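/- Let $n\ge 1$ and write points of $\mathbb{C}^n$ as $z=(z',z_n)=x+iy$. Let $$T_B=\{z=x+iy\in\mathbb{C}^n:\ |y'|^2<y_n\},\qquad \rho(z,w)=\tfrac14\Big(\sum_{j<n}(z_j-\overline{w_j})^2-2i(z_n-\overline{w_n})\Big),\qquad \rho(z)=\rho(z,z)=y_n-|y'|^2,$$ and $\mathbf i=(0',i)$. The notation $z\to\partial\widehat{T_B}$ means that $z\in T_B$ and $\rho(z)\to0$ or $|z|\to\infty$, and $C_0(T_B)$ is the space of continuous $f:T_B\to\mathbb{C}$ with $f(z)\to0$ as $z\to\partial\widehat{T_B}$. For $\alpha>-1$ let $dV_\alpha=\rho(z)^\alpha dV$, where $dV$ is Lebesgue measure. For $1<p<\infty$ let $A^p_\alpha(T_B)$ be the space of holomorphic functions in $L^p(T_B,dV_\alpha)$, with the norm $\|\cdot\|_{p,\alpha}$ of that space, and let $$K_\alpha(z,w)=\frac{\Gamma(n+\alpha+1)}{2^{n+1}\pi^n\,\Gamma(\alpha+1)\,\rho(z,w)^{n+\alpha+1}}$$ (principal power; $\operatorname{Re}\rho(z,w)>0$ on $T_B\times T_B$). Let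 $\beta$ be the Bergman distance on $T_B$, $\beta(z,w)=\inf_\gamma\int_0^1\langle \mathbf B(\gamma)\gamma',\gamma'\rangle^{1/2}dt$ over smooth curves $\gamma:[0,1]\to T_B$ from $z$ to $w$, where $\mathbf B(z)=\frac1{n+1}\big(\frac{\partial^2}{\partial\bar z_i\partial z_j}\log K_0(z,z)\big)_{i,j}$, and let $D(z,r)=\{w\in T_B:\beta(z,w)<r\}$. For a positive Borel measure $\mu$ on $T_B$ and $z\in T_B$ put $$\widetilde\mu(z)=\int_{T_B}\frac{|K_\alpha(z,w)|^2}{K_\alpha(z,z)}\,d\mu(w),\qquad \widehat\mu_r(z)=\frac{\mu(D(z,r))}{V_\alpha(D(z,r))},\qquad T_\mu f(z)=\int_{T_B}K_\alpha(z,w)f(w)\,d\mu(w).$$ Let $\mathcal M_+$ be the set of positive Borel measures $\mu$ on $T_B$ such that $\int_{T_B}|\rho(z,\mathbf i)|^{-t}d\mu(z)<\infty$ for some $t>0$. For $t\in\mathbb{R}$ let $S_t$ be the space of holomorphic $f$ on $T_B$ with $\sup_{z\in T_B}|\rho(z,\mathbf i)|^t|f(z)|<\infty$. The measure $\mu$ is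 a vanishing Carleson measure for $A^q_\alpha(T_B)$ if $\int_{T_B}|f_k|^q\,d\mu\to0$ for every bounded sequence $(f_k)$ in $A^q_\alpha(T_B)$ that converges to $0$ uniformly on compact subsets of $T_B$. **Theorem.** Let $r>0$, $1<p,q<\infty$, $\alpha>-1$ and $\mu\in\mathcal M_+$, and let $t$ be any number with $t>n+(\alpha+1)/p$ and $\int_{T_B}|\rho(z,\mathbf i)|^{-t}d\mu(z)<\infty$ (every sufficiently large $t$ is such a number). Then the following are equivalent: 1. $T_\mu$ is compact on $A^p_\alpha(T_B)$, that is, $T_\mu$, given on the dense subspace $S_t$ by the integral above, extends to a compact operator on $A^p_\alpha(T_B)$; 2. $\widetilde\mu$ is finite on $T_B$ and belongs to $C_0(T_B)$; 3. $\widehat\mu_r(z)\to0$ as $z\to\partial\widehat{T_B}$; 4. $\mu$ is a vanishing Carleson measure for $A^q_\alpha(T_B)$. -/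

import Mathlib

open MeasureTheory Filter Topology Set
open scoped ENNReal

noncomputable section

namespace TubeBergman

/-- The space `ℂⁿ` with `n = m + 1 ≥ 1`; a point is `z = (z', z_n)`, with `z' = (z 0, …, z (m-1))`
and `z_n = z (Fin.last m)`. Only the topology, the bounded sets, the Borel sets and the Lebesgue
measure of this space are used below, and those are the standard ones. -/
abbrev Cn (m : ℕ) : Type := Fin (m + 1) → ℂ

/-- `ρ(z, w) = ((z' - conj w')² - 2 i (z_n - conj w_n)) / 4`. -/
def rhoPair {m : ℕ} (z w : Cn m) : ℂ :=
  (1 / 4) * ((∑ j : Fin m, (z j.castSucc - star (w j.castSucc)) ^ 2)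
    - 2 * Complex.I * (z (Fin.last m) - star (w (Fin.last m))))

/-- `ρ(z) = y_n - |y'|²`, where `y = Im z`. -/
def rho {m : ℕ} (z : Cn m) : ℝ :=
  (z (Fin.last m)).im - ∑ j : Fin m, (z j.castSucc).im ^ 2

/-- The tubular domain `T_B = {x + i y : |y'|² < y_n}`. -/
def TB (m : ℕ) : Set (Cn m) :=
  {z | ∑ j : Fin m, (z j.castSucc).im ^ 2 < (z (Fin.last m)).im}

/-- The base point `𝐢 = (0', i)`. -/
def basePt (m : ℕ) : Cn m := Pi.single (Fin.last m) Complex.I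

/-- The weighted volume `dV_α = ρ(z)^α dV` on `T_B`. -/
def Valpha (m : ℕ) (α : ℝ) : Measure (Cn m) :=
  (volume.restrict (TB m)).withDensity (fun z => ENNReal.ofReal (rho z ^ α))

/-- The weighted Bergman kernel
`K_α(z, w) = Γ(n+α+1) / (2^(n+1) π^n Γ(α+1) ρ(z,w)^(n+α+1))`. For `z, w ∈ T_B` the real part of
`ρ(z, w)` is positive, and the power is the principal one. -/
def bergmanKernel {m : ℕ} (α : ℝ) (z w : Cn m) : ℂ :=
  ((Real.Gamma ((m + 1 : ℝ) + α + 1) /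
      (2 ^ (m + 2) * Real.pi ^ (m + 1) * Real.Gamma (α + 1)) : ℝ) : ℂ) /
    rhoPair z w ^ (((m + 1 : ℝ) + α + 1 : ℝ) : ℂ)

/-- The filter of `z → ∂T̂_B` in `T_B`: `ρ(z) → 0` or `|z| → ∞`. -/
def toBoundary (m : ℕ) : Filter (Cn m) :=
  (comap rho (𝓝 0) ⊔ Bornology.cobounded (Cn m)) ⊓ 𝓟 (TB m)

/-- `f ∈ C_0(T_B)`: continuous on `T_B`, with `f(z) → 0` as `z → ∂T̂_B`. -/
def MemC0 {m : ℕ} (f : Cn m → ℂ) : Prop :=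
  ContinuousOn f (TB m) ∧ Tendsto f (toBoundary m) (𝓝 0)

/-! ### The Bergman metric -/

/-- The Wirtinger derivative `∂f/∂z_j`. -/
def dz {m : ℕ} (j : Fin (m + 1)) (f : Cn m → ℂ) (z : Cn m) : ℂ :=
  (1 / 2) * (fderiv ℝ f z (Pi.single j 1) - Complex.I * fderiv ℝ f z (Pi.single j Complex.I))

/-- The Wirtinger derivative `∂f/∂(conj z_j)`. -/
def dzbar {m : ℕ} (j : Fin (m + 1)) (f : Cn m → ℂ) (z : Cn m) : ℂ :=
  (1 / 2) * (fderiv ℝ f z (Pi.single j 1) + Complex.I * fderiv ℝ f z (Pi.single j Complex.I))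

/-- The Bergman matrix `(1/(n+1)) (∂²/∂(conj z_i)∂z_j log K(z,z))`, with `K` the (unweighted)
Bergman kernel of `T_B`. -/
def bergmanMatrix {m : ℕ} (z : Cn m) : Matrix (Fin (m + 1)) (Fin (m + 1)) ℂ :=
  Matrix.of fun i j => (1 / ((m : ℂ) + 2)) *
    dzbar i (dz j (fun u : Cn m => ((Real.log (bergmanKernel 0 u u).re : ℝ) : ℂ))) z

/-- The length `√⟨B(z)v, v⟩` of a tangent vector `v` at `z`. -/
def bergmanNorm {m : ℕ} (z v : Cn m) : ℝ :=
  Real.sqrt (∑ i, (bergmanMatrix z).mulVec v i * star (v i)).re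

/-- The length of a curve parametrized by `[0, 1]`. -/
def bergmanLength {m : ℕ} (γ : ℝ → Cn m) : ℝ :=
  ∫ t in (0 : ℝ)..1, bergmanNorm (γ t) (derivWithin γ (Icc 0 1) t)

/-- The Bergman distance: the infimum of the lengths of the smooth curves in `T_B` from `z`
to `w`. -/
def bergmanDist {m : ℕ} (z w : Cn m) : ℝ :=
  sInf {l : ℝ | ∃ γ : ℝ → Cn m, ContDiffOn ℝ ((⊤ : ℕ∞) : WithTop ℕ∞) γ (Icc 0 1) ∧ MapsTo γ (Icc 0 1) (TB m) ∧
    γ 0 = z ∧ γ 1 = w ∧ l = bergmanLength γ}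

/-- The Bergman ball `D(z, r)`. -/
def bergmanBall {m : ℕ} (z : Cn m) (r : ℝ) : Set (Cn m) :=
  {w | w ∈ TB m ∧ bergmanDist z w < r}

/-! ### Bergman spaces -/

/-- `F` is (a representative of) an element of `A^p_α(T_B)`: it is holomorphic on `T_B` and
lies in `L^p_α(T_B)`. -/
def MemBergman {m : ℕ} (α p : ℝ) (F : Cn m → ℂ) : Prop :=
  DifferentiableOn ℂ F (TB m) ∧ MemLp F (ENNReal.ofReal p) (Valpha m α)

/-- The Bergman space `A^p_α(T_B)` as a subspace of `L^p(T_B, dV_α)`: the classes that have a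
holomorphic representative. -/
def bergmanSpace (m : ℕ) (α p : ℝ) :
    Submodule ℂ (Lp ℂ (ENNReal.ofReal p) (Valpha m α)) where
  carrier := {f | ∃ F : Cn m → ℂ, MemBergman α p F ∧ f =ᵐ[Valpha m α] F}
  add_mem' := by
    rintro f g ⟨F, hF, hfF⟩ ⟨G, hG, hgG⟩
    exact ⟨F + G, ⟨hF.1.add hG.1, hF.2.add hG.2⟩, (Lp.coeFn_add f g).trans (hfF.add hgG)⟩
  zero_mem' := ⟨0, ⟨differentiableOn_const 0, MemLp.zero⟩, Lp.coeFn_zero _ _ _⟩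
  smul_mem' := by
    rintro c f ⟨F, hF, hfF⟩
    exact ⟨c • F, ⟨hF.1.const_smul c, hF.2.const_smul c⟩,
      (Lp.coeFn_smul c f).trans (hfF.const_smul c)⟩

/-- The space `S_t` of the holomorphic functions `f` on `T_B` with
`sup |ρ(z, 𝐢)|^t |f(z)| < ∞`. -/
def MemS {m : ℕ} (t : ℝ) (f : Cn m → ℂ) : Prop :=
  DifferentiableOn ℂ f (TB m) ∧
    ∃ C : ℝ, ∀ z ∈ TB m, ‖rhoPair z (basePt m)‖ ^ t * ‖f z‖ ≤ C

/-! ### Positive Borel measures on `T_B`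

A positive Borel measure on `T_B` is given as a Borel measure on `ℂⁿ`, of which only the
restriction to `T_B` is used. -/

/-- `∫_{T_B} |ρ(z, 𝐢)|^(-t) dμ(z) < ∞`. -/
def HasDecay {m : ℕ} (t : ℝ) (μ : Measure (Cn m)) : Prop :=
  ∫⁻ z in TB m, ENNReal.ofReal (1 / ‖rhoPair z (basePt m)‖ ^ t) ∂μ < ⊤

/-- The class `𝓜_+`. -/
def MPlus (m : ℕ) : Set (Measure (Cn m)) :=
  {μ | ∃ t : ℝ, 0 < t ∧ HasDecay t μ}

/-- The integral `T_μ f(z) = ∫_{T_B} K_α(z, w) f(w) dμ(w)`. -/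
def toeplitz {m : ℕ} (α : ℝ) (μ : Measure (Cn m)) (f : Cn m → ℂ) (z : Cn m) : ℂ :=
  ∫ w in TB m, bergmanKernel α z w * f w ∂μ

/-- The Toeplitz operator with domain `S_t`, given there by the integral `T_μ f`, extends to a
compact operator on `A^p_α(T_B)`. -/
def ToeplitzCompact {m : ℕ} (α p t : ℝ) (hp : 1 < p) (μ : Measure (Cn m)) : Prop :=
  haveI : Fact (1 ≤ ENNReal.ofReal p) := ⟨ENNReal.one_le_ofReal.2 hp.le⟩
  ∃ T : bergmanSpace m α p →L[ℂ] bergmanSpace m α p, IsCompactOperator T ∧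
    ∀ (f : bergmanSpace m α p) (F : Cn m → ℂ), MemS t F →
      ((f : Lp ℂ (ENNReal.ofReal p) (Valpha m α)) : Cn m → ℂ) =ᵐ[Valpha m α] F →
      ((T f : Lp ℂ (ENNReal.ofReal p) (Valpha m α)) : Cn m → ℂ) =ᵐ[Valpha m α] toeplitz α μ F

/-- The normalized kernel `k_z(w) = K_α(z, w) / √K_α(z, z)`. -/
def normalizedKernel {m : ℕ} (α : ℝ) (z w : Cn m) : ℂ :=
  bergmanKernel α z w / (Real.sqrt (bergmanKernel α z z).re : ℂ)

/-- `μ̃(z) = ∫_{T_B} |k_z(w)|² dμ(w)`, a value in `[0, ∞]`. -/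
def berezin {m : ℕ} (α : ℝ) (μ : Measure (Cn m)) (z : Cn m) : ℝ≥0∞ :=
  ∫⁻ w in TB m, ‖normalizedKernel α z w‖ₑ ^ 2 ∂μ

/-- `μ̃` is finite on `T_B` and belongs to `C_0(T_B)`. -/
def BerezinMemC0 {m : ℕ} (α : ℝ) (μ : Measure (Cn m)) : Prop :=
  (∀ z ∈ TB m, berezin α μ z ≠ ⊤) ∧ MemC0 (fun z => ((berezin α μ z).toReal : ℂ))

/-- The averaging function `μ̂_r(z) = μ(D(z, r)) / V_α(D(z, r))`, a value in `[0, ∞]`. -/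
def averaging {m : ℕ} (α r : ℝ) (μ : Measure (Cn m)) (z : Cn m) : ℝ≥0∞ :=
  μ (bergmanBall z r) / Valpha m α (bergmanBall z r)

/-- `μ` is a vanishing Carleson measure for `A^q_α(T_B)`. -/
def VanishingCarleson {m : ℕ} (α q : ℝ) (μ : Measure (Cn m)) : Prop :=
  ∀ f : ℕ → Cn m → ℂ, (∀ k, MemBergman α q (f k)) →
    (∃ M : ℝ, ∀ k, eLpNorm (f k) (ENNReal.ofReal q) (Valpha m α) ≤ ENNReal.ofReal M) →
    (∀ K : Set (Cn m), IsCompact K → K ⊆ TB m → TendstoUniformlyOn f 0 atTop K) →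
    Tendsto (fun k => ∫⁻ w in TB m, ‖f k w‖ₑ ^ q ∂μ) atTop (𝓝 0)

end TubeBergman

end

open TubeBergman

/-! Put n = m + 1 and N = n + 1 + α = m + 2 + α. The tube is affinely homogeneous: the maps `phi w`
act simply transitively, send 𝐢 to w, and satisfy ρ(φ_w z, φ_w u) = ρ(w) ρ(z, u). Hence the Bergman
metric is invariant, dV_α scales by ρ(w)^N, and estimates can be proved at 𝐢 and transported. In the
coordinate `psi z`, the Bergman balls of radius r about z contain a fixed sup-norm ball about 𝐢 and
lie in a fixed compact set. Averages over Bergman balls therefore dominate averages over small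
affine cells (`cellAvg`). If the cell averages tend to 0 at the boundary, conditions 1, 2 and 4
follow, and each of these gives back condition 3.

From averages to operators. The submean value property on cells and Tonelli's theorem give ∫ |h|^q
dμ ≤ C ∫ |h|^q `cellAvg` dV_α for holomorphic h (`exists_carleson`). When the weight on the right is
bounded and vanishes at the boundary, a bounded family that tends to 0 locally uniformly has
integrals tending to 0: this is the vanishing Carleson property. The Berezin transform is, up to a
constant, the L²(μ) mass of such a family, the normalized kernels. For T_μ, the case q = 1 applied
to the kernel times f bounds |T_μ f| by a positive integral operator with kernel |ρ(z, u)|^(-N)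
acting on |f| `cellAvg`. Schur's test (`exists_absOp_bound`) gives ‖T_μ f‖_p ≤ C ‖f `cellAvg`‖_p.
The part of the right side near the boundary is small in norm, and the part on a compact set is
controlled by finitely many point values, so T_μ is compact.

Back to averages. On a Bergman ball |ρ(w, z)| is at most a constant times ρ(z), so the average at z
is dominated by ∫ ρ(z)^(x - N) |ρ(w, z)|^(-x) dμ(w), for any fixed x ≥ 0 (`exists_averaging_le`).
With x = 2N this is the Berezin transform. In general it is an integral of the test functions f_z(w)
= ρ(z)^(b - a) ρ(w, z)^(-b); when a p = N and b > a, their norm in A^p_α does not depend on z, and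
they tend to 0 locally uniformly at the boundary. This settles conditions 2 and 4.

For condition 1 the test functions must lie in S_t, which is ensured by b = N + k with k large. Then
T_μ f_z(z) has kernel exponent N against exponent N + k, and its integrand need not be positive.
Applying ∂/∂z_n k times raises the kernel exponent to N + k; the integrand becomes a multiple of
|ρ(w, z)|^(-2(N + k)), and Cauchy's estimate bounds the derivative by ‖T f_z‖. So the average at z
is at most C ‖T f_z‖ (`exists_lintegral_le_norm_toeplitz`). Boundedness of T first bounds the
averages; this yields T f_z → 0 pointwise, and compactness upgrades it to convergence in norm. -/

noncomputable section

namespace TubeBergman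

/-! ### Affine automorphisms of the tube domain -/

section Automorphisms

variable {m : ℕ}

/-- The linear part of `phi w`. -/
def phiLin (w : Cn m) : Cn m →ₗ[ℂ] Cn m where
  toFun z := Fin.snoc (α := fun _ => ℂ) (fun j : Fin m => (√(rho w) : ℂ) * z j.castSucc)
    ((rho w : ℂ) * z (Fin.last m) +
      2 * (√(rho w) : ℂ) * ∑ j : Fin m, ((w j.castSucc).im : ℂ) * z j.castSucc)
  map_add' x y := by
    funext i
    refine Fin.lastCases ?_ (fun j => ?_) i
    · simp only [Fin.snoc_last, Pi.add_apply, mul_add, Finset.sum_add_distrib]; ring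
    · simp only [Fin.snoc_castSucc, Pi.add_apply, mul_add]
  map_smul' c x := by
    funext i
    refine Fin.lastCases ?_ (fun j => ?_) i
    · simp only [Fin.snoc_last, Pi.smul_apply, smul_eq_mul, RingHom.id_apply, mul_add,
        Finset.mul_sum]
      congr 1
      · ring
      · exact Finset.sum_congr rfl fun j _ => by ring
    · simp only [Fin.snoc_castSucc, Pi.smul_apply, smul_eq_mul, RingHom.id_apply]; ring

/-- The translation part of `phi w`. -/
def phiShift (w : Cn m) : Cn m :=
  Fin.snoc (α := fun _ => ℂ) (fun j : Fin m => w j.castSucc)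
    (((w (Fin.last m)).re : ℂ) + Complex.I * ((∑ j : Fin m, (w j.castSucc).im ^ 2 : ℝ) : ℂ))

/-- The affine automorphism of the tube that maps `𝐢` to `w`. -/
def phi (w z : Cn m) : Cn m := phiLin w z + phiShift w

/-- The inverse of `phi w`. -/
def psi (w z : Cn m) : Cn m :=
  Fin.snoc (α := fun _ => ℂ) (fun j : Fin m => (z j.castSucc - w j.castSucc) / (√(rho w) : ℂ))
    ((z (Fin.last m) - (w (Fin.last m)).re
      - Complex.I * ((∑ j : Fin m, (w j.castSucc).im ^ 2 : ℝ) : ℂ)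
      - 2 * ∑ j : Fin m, ((w j.castSucc).im : ℂ) * (z j.castSucc - w j.castSucc)) / (rho w : ℂ))

theorem phiLin_castSucc (w z : Cn m) (j : Fin m) :
    phiLin w z j.castSucc = (√(rho w) : ℂ) * z j.castSucc := by
  simp [phiLin]

theorem phiLin_last (w z : Cn m) :
    phiLin w z (Fin.last m) = (rho w : ℂ) * z (Fin.last m) +
      2 * (√(rho w) : ℂ) * ∑ j : Fin m, ((w j.castSucc).im : ℂ) * z j.castSucc := by
  simp [phiLin]

theorem phi_castSucc (w z : Cn m) (j : Fin m) :
    phi w z j.castSucc = (√(rho w) : ℂ) * z j.castSucc + w j.castSucc := by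
  simp [phi, phiLin_castSucc, phiShift]

theorem phi_last (w z : Cn m) :
    phi w z (Fin.last m) = (rho w : ℂ) * z (Fin.last m) +
      2 * (√(rho w) : ℂ) * (∑ j : Fin m, ((w j.castSucc).im : ℂ) * z j.castSucc) +
      (((w (Fin.last m)).re : ℂ)
        + Complex.I * ((∑ j : Fin m, (w j.castSucc).im ^ 2 : ℝ) : ℂ)) := by
  simp [phi, phiLin_last, phiShift]

theorem psi_castSucc (w z : Cn m) (j : Fin m) :
    psi w z j.castSucc = (z j.castSucc - w j.castSucc) / (√(rho w) : ℂ) := by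
  simp [psi]

theorem psi_last (w z : Cn m) :
    psi w z (Fin.last m) = (z (Fin.last m) - (w (Fin.last m)).re
      - Complex.I * ((∑ j : Fin m, (w j.castSucc).im ^ 2 : ℝ) : ℂ)
      - 2 * ∑ j : Fin m, ((w j.castSucc).im : ℂ) * (z j.castSucc - w j.castSucc)) /
        (rho w : ℂ) := by
  simp [psi]

theorem mem_TB_iff {z : Cn m} : z ∈ TB m ↔ 0 < rho z := by
  simp [TB, rho]

theorem continuous_rho : Continuous (rho : Cn m → ℝ) := by
  unfold rho; fun_prop

theorem isOpen_TB : IsOpen (TB m) := by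
  have : TB m = rho ⁻¹' Ioi 0 := by ext z; simp [mem_TB_iff]
  rw [this]
  exact isOpen_Ioi.preimage continuous_rho

theorem measurableSet_TB : MeasurableSet (TB m) := isOpen_TB.measurableSet

theorem rho_basePt : rho (basePt m) = 1 := by
  simp [rho, basePt]

theorem basePt_mem : basePt m ∈ TB m := by
  rw [mem_TB_iff, rho_basePt]; exact one_pos

theorem basePt_castSucc (j : Fin m) : basePt m j.castSucc = 0 := by
  simp [basePt]

theorem basePt_last : basePt m (Fin.last m) = Complex.I := by
  simp [basePt]

theorem sq_sqrt_rho {w : Cn m} (hw : w ∈ TB m) : (√(rho w) : ℂ) ^ 2 = rho w := by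
  rw [← Complex.ofReal_pow, Real.sq_sqrt (mem_TB_iff.1 hw).le]

theorem sqrt_rho_ne {w : Cn m} (hw : w ∈ TB m) : (√(rho w) : ℂ) ≠ 0 := by
  simpa using (Real.sqrt_pos.2 (mem_TB_iff.1 hw)).ne'

theorem psi_phi {w : Cn m} (hw : w ∈ TB m) (z : Cn m) : psi w (phi w z) = z := by
  have h1 := sqrt_rho_ne hw
  have h2 : (rho w : ℂ) ≠ 0 := by rw [← sq_sqrt_rho hw]; exact pow_ne_zero 2 h1
  funext i
  refine Fin.lastCases ?_ (fun j => ?_) i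
  · rw [psi_last, phi_last]
    have : ∑ j : Fin m, ((w j.castSucc).im : ℂ) * (phi w z j.castSucc - w j.castSucc) =
        √(rho w) * ∑ j : Fin m, ((w j.castSucc).im : ℂ) * z j.castSucc := by
      rw [Finset.mul_sum]
      exact Finset.sum_congr rfl fun j _ => by rw [phi_castSucc]; ring
    rw [this]
    field_simp
    ring
  · rw [psi_castSucc, phi_castSucc]; field_simp; ring

theorem phi_psi {w : Cn m} (hw : w ∈ TB m) (z : Cn m) : phi w (psi w z) = z := by
  have h1 := sqrt_rho_ne hw
  have h2 : (rho w : ℂ) ≠ 0 := by rw [← sq_sqrt_rho hw]; exact pow_ne_zero 2 h1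
  funext i
  refine Fin.lastCases ?_ (fun j => ?_) i
  · rw [phi_last, psi_last]
    have : 2 * (√(rho w) : ℂ) * ∑ j : Fin m, ((w j.castSucc).im : ℂ) * psi w z j.castSucc =
        2 * ∑ j : Fin m, ((w j.castSucc).im : ℂ) * (z j.castSucc - w j.castSucc) := by
      rw [mul_assoc, Finset.mul_sum]
      congr 1
      exact Finset.sum_congr rfl fun j _ => by rw [psi_castSucc]; field_simp
    rw [this, mul_div_cancel₀ _ h2]
    ring
  · rw [phi_castSucc, psi_castSucc]; field_simp; ring

theorem continuous_phi (w : Cn m) : Continuous (phi w) := by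
  have : Continuous (phiLin w) := LinearMap.continuous_of_finiteDimensional _
  unfold phi; fun_prop

theorem continuous_psi (w : Cn m) : Continuous (psi w) := by
  refine Continuous.finSnoc (A := fun _ => ℂ) ?_ ?_ <;> fun_prop

theorem measurable_psi : Measurable fun x : Cn m × Cn m => psi x.1 x.2 := by
  have h : Measurable (rho : Cn m → ℝ) := continuous_rho.measurable
  refine measurable_pi_iff.2 fun i => ?_
  refine Fin.lastCases ?_ (fun j => ?_) i
  · simp only [psi_last]; fun_prop
  · simp only [psi_castSucc]; fun_prop

/-- `phi w` as a homeomorphism. -/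
def phiHomeo {w : Cn m} (hw : w ∈ TB m) : Cn m ≃ₜ Cn m where
  toFun := phi w
  invFun := psi w
  left_inv := psi_phi hw
  right_inv := phi_psi hw
  continuous_toFun := continuous_phi w
  continuous_invFun := continuous_psi w

theorem im_sum_real_mul (w z : Cn m) :
    (∑ j : Fin m, ((w j.castSucc).im : ℂ) * z j.castSucc).im =
      ∑ j : Fin m, (w j.castSucc).im * (z j.castSucc).im := by
  simp [Complex.im_sum]

theorem phi_last_im {w : Cn m} (z : Cn m) :
    (phi w z (Fin.last m)).im = rho w * (z (Fin.last m)).im +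
      2 * √(rho w) * (∑ j : Fin m, (w j.castSucc).im * (z j.castSucc).im) +
      ∑ j : Fin m, (w j.castSucc).im ^ 2 := by
  rw [phi_last]
  have h : ∀ (a : ℝ) (c : ℂ), (2 * (a : ℂ) * c).im = 2 * a * c.im := by
    intro a c; simp [Complex.mul_im]
  have h' : ∀ a : ℝ, (Complex.I * (a : ℂ)).im = a := by intro a; simp
  rw [Complex.add_im, Complex.add_im, h, im_sum_real_mul, Complex.add_im, h',
    Complex.im_ofReal_mul, Complex.ofReal_im, zero_add]

theorem rho_phi {w : Cn m} (hw : w ∈ TB m) (z : Cn m) : rho (phi w z) = rho w * rho z := by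
  have h := Real.sq_sqrt (mem_TB_iff.1 hw).le
  rw [rho, phi_last_im]
  have : ∑ j : Fin m, (phi w z j.castSucc).im ^ 2 =
      rho w * ∑ j : Fin m, (z j.castSucc).im ^ 2 +
      2 * √(rho w) * (∑ j : Fin m, (w j.castSucc).im * (z j.castSucc).im) +
      ∑ j : Fin m, (w j.castSucc).im ^ 2 := by
    rw [Finset.mul_sum, Finset.mul_sum, ← Finset.sum_add_distrib, ← Finset.sum_add_distrib]
    refine Finset.sum_congr rfl fun j _ => ?_
    rw [phi_castSucc, Complex.add_im, Complex.im_ofReal_mul]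
    linear_combination (z j.castSucc).im ^ 2 * h
  rw [this]
  unfold rho
  ring

theorem phi_mem {w : Cn m} (hw : w ∈ TB m) {z : Cn m} : phi w z ∈ TB m ↔ z ∈ TB m := by
  rw [mem_TB_iff, mem_TB_iff, rho_phi hw]
  exact mul_pos_iff_of_pos_left (mem_TB_iff.1 hw)

theorem psi_mem {w : Cn m} (hw : w ∈ TB m) {z : Cn m} : psi w z ∈ TB m ↔ z ∈ TB m := by
  rw [← phi_mem hw, phi_psi hw]

theorem rho_psi {w : Cn m} (hw : w ∈ TB m) (z : Cn m) : rho z = rho w * rho (psi w z) := by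
  rw [← rho_phi hw, phi_psi hw]

theorem phi_basePt (w : Cn m) : phi w (basePt m) = w := by
  funext i
  refine Fin.lastCases ?_ (fun j => ?_) i
  · rw [phi_last]
    simp only [basePt_castSucc, basePt_last, mul_zero, Finset.sum_const_zero, add_zero]
    apply Complex.ext
    · simp [-Complex.ofReal_sum]
    · simp [rho, -Complex.ofReal_sum]
  · simp [phi_castSucc, basePt_castSucc]

theorem psi_eq_of_phi_eq {w u : Cn m} (hw : w ∈ TB m) {z : Cn m} (h : phi w u = z) :
    psi w z = u := by rw [← h, psi_phi hw]

theorem psi_self {w : Cn m} (hw : w ∈ TB m) : psi w w = basePt m :=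
  psi_eq_of_phi_eq hw (phi_basePt w)

/-- The group law: the automorphisms are parametrized by the image of 𝐢, and composition corresponds
to moving that image. -/
theorem phi_phi {w : Cn m} (hw : w ∈ TB m) (u z : Cn m) :
    phi (phi w u) z = phi w (phi u z) := by
  have hr := (mem_TB_iff.1 hw).le
  have hs : √(rho (phi w u)) = √(rho w) * √(rho u) := by
    rw [rho_phi hw, Real.sqrt_mul hr]
  have h := sq_sqrt_rho hw
  funext i
  refine Fin.lastCases ?_ (fun j => ?_) i
  · rw [phi_last, phi_last w (phi u z), hs, rho_phi hw, phi_last u z]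
    have e1 : ∑ j : Fin m, ((phi w u j.castSucc).im : ℂ) * z j.castSucc =
        √(rho w) * (∑ j : Fin m, ((u j.castSucc).im : ℂ) * z j.castSucc) +
        ∑ j : Fin m, ((w j.castSucc).im : ℂ) * z j.castSucc := by
      rw [Finset.mul_sum, ← Finset.sum_add_distrib]
      refine Finset.sum_congr rfl fun j _ => ?_
      rw [phi_castSucc, Complex.add_im, Complex.im_ofReal_mul]; push_cast; ring
    have e2 : ∑ j : Fin m, ((w j.castSucc).im : ℂ) * phi u z j.castSucc =
        √(rho u) * (∑ j : Fin m, ((w j.castSucc).im : ℂ) * z j.castSucc) +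
        ∑ j : Fin m, ((w j.castSucc).im : ℂ) * u j.castSucc := by
      rw [Finset.mul_sum, ← Finset.sum_add_distrib]
      refine Finset.sum_congr rfl fun j _ => ?_
      rw [phi_castSucc]; ring
    -- In the form z_n - iρ(z) the translation part is computed from `phi_last` and `rho_phi`, with
    -- no separate treatment of the squares.
    have e3 : ((phi w u (Fin.last m)).re : ℂ) +
        Complex.I * ((∑ j : Fin m, (phi w u j.castSucc).im ^ 2 : ℝ) : ℂ) =
        phi w u (Fin.last m) - Complex.I * rho (phi w u) := by
      apply Complex.ext
      · simp [-Complex.ofReal_sum]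
      · simp [rho, -Complex.ofReal_sum]
    have e4 : ((u (Fin.last m)).re : ℂ) +
        Complex.I * ((∑ j : Fin m, (u j.castSucc).im ^ 2 : ℝ) : ℂ) =
        u (Fin.last m) - Complex.I * rho u := by
      apply Complex.ext
      · simp [-Complex.ofReal_sum]
      · simp [rho, -Complex.ofReal_sum]
    rw [e1, e2, e3, e4, phi_last, rho_phi hw]
    push_cast
    linear_combination (2 * (√(rho u) : ℂ) *
      ∑ j : Fin m, ((u j.castSucc).im : ℂ) * z j.castSucc) * h
  · rw [phi_castSucc, phi_castSucc, phi_castSucc, phi_castSucc, hs]; push_cast; ring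

theorem psi_phi_self {w u : Cn m} (hw : w ∈ TB m) (hu : u ∈ TB m) :
    psi (phi w u) w = psi u (basePt m) := by
  apply psi_eq_of_phi_eq ((phi_mem hw).2 hu)
  rw [phi_phi hw u, phi_psi hu, phi_basePt w]

/-- `ψ_z w` depends only on `ψ_w z`. -/
theorem psi_swap {w z : Cn m} (hw : w ∈ TB m) (hz : z ∈ TB m) :
    psi z w = psi (psi w z) (basePt m) := by
  conv_lhs => rw [← phi_psi hw z]
  exact psi_phi_self hw ((psi_mem hw).2 hz)

/-- Polarized form of `rho_phi`. Together with the Jacobian it reduces kernel estimates at an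
arbitrary point to estimates at 𝐢. -/
theorem rhoPair_phi {w : Cn m} (hw : w ∈ TB m) (z u : Cn m) :
    rhoPair (phi w z) (phi w u) = rho w * rhoPair z u := by
  have h := sq_sqrt_rho hw
  have e1 : ∑ j : Fin m, (phi w z j.castSucc - star (phi w u j.castSucc)) ^ 2 =
      rho w * ∑ j : Fin m, (z j.castSucc - star (u j.castSucc)) ^ 2 +
      4 * Complex.I * √(rho w) * (∑ j : Fin m, ((w j.castSucc).im : ℂ) * z j.castSucc) -
      4 * Complex.I * √(rho w) * (∑ j : Fin m, ((w j.castSucc).im : ℂ) * star (u j.castSucc)) -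
      4 * ((∑ j : Fin m, (w j.castSucc).im ^ 2 : ℝ) : ℂ) := by
    push_cast
    rw [Finset.mul_sum, Finset.mul_sum, Finset.mul_sum, Finset.mul_sum, ← Finset.sum_add_distrib,
      ← Finset.sum_sub_distrib, ← Finset.sum_sub_distrib]
    refine Finset.sum_congr rfl fun j _ => ?_
    have : w j.castSucc - star (w j.castSucc) = 2 * Complex.I * (w j.castSucc).im := by
      apply Complex.ext <;> simp; ring
    rw [phi_castSucc, phi_castSucc, star_add, star_mul']
    have hr : star ((√(rho w) : ℝ) : ℂ) = √(rho w) := Complex.conj_ofReal _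
    rw [hr]
    have : (√(rho w) : ℂ) * z j.castSucc + w j.castSucc -
        (√(rho w) * star (u j.castSucc) + star (w j.castSucc)) =
        √(rho w) * (z j.castSucc - star (u j.castSucc)) + 2 * Complex.I * (w j.castSucc).im := by
      linear_combination this
    rw [this]
    linear_combination (z j.castSucc - star (u j.castSucc)) ^ 2 * h +
      4 * ((w j.castSucc).im : ℂ) ^ 2 * Complex.I_sq
  have e2 : star (phi w u (Fin.last m)) = rho w * star (u (Fin.last m)) +
      2 * √(rho w) * (∑ j : Fin m, ((w j.castSucc).im : ℂ) * star (u j.castSucc)) +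
      ((w (Fin.last m)).re - Complex.I * ((∑ j : Fin m, (w j.castSucc).im ^ 2 : ℝ) : ℂ)) := by
    rw [phi_last]
    simp only [star_add, star_mul', star_sum, Complex.star_def, Complex.conj_ofReal,
      Complex.conj_I, map_ofNat]
    ring
  unfold rhoPair
  rw [e1, e2, phi_last]
  linear_combination (- ((∑ j : Fin m, (w j.castSucc).im ^ 2 : ℝ) : ℂ)) * Complex.I_sq

/-- The matrix is triangular: the first m coordinates are scaled separately, and only the last one
mixes with the others. -/
theorem det_phiLin (w : Cn m) : LinearMap.det (phiLin w) = (√(rho w) : ℂ) ^ m * rho w := by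
  rw [← LinearMap.det_toMatrix', Matrix.det_of_isLowerTriangular, Fin.prod_univ_castSucc]
  · have h1 : ∀ i : Fin m, LinearMap.toMatrix' (phiLin w) i.castSucc i.castSucc
        = (√(rho w) : ℂ) := by
      intro i; simp [LinearMap.toMatrix'_apply, phiLin_castSucc]
    have h2 : LinearMap.toMatrix' (phiLin w) (Fin.last m) (Fin.last m) = (rho w : ℂ) := by
      simp [LinearMap.toMatrix'_apply, phiLin_last]
    simp [h1, h2]
  · intro i j hij
    rw [LinearMap.toMatrix'_apply]
    revert hij
    refine Fin.lastCases ?_ (fun i => ?_) i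
    · intro hij
      exact absurd hij (by simpa using Fin.le_last j)
    · intro hij
      rw [phiLin_castSucc]
      have : i.castSucc ≠ j := by rintro rfl; simp at hij
      simp [this]

theorem map_phi_volume {w : Cn m} (hw : w ∈ TB m) :
    Measure.map (phi w) volume = ENNReal.ofReal ((rho w ^ (m + 2))⁻¹) • (volume : Measure (Cn m)) := by
  have hr := mem_TB_iff.1 hw
  -- The real determinant is the squared modulus of the complex one: ρ^m from the first m
  -- coordinates and ρ² from the last.
  have hd : LinearMap.det ((phiLin w).restrictScalars ℝ) = rho w ^ (m + 2) := by
    rw [LinearMap.det_restrictScalars, det_phiLin, map_mul, map_pow, Algebra.norm_complex_apply,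
      Algebra.norm_complex_apply, Complex.normSq_ofReal, Complex.normSq_ofReal,
      Real.mul_self_sqrt hr.le]
    ring
  have h1 : phi w = (fun z => z + phiShift w) ∘ ((phiLin w).restrictScalars ℝ) := rfl
  have hc : Continuous ((phiLin w).restrictScalars ℝ) :=
    LinearMap.continuous_of_finiteDimensional _
  rw [h1, ← Measure.map_map (by fun_prop) hc.measurable,
    Measure.map_linearMap_addHaar_eq_smul_addHaar _ (by rw [hd]; positivity), hd,
    Measure.map_smul, map_add_right_eq_self, abs_of_pos (by positivity)]

/-- Change of variables by the automorphism `phi w`. -/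
theorem lintegral_phi {w : Cn m} (hw : w ∈ TB m) (f : Cn m → ℝ≥0∞) :
    ∫⁻ z in TB m, f z = ENNReal.ofReal (rho w ^ (m + 2)) * ∫⁻ z in TB m, f (phi w z) := by
  have hr := mem_TB_iff.1 hw
  have hpre : phi w ⁻¹' TB m = TB m := by ext z; exact phi_mem hw
  have hemb : MeasurableEmbedding (phi w) := (phiHomeo hw).measurableEmbedding
  have h1 : Measure.map (phi w) (volume.restrict (TB m)) =
      ENNReal.ofReal ((rho w ^ (m + 2))⁻¹) • (volume.restrict (TB m)) := by
    rw [← Measure.restrict_smul, ← map_phi_volume hw, hemb.restrict_map, hpre]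
  rw [← hemb.lintegral_map, h1, lintegral_smul_measure, smul_eq_mul, ← mul_assoc,
    ← ENNReal.ofReal_mul (by positivity), mul_inv_cancel₀ (by positivity), ENNReal.ofReal_one,
    one_mul]

end Automorphisms

/-! ### Size of `ρ(z, w)` -/

section Size

variable {m : ℕ}

theorem rhoPair_self (z : Cn m) : rhoPair z z = rho z := by
  have h : ∀ c : ℂ, c - star c = 2 * Complex.I * c.im := by
    intro c; apply Complex.ext <;> simp; ring
  unfold rhoPair rho
  simp only [h]
  push_cast
  have : ∑ j : Fin m, (2 * Complex.I * ((z j.castSucc).im : ℂ)) ^ 2 =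
      -4 * ∑ j : Fin m, ((z j.castSucc).im : ℂ) ^ 2 := by
    rw [Finset.mul_sum]
    exact Finset.sum_congr rfl fun j _ => by
      linear_combination 4 * ((z j.castSucc).im : ℂ) ^ 2 * Complex.I_sq
  rw [this]
  linear_combination (-((z (Fin.last m)).im : ℂ)) * Complex.I_sq

theorem rhoPair_symm (z w : Cn m) : rhoPair z w = star (rhoPair w z) := by
  unfold rhoPair
  simp only [star_mul', star_sub, star_sum, star_pow, Complex.star_def,
    Complex.conj_I, map_ofNat, map_div₀, map_one, Complex.conj_conj]
  have : ∑ j : Fin m, ((starRingEnd ℂ) (w j.castSucc) - z j.castSucc) ^ 2 =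
      ∑ j : Fin m, (z j.castSucc - (starRingEnd ℂ) (w j.castSucc)) ^ 2 :=
    Finset.sum_congr rfl fun j _ => by ring
  rw [this]
  ring

theorem norm_rhoPair_symm (z w : Cn m) : ‖rhoPair z w‖ = ‖rhoPair w z‖ := by
  rw [rhoPair_symm, norm_star]

/-- The source of the lower bounds for |ρ(w, z)|: on the tube the real part is a sum of nonnegative
terms, so it controls |w' - z'|², ρ(w) and ρ(z) at once. -/
theorem four_mul_re_rhoPair (w z : Cn m) : 4 * (rhoPair w z).re =
    (∑ j : Fin m, ‖w j.castSucc - z j.castSucc‖ ^ 2) + 2 * rho w + 2 * rho z := by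
  have h4 : 4 * (rhoPair w z).re = (∑ j : Fin m, ((w j.castSucc - star (z j.castSucc)) ^ 2).re)
      + 2 * (w (Fin.last m)).im + 2 * (z (Fin.last m)).im := by
    unfold rhoPair
    rw [show (1 / 4 : ℂ) = ((1 / 4 : ℝ) : ℂ) by push_cast; ring, Complex.re_ofReal_mul,
      Complex.sub_re, Complex.re_sum]
    simp [Complex.mul_re, Complex.mul_im]
    ring
  rw [h4]
  unfold rho
  have : ∑ j : Fin m, ‖w j.castSucc - z j.castSucc‖ ^ 2 =
      (∑ j : Fin m, ((w j.castSucc - star (z j.castSucc)) ^ 2).re) +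
      2 * (∑ j : Fin m, (w j.castSucc).im ^ 2) + 2 * ∑ j : Fin m, (z j.castSucc).im ^ 2 := by
    rw [Finset.mul_sum, Finset.mul_sum, ← Finset.sum_add_distrib, ← Finset.sum_add_distrib]
    refine Finset.sum_congr rfl fun j _ => ?_
    rw [← Complex.normSq_eq_norm_sq, Complex.normSq_apply, sq]
    simp [Complex.mul_re]
    ring
  rw [this]
  ring

theorem re_rhoPair_pos {w z : Cn m} (hw : w ∈ TB m) (hz : z ∈ TB m) : 0 < (rhoPair w z).re := by
  have h := four_mul_re_rhoPair w z
  have h1 := mem_TB_iff.1 hw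
  have h2 := mem_TB_iff.1 hz
  have : 0 ≤ ∑ j : Fin m, ‖w j.castSucc - z j.castSucc‖ ^ 2 :=
    Finset.sum_nonneg fun j _ => by positivity
  linarith

theorem rhoPair_mem_slitPlane {w z : Cn m} (hw : w ∈ TB m) (hz : z ∈ TB m) :
    rhoPair w z ∈ Complex.slitPlane := Or.inl (re_rhoPair_pos hw hz)

theorem rhoPair_ne_zero {w z : Cn m} (hw : w ∈ TB m) (hz : z ∈ TB m) : rhoPair w z ≠ 0 :=
  Complex.slitPlane_ne_zero (rhoPair_mem_slitPlane hw hz)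

theorem norm_rhoPair_pos {w z : Cn m} (hw : w ∈ TB m) (hz : z ∈ TB m) : 0 < ‖rhoPair w z‖ :=
  norm_pos_iff.2 (rhoPair_ne_zero hw hz)

theorem rho_le_norm_rhoPair_left {w z : Cn m} (hz : z ∈ TB m) :
    rho w ≤ 2 * ‖rhoPair w z‖ := by
  have h := four_mul_re_rhoPair w z
  have h2 := mem_TB_iff.1 hz
  have h3 := Complex.re_le_norm (rhoPair w z)
  have : 0 ≤ ∑ j : Fin m, ‖w j.castSucc - z j.castSucc‖ ^ 2 :=
    Finset.sum_nonneg fun j _ => by positivity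
  linarith

theorem rho_le_norm_rhoPair_right {w z : Cn m} (hw : w ∈ TB m) :
    rho z ≤ 2 * ‖rhoPair w z‖ := by
  rw [norm_rhoPair_symm]
  exact rho_le_norm_rhoPair_left hw

theorem half_le_norm_rhoPair {w : Cn m} (hw : w ∈ TB m) : 1 / 2 ≤ ‖rhoPair w (basePt m)‖ := by
  have := rho_le_norm_rhoPair_right (z := basePt m) hw
  rw [rho_basePt] at this
  linarith

theorem four_mul_im_rhoPair_basePt (w : Cn m) : 4 * (rhoPair w (basePt m)).im =
    2 * (∑ j : Fin m, (w j.castSucc).re * (w j.castSucc).im) - 2 * (w (Fin.last m)).re := by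
  unfold rhoPair
  rw [show (1 / 4 : ℂ) = ((1 / 4 : ℝ) : ℂ) by push_cast; ring, Complex.im_ofReal_mul,
    Complex.sub_im, Complex.im_sum]
  simp only [basePt_castSucc, basePt_last]
  have : ∑ j : Fin m, ((w j.castSucc - star (0 : ℂ)) ^ 2).im =
      2 * ∑ j : Fin m, (w j.castSucc).re * (w j.castSucc).im := by
    rw [Finset.mul_sum]
    exact Finset.sum_congr rfl fun j _ => by rw [star_zero, sub_zero, sq, Complex.mul_im]; ring
  rw [this]
  simp [Complex.mul_im]

/-- The real part controls w' and ρ(w), and the imaginary part controls Re w_n after a shear that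
depends only on w'. These are the natural coordinates for growth and integrability on the tube. -/
theorem eight_mul_norm_rhoPair_basePt_ge (w : Cn m) :
    (∑ j : Fin m, ‖w j.castSucc‖ ^ 2) + 2 * rho w + 2 +
      2 * |(w (Fin.last m)).re - ∑ j : Fin m, (w j.castSucc).re * (w j.castSucc).im| ≤
    8 * ‖rhoPair w (basePt m)‖ := by
  have h1 := four_mul_re_rhoPair w (basePt m)
  simp only [basePt_castSucc, sub_zero, rho_basePt] at h1
  have h2 := four_mul_im_rhoPair_basePt w
  have h3 := Complex.re_le_norm (rhoPair w (basePt m))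
  have h4 := Complex.abs_im_le_norm (rhoPair w (basePt m))
  rw [abs_le] at h4
  have h5 : |(w (Fin.last m)).re - ∑ j : Fin m, (w j.castSucc).re * (w j.castSucc).im| ≤
      2 * ‖rhoPair w (basePt m)‖ := by
    rw [abs_le]; constructor <;> linarith [h4.1, h4.2]
  linarith

/-- Undoing the shear costs only |w'|², which is itself at most 8 |ρ(w, 𝐢)|. Thus |ρ(w, 𝐢)| → ∞ as
|w| → ∞ in the tube. -/
theorem norm_le_of_norm_rhoPair_le {w : Cn m} (hw : w ∈ TB m) {M : ℝ}
    (h : ‖rhoPair w (basePt m)‖ ≤ M) : ‖w‖ ≤ 36 * M + 1 := by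
  have h1 := eight_mul_norm_rhoPair_basePt_ge w
  have hr := mem_TB_iff.1 hw
  have hM : 0 ≤ M := (norm_nonneg _).trans h
  set S := ∑ j : Fin m, ‖w j.castSucc‖ ^ 2 with hS
  have hS0 : 0 ≤ S := Finset.sum_nonneg fun j _ => by positivity
  have ha := abs_nonneg ((w (Fin.last m)).re - ∑ j : Fin m, (w j.castSucc).re * (w j.castSucc).im)
  have hSM : S ≤ 8 * M := by linarith
  have hj : ∀ j : Fin m, ‖w j.castSucc‖ ≤ 8 * M + 1 := by
    intro j
    have : ‖w j.castSucc‖ ^ 2 ≤ S :=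
      Finset.single_le_sum (f := fun j : Fin m => ‖w j.castSucc‖ ^ 2)
        (fun j _ => by positivity) (Finset.mem_univ j)
    nlinarith [sq_nonneg (‖w j.castSucc‖ - 1)]
  have hb : |∑ j : Fin m, (w j.castSucc).re * (w j.castSucc).im| ≤ S := by
    refine (Finset.abs_sum_le_sum_abs _ _).trans (Finset.sum_le_sum fun j _ => ?_)
    rw [abs_mul, sq]
    exact mul_le_mul (Complex.abs_re_le_norm _) (Complex.abs_im_le_norm _) (abs_nonneg _)
      (norm_nonneg _)
  have hy : |∑ j : Fin m, (w j.castSucc).im ^ 2| ≤ S := by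
    rw [abs_of_nonneg (Finset.sum_nonneg fun j _ => by positivity)]
    refine Finset.sum_le_sum fun j _ => ?_
    rw [← sq_abs]
    exact pow_le_pow_left₀ (abs_nonneg _) (Complex.abs_im_le_norm _) 2
  have him : (w (Fin.last m)).im = rho w + ∑ j : Fin m, (w j.castSucc).im ^ 2 := by
    unfold rho; ring
  have hn : ‖w (Fin.last m)‖ ≤ 36 * M + 1 := by
    refine (Complex.norm_le_abs_re_add_abs_im _).trans ?_
    have e1 : |(w (Fin.last m)).re| ≤ 4 * M + S := by
      have := abs_le.1 hb
      have h7 := abs_le.1 (show |(w (Fin.last m)).re -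
        ∑ j : Fin m, (w j.castSucc).re * (w j.castSucc).im| ≤ 4 * M by linarith)
      rw [abs_le]; constructor <;> linarith [this.1, this.2, h7.1, h7.2]
    have e2 : |(w (Fin.last m)).im| ≤ 4 * M + S := by
      rw [him]
      refine (abs_add_le _ _).trans ?_
      rw [abs_of_pos hr]
      linarith
    linarith
  refine (pi_norm_le_iff_of_nonneg (by positivity)).2 fun i => ?_
  refine Fin.lastCases hn (fun j => ?_) i
  have := hj j
  linarith

/-- The terms w_j² and w_n cancel in the difference, so what is left grows only linearly in w'. -/
theorem norm_rhoPair_sub_le {R : ℝ} {z ζ : Cn m} (hz : ‖z‖ ≤ R) (hζ : ‖ζ‖ ≤ R) (w : Cn m) :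
    ‖rhoPair w z - rhoPair w ζ‖ ≤ R * (∑ j : Fin m, ‖w j.castSucc‖) + m * R ^ 2 + R := by
  have hR : 0 ≤ R := (norm_nonneg z).trans hz
  have e : rhoPair w z - rhoPair w ζ = (1 / 4) * ((∑ j : Fin m,
      (star (ζ j.castSucc) - star (z j.castSucc)) *
      (2 * w j.castSucc - star (z j.castSucc) - star (ζ j.castSucc))) +
      2 * Complex.I * (star (z (Fin.last m)) - star (ζ (Fin.last m)))) := by
    unfold rhoPair
    have : ∑ j : Fin m, (star (ζ j.castSucc) - star (z j.castSucc)) *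
      (2 * w j.castSucc - star (z j.castSucc) - star (ζ j.castSucc)) =
      (∑ j : Fin m, (w j.castSucc - star (z j.castSucc)) ^ 2) -
      ∑ j : Fin m, (w j.castSucc - star (ζ j.castSucc)) ^ 2 := by
      rw [← Finset.sum_sub_distrib]
      exact Finset.sum_congr rfl fun j _ => by ring
    rw [this]
    ring
  have hz' : ∀ i, ‖star (z i)‖ ≤ R := fun i => by rw [norm_star]; exact (norm_le_pi_norm z i).trans hz
  have hζ' : ∀ i, ‖star (ζ i)‖ ≤ R := fun i => by rw [norm_star]; exact (norm_le_pi_norm ζ i).trans hζ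
  have h1 : ‖∑ j : Fin m, (star (ζ j.castSucc) - star (z j.castSucc)) *
      (2 * w j.castSucc - star (z j.castSucc) - star (ζ j.castSucc))‖ ≤
      4 * R * (∑ j : Fin m, ‖w j.castSucc‖) + m * (4 * R ^ 2) := by
    refine (norm_sum_le _ _).trans ?_
    have : (m : ℝ) * (4 * R ^ 2) = ∑ j : Fin m, 4 * R ^ 2 := by simp
    rw [this, Finset.mul_sum, ← Finset.sum_add_distrib]
    refine Finset.sum_le_sum fun j _ => ?_
    rw [norm_mul]
    have a1 : ‖star (ζ j.castSucc) - star (z j.castSucc)‖ ≤ 2 * R :=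
      (norm_sub_le _ _).trans (by linarith [hz' j.castSucc, hζ' j.castSucc])
    have a2 : ‖2 * w j.castSucc - star (z j.castSucc) - star (ζ j.castSucc)‖ ≤
        2 * ‖w j.castSucc‖ + 2 * R := by
      refine (norm_sub_le _ _).trans ?_
      have := norm_sub_le (2 * w j.castSucc) (star (z j.castSucc))
      rw [norm_mul, Complex.norm_ofNat] at this
      linarith [hz' j.castSucc, hζ' j.castSucc]
    calc _ ≤ (2 * R) * (2 * ‖w j.castSucc‖ + 2 * R) := by gcongr
      _ = _ := by ring
  have h2 : ‖2 * Complex.I * (star (z (Fin.last m)) - star (ζ (Fin.last m)))‖ ≤ 4 * R := by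
    rw [norm_mul, norm_mul, Complex.norm_I, Complex.norm_ofNat]
    have := norm_sub_le (star (z (Fin.last m))) (star (ζ (Fin.last m)))
    linarith [hz' (Fin.last m), hζ' (Fin.last m)]
  rw [e, norm_mul]
  have h3 := norm_add_le (∑ j : Fin m, (star (ζ j.castSucc) - star (z j.castSucc)) *
      (2 * w j.castSucc - star (z j.castSucc) - star (ζ j.castSucc)))
      (2 * Complex.I * (star (z (Fin.last m)) - star (ζ (Fin.last m))))
  have h4 : ‖(1 / 4 : ℂ)‖ = 1 / 4 := by norm_num
  rw [h4]
  linarith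

/-- Linear growth in w' is absorbed by the quadratic term of Re ρ(w, ζ), and the constants by its
term in ρ(ζ) ≥ ε. -/
theorem sum_norm_add_one_le {R ε : ℝ} (hε : 0 < ε) {ζ : Cn m} (hζ : ‖ζ‖ ≤ R) (hζε : ε ≤ rho ζ)
    {w : Cn m} (hw : w ∈ TB m) :
    (∑ j : Fin m, ‖w j.castSucc‖) + 1 ≤
      4 * (1 + (m * (R + 1) + 1) / (2 * ε)) * ‖rhoPair w ζ‖ := by
  have hR : 0 ≤ R := (norm_nonneg ζ).trans hζ
  have h := four_mul_re_rhoPair w ζ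
  have h1 := mem_TB_iff.1 hw
  have h3 := Complex.re_le_norm (rhoPair w ζ)
  set S := ∑ j : Fin m, ‖w j.castSucc - ζ j.castSucc‖ ^ 2 with hS
  have hS0 : 0 ≤ S := Finset.sum_nonneg fun j _ => by positivity
  have hW : (∑ j : Fin m, ‖w j.castSucc‖) ≤ S + m * (R + 1) := by
    have : (m : ℝ) * (R + 1) = ∑ j : Fin m, (R + 1) := by
      rw [Finset.sum_const, Finset.card_univ, Fintype.card_fin, nsmul_eq_mul]
    rw [this, hS, ← Finset.sum_add_distrib]
    refine Finset.sum_le_sum fun j _ => ?_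
    have a1 := norm_sub_norm_le (w j.castSucc) (ζ j.castSucc)
    have a2 := (norm_le_pi_norm ζ j.castSucc).trans hζ
    nlinarith [sq_nonneg (‖w j.castSucc - ζ j.castSucc‖ - 1)]
  have hc : 0 ≤ (m * (R + 1) + 1) / (2 * ε) := by positivity
  have e : (m * (R + 1) + 1) / (2 * ε) * (2 * ε) = m * (R + 1) + 1 := by field_simp
  have h5 : S + 2 * ε ≤ 4 * ‖rhoPair w ζ‖ := by linarith
  have h6 := mul_le_mul_of_nonneg_left h5 (show 0 ≤ 1 + (m * (R + 1) + 1) / (2 * ε) by linarith)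
  nlinarith [mul_nonneg hc hS0]

theorem exists_pos_le_rho {Q : Set (Cn m)} (hQ : IsCompact Q) (hQT : Q ⊆ TB m) :
    ∃ ε > 0, ∃ R > 0, ∀ z ∈ Q, ε ≤ rho z ∧ ‖z‖ ≤ R := by
  obtain ⟨R, hR0, hR⟩ := hQ.isBounded.exists_pos_norm_le
  rcases Q.eq_empty_or_nonempty with rfl | hne
  · exact ⟨1, one_pos, 1, one_pos, by simp⟩
  obtain ⟨z₀, hz₀, hmin⟩ := hQ.exists_isMinOn hne continuous_rho.continuousOn
  exact ⟨rho z₀, mem_TB_iff.1 (hQT hz₀), R, hR0, fun z hz => ⟨hmin hz, hR z hz⟩⟩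

/-- On a compact subset of the tube, all `|ρ(w, z)|` are comparable, uniformly in `w`. -/
theorem exists_comparable {Q : Set (Cn m)} (hQ : IsCompact Q) (hQT : Q ⊆ TB m) :
    ∃ C > 0, ∀ z ∈ Q, ∀ ζ ∈ Q, ∀ w ∈ TB m, ‖rhoPair w z‖ ≤ C * ‖rhoPair w ζ‖ := by
  obtain ⟨ε, hε, R, hR, h⟩ := exists_pos_le_rho hQ hQT
  refine ⟨1 + (R + m * R ^ 2) * (4 * (1 + (m * (R + 1) + 1) / (2 * ε))), by positivity,
    fun z hz ζ hζ w hw => ?_⟩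
  have h1 := norm_rhoPair_sub_le (h z hz).2 (h ζ hζ).2 w
  have h2 := sum_norm_add_one_le hε (h ζ hζ).2 (h ζ hζ).1 hw
  have h3 := norm_sub_norm_le (rhoPair w z) (rhoPair w ζ)
  have hS0 : 0 ≤ ∑ j : Fin m, ‖w j.castSucc‖ := Finset.sum_nonneg fun j _ => by positivity
  have h4 : R * (∑ j : Fin m, ‖w j.castSucc‖) + m * R ^ 2 + R ≤
      (R + m * R ^ 2) * ((∑ j : Fin m, ‖w j.castSucc‖) + 1) := by
    nlinarith [mul_nonneg (show 0 ≤ m * R ^ 2 by positivity) hS0]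
  have h5 := mul_le_mul_of_nonneg_left h2 (show 0 ≤ R + m * R ^ 2 by positivity)
  linarith

theorem rhoPair_eq_psi {ζ : Cn m} (hζ : ζ ∈ TB m) (w z : Cn m) :
    rhoPair w z = rho ζ * rhoPair (psi ζ w) (psi ζ z) := by
  rw [← rhoPair_phi hζ, phi_psi hζ, phi_psi hζ]

/-- Invariant form of `exists_comparable`. -/
theorem exists_comparable_cell {Q : Set (Cn m)} (hQ : IsCompact Q) (hQT : Q ⊆ TB m) :
    ∃ C > 0, ∀ ζ ∈ TB m, ∀ z, psi ζ z ∈ Q → ∀ w ∈ TB m,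
      ‖rhoPair w z‖ ≤ C * ‖rhoPair w ζ‖ ∧ ‖rhoPair w ζ‖ ≤ C * ‖rhoPair w z‖ := by
  -- The base point is adjoined because it is the `psi ζ`-coordinate of ζ itself.
  obtain ⟨C, hC, h⟩ := exists_comparable (hQ.insert (basePt m))
    (insert_subset basePt_mem hQT)
  refine ⟨C, hC, fun ζ hζ z hz w hw => ?_⟩
  have hr := (mem_TB_iff.1 hζ).le
  have hw' := (psi_mem hζ).2 hw
  rw [rhoPair_eq_psi hζ w z, rhoPair_eq_psi hζ w ζ, psi_self hζ, norm_mul, norm_mul,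
    Complex.norm_real, Real.norm_eq_abs, abs_of_nonneg hr]
  constructor
  · have := h _ (mem_insert_of_mem _ hz) _ (mem_insert _ _) _ hw'
    calc _ ≤ rho ζ * (C * _) := mul_le_mul_of_nonneg_left this hr
      _ = _ := by ring
  · have := h _ (mem_insert _ _) _ (mem_insert_of_mem _ hz) _ hw'
    calc _ ≤ rho ζ * (C * _) := mul_le_mul_of_nonneg_left this hr
      _ = _ := by ring

/-! ### The boundary filter -/

/-- A compact exhaustion of the tube. -/
def core (m : ℕ) (ε R : ℝ) : Set (Cn m) := {z | ε ≤ rho z ∧ ‖z‖ ≤ R}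

theorem isCompact_core (ε R : ℝ) : IsCompact (core m ε R) := by
  have : core m ε R = {z | ε ≤ rho z} ∩ Metric.closedBall 0 R := by
    ext z; simp [core]
  rw [this]
  exact (isCompact_closedBall 0 R).inter_left (isClosed_le continuous_const continuous_rho)

theorem core_subset {ε : ℝ} (hε : 0 < ε) (R : ℝ) : core m ε R ⊆ TB m :=
  fun _ hz => mem_TB_iff.2 (hε.trans_le hz.1)

theorem exists_subset_core {Q : Set (Cn m)} (hQ : IsCompact Q) (hQT : Q ⊆ TB m) :
    ∃ ε > 0, ∃ R > 0, Q ⊆ core m ε R := by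
  obtain ⟨ε, hε, R, hR, h⟩ := exists_pos_le_rho hQ hQT
  exact ⟨ε, hε, R, hR, h⟩

/-- The filter is that of complements of compact subsets of the tube; limits at the boundary are
unfolded in this form. -/
theorem eventually_toBoundary_iff {P : Cn m → Prop} :
    (∀ᶠ z in toBoundary m, P z) ↔
      ∃ ε > 0, ∃ R > 0, ∀ z ∈ TB m, z ∉ core m ε R → P z := by
  rw [toBoundary, eventually_inf_principal, eventually_sup]
  constructor
  · rintro ⟨h1, h2⟩
    rw [eventually_comap, Metric.eventually_nhds_iff] at h1
    obtain ⟨ε, hε, h1⟩ := h1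
    obtain ⟨R, -, h2⟩ := (Metric.hasBasis_cobounded_compl_closedBall (0 : Cn m)).eventually_iff.1 h2
    refine ⟨ε, hε, max R 1, by positivity, fun z hz hzc => ?_⟩
    by_cases hr : rho z < ε
    · refine h1 (y := rho z) ?_ z rfl hz
      rw [Real.dist_0_eq_abs, abs_of_pos (mem_TB_iff.1 hz)]; exact hr
    · refine h2 ?_ hz
      simp only [mem_compl_iff, Metric.mem_closedBall, dist_zero_right, not_le]
      by_contra hR
      exact hzc ⟨not_lt.1 hr, (not_lt.1 hR).trans (le_max_left _ _)⟩
  · rintro ⟨ε, hε, R, -, h⟩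
    constructor
    · rw [eventually_comap, Metric.eventually_nhds_iff]
      refine ⟨ε, hε, fun y hy z hzy hz => h z hz fun hc => ?_⟩
      rw [Real.dist_0_eq_abs, ← hzy] at hy
      exact absurd ((le_abs_self _).trans_lt hy) (not_lt.2 hc.1)
    · refine (Metric.hasBasis_cobounded_compl_closedBall (0 : Cn m)).eventually_iff.2
        ⟨R, trivial, fun z hz hzT => h z hzT fun hc => ?_⟩
      simp only [mem_compl_iff, Metric.mem_closedBall, dist_zero_right, not_le] at hz
      exact absurd hc.2 (not_le.2 hz)

theorem eventually_mem_TB : ∀ᶠ z in toBoundary m, z ∈ TB m :=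
  eventually_toBoundary_iff.2 ⟨1, one_pos, 1, one_pos, fun _ hz _ => hz⟩

instance : (toBoundary m).IsCountablyGenerated := by
  have : (Bornology.cobounded (Cn m)).IsCountablyGenerated := by
    rw [← comap_norm_atTop]; infer_instance
  unfold toBoundary; infer_instance

/-- A point leaving every compact set either has small ρ(z) or large |ρ(z, 𝐢)|. As |ρ(z, 𝐢)| ≥
max(1, ρ(z))/2, the product is at most 2^b ρ(z)^(b - a) and at most 2^(b - a) |ρ(z, 𝐢)|^(-a), one
bound for each case. -/
theorem tendsto_rho_rpow_mul {a b : ℝ} (ha : 0 < a) (hab : a < b) :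
    Tendsto (fun z : Cn m => rho z ^ (b - a) * ‖rhoPair z (basePt m)‖ ^ (-b))
      (toBoundary m) (𝓝 0) := by
  have key : ∀ z ∈ TB m, rho z ^ (b - a) * ‖rhoPair z (basePt m)‖ ^ (-b) ≤
        2 ^ b * rho z ^ (b - a) ∧
      rho z ^ (b - a) * ‖rhoPair z (basePt m)‖ ^ (-b) ≤
        2 ^ (b - a) * ‖rhoPair z (basePt m)‖ ^ (-a) := by
    intro z hz
    have h1 := half_le_norm_rhoPair hz
    have h0 : 0 < ‖rhoPair z (basePt m)‖ := norm_rhoPair_pos hz basePt_mem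
    have h2 := rho_le_norm_rhoPair_left (w := z) (basePt_mem (m := m))
    have hr := mem_TB_iff.1 hz
    constructor
    · rw [mul_comm]
      refine mul_le_mul_of_nonneg_right ?_ (Real.rpow_nonneg hr.le _)
      calc ‖rhoPair z (basePt m)‖ ^ (-b) ≤ (1 / 2 : ℝ) ^ (-b) :=
            Real.rpow_le_rpow_of_nonpos (by norm_num) h1 (by linarith)
        _ = 2 ^ b := by
          rw [one_div, Real.inv_rpow (by norm_num), Real.rpow_neg (by norm_num), inv_inv]
    · calc rho z ^ (b - a) * ‖rhoPair z (basePt m)‖ ^ (-b)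
          ≤ (2 * ‖rhoPair z (basePt m)‖) ^ (b - a) * ‖rhoPair z (basePt m)‖ ^ (-b) := by
            gcongr
        _ = 2 ^ (b - a) * (‖rhoPair z (basePt m)‖ ^ (b - a) * ‖rhoPair z (basePt m)‖ ^ (-b)) := by
            rw [Real.mul_rpow (by norm_num) h0.le]; ring
        _ = _ := by rw [← Real.rpow_add h0]; ring_nf
  rw [Metric.tendsto_nhds]
  intro η hη
  have l1 : Tendsto (fun x : ℝ => 2 ^ b * x ^ (b - a)) (𝓝[>] 0) (𝓝 0) := by
    have : Tendsto (fun x : ℝ => 2 ^ b * x ^ (b - a)) (𝓝 0) (𝓝 (2 ^ b * 0 ^ (b - a))) :=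
      ((Real.continuousAt_rpow_const 0 _ (Or.inr (by linarith))).tendsto).const_mul _
    rw [Real.zero_rpow (by linarith), mul_zero] at this
    exact this.mono_left nhdsWithin_le_nhds
  have l2 : Tendsto (fun x : ℝ => 2 ^ (b - a) * x ^ (-a)) atTop (𝓝 0) := by
    simpa using (tendsto_rpow_neg_atTop ha).const_mul (2 ^ (b - a))
  obtain ⟨ε, hε, h1⟩ := (nhdsGT_basis (0 : ℝ)).eventually_iff.1 (l1.eventually (gt_mem_nhds hη))
  obtain ⟨M, h2⟩ := eventually_atTop.1 (l2.eventually (gt_mem_nhds hη))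
  -- The radius comes from `norm_le_of_norm_rhoPair_le`: beyond it |ρ(z, 𝐢)| exceeds M.
  refine eventually_toBoundary_iff.2 ⟨ε, hε, 36 * |M| + 1, by positivity, fun z hz hzc => ?_⟩
  have hr := mem_TB_iff.1 hz
  rw [Real.dist_0_eq_abs, abs_of_nonneg (by positivity)]
  by_cases hc : rho z < ε
  · exact (key z hz).1.trans_lt (h1 ⟨hr, hc⟩)
  · refine (key z hz).2.trans_lt (h2 _ ?_)
    by_contra hM
    refine hzc ⟨not_lt.1 hc, norm_le_of_norm_rhoPair_le hz ?_⟩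
    exact (not_le.1 hM).le.trans (le_abs_self _)

end Size

/-! ### The integrals of `ρ(u)^a |ρ(u, z)|^(-s)` -/

section Integrals

variable {m : ℕ}

theorem rpow_one_add_lintegral_lt_top {a c : ℝ} (ha : -1 < a) (hc : a + 1 < c) :
    ∫⁻ y in Ioi (0 : ℝ), ENNReal.ofReal (y ^ a * (1 + y) ^ (-c)) < ⊤ := by
  have h1 : IntegrableOn (fun y : ℝ => y ^ a) (Ioc 0 1) := by
    have := intervalIntegral.intervalIntegrable_rpow' (a := 0) (b := 1) ha
    rwa [intervalIntegrable_iff_integrableOn_Ioc_of_le zero_le_one] at this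
  have h2 : IntegrableOn (fun y : ℝ => y ^ (a - c)) (Ioi 1) :=
    integrableOn_Ioi_rpow_of_lt (by linarith) one_pos
  rw [← Ioc_union_Ioi_eq_Ioi (zero_le_one' ℝ)]
  refine (lintegral_union_le _ _ _).trans_lt (ENNReal.add_lt_top.2 ⟨?_, ?_⟩)
  · refine (setLIntegral_mono' measurableSet_Ioc fun y hy => ?_).trans_lt h1.lintegral_lt_top
    refine ENNReal.ofReal_le_ofReal (mul_le_of_le_one_right (Real.rpow_nonneg hy.1.le _) ?_)
    exact Real.rpow_le_one_of_one_le_of_nonpos (by linarith [hy.1]) (by linarith)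
  · refine (setLIntegral_mono' measurableSet_Ioi fun y hy => ?_).trans_lt h2.lintegral_lt_top
    have hy0 : 0 < y := one_pos.trans hy
    refine ENNReal.ofReal_le_ofReal ?_
    rw [sub_eq_add_neg, Real.rpow_add hy0]
    refine mul_le_mul_of_nonneg_left ?_ (Real.rpow_nonneg hy0.le _)
    exact Real.rpow_le_rpow_of_nonpos hy0 (by linarith) (by linarith)

/-- `∫_{T_B} ρ(u)^a |ρ(u, z)|^(-s) dV(u)`. -/
def kernelIntegral (a s : ℝ) (z : Cn m) : ℝ≥0∞ :=
  ∫⁻ u in TB m, ENNReal.ofReal (rho u ^ a * ‖rhoPair u z‖ ^ (-s))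

/-- Scaling by `phi z`: the Jacobian contributes m + 2 to the exponent, ρ(u)^a contributes a, and
the kernel contributes -s. -/
theorem kernelIntegral_eq (a s : ℝ) {z : Cn m} (hz : z ∈ TB m) :
    kernelIntegral a s z =
      ENNReal.ofReal (rho z ^ (m + 2 + a - s)) * kernelIntegral a s (basePt m) := by
  have hr := mem_TB_iff.1 hz
  unfold kernelIntegral
  rw [lintegral_phi hz]
  have : ∀ u ∈ TB m, ENNReal.ofReal (rho (phi z u) ^ a * ‖rhoPair (phi z u) z‖ ^ (-s)) =
      ENNReal.ofReal (rho z ^ (a - s)) *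
        ENNReal.ofReal (rho u ^ a * ‖rhoPair u (basePt m)‖ ^ (-s)) := by
    intro u hu
    have hu' := mem_TB_iff.1 hu
    rw [← ENNReal.ofReal_mul (by positivity)]
    congr 1
    have e : rhoPair (phi z u) z = rho z * rhoPair u (basePt m) := by
      rw [← rhoPair_phi hz, phi_basePt]
    rw [e, rho_phi hz, norm_mul, Complex.norm_real, Real.norm_eq_abs, abs_of_pos hr,
      Real.mul_rpow hr.le hu'.le, Real.mul_rpow hr.le (norm_nonneg _), sub_eq_add_neg,
      Real.rpow_add hr]
    ring
  rw [setLIntegral_congr_fun measurableSet_TB this, lintegral_const_mul' _ _ ENNReal.ofReal_ne_top,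
    ← mul_assoc, ← ENNReal.ofReal_mul (by positivity)]
  congr 2
  rw [← Real.rpow_natCast, ← Real.rpow_add hr]
  congr 1
  push_cast
  ring

/-- In sheared coordinates |ρ(u, 𝐢)| dominates (1 + |u'|)², 1 + ρ(u) and 1 + |x|, where x is the
sheared real part of u_n. Splitting the exponent s among these three bounds the integral by a
product of convergent integrals. -/
theorem kernelIntegral_basePt_lt_top {a s : ℝ} (ha : -1 < a) (hs : m + 2 + a < s) :
    kernelIntegral a s (basePt m) < ⊤ := by
  -- The excess of s over the critical exponent m + 2 + a is shared equally among the critical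
  -- exponents m, a + 1 and 1 of the three factors.
  set δ := (s - (m + 2 + a)) / 3 with hδ
  have hδ0 : 0 < δ := by rw [hδ]; linarith
  set c := (m : ℝ) + δ with hc
  set a' := a + 1 + δ with ha'
  set b := 1 + δ with hb
  have hsum : s = c + a' + b := by rw [hc, ha', hb, hδ]; ring
  have hc0 : 0 < c := by positivity
  have ha0 : 0 < a' := by rw [ha']; linarith
  have hb0 : 0 < b := by rw [hb]; linarith
  -- Subtracting the shift turns Im u_n into ρ(u). For fixed u' it is a translation in u_n, so
  -- Lebesgue measure is unchanged.
  let shift : (Fin m → ℂ) → ℂ := fun v =>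
    ((∑ j, (v j).re * (v j).im : ℝ) : ℂ) + Complex.I * ((∑ j, (v j).im ^ 2 : ℝ) : ℂ)
  let H1 : ℝ → ℝ≥0∞ := fun x => ENNReal.ofReal ((1 + ‖x‖) ^ (-b))
  let H2 : ℝ → ℝ≥0∞ := (Ioi 0).indicator fun y => ENNReal.ofReal (y ^ a * (1 + y) ^ (-a'))
  let H3 : (Fin m → ℂ) → ℝ≥0∞ := fun v => ENNReal.ofReal ((1 + ‖v‖) ^ (-(2 * c)))
  let g : ℂ × (Fin m → ℂ) → ℝ≥0∞ := fun p =>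
    H3 p.2 * (H1 (p.1 - shift p.2).re * H2 (p.1 - shift p.2).im)
  have mH1 : Measurable H1 := by fun_prop
  have mH2 : Measurable H2 := by
    refine Measurable.indicator ?_ measurableSet_Ioi
    fun_prop
  have mH3 : Measurable H3 := by fun_prop
  have mshift : Measurable shift := by fun_prop
  have mg : Measurable g := by fun_prop
  have key : ∀ u ∈ TB m, ENNReal.ofReal (rho u ^ a * ‖rhoPair u (basePt m)‖ ^ (-s)) ≤
      ENNReal.ofReal (16 ^ s) *
        g (MeasurableEquiv.piFinSuccAbove (fun _ : Fin (m + 1) => ℂ) (Fin.last m) u) := by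
    intro u hu
    have hr := mem_TB_iff.1 hu
    set v : Fin m → ℂ := fun j => u j.castSucc with hv
    have e1 : MeasurableEquiv.piFinSuccAbove (fun _ : Fin (m + 1) => ℂ) (Fin.last m) u =
        (u (Fin.last m), v) := by
      simp only [MeasurableEquiv.piFinSuccAbove, hv]
      refine Prod.ext rfl ?_
      funext j
      simp [Fin.insertNthEquiv, Fin.init]
    have e2 : (u (Fin.last m) - shift v).im = rho u := by
      simp [shift, rho, hv, -Complex.ofReal_sum]
    have e3 : (u (Fin.last m) - shift v).re =
        (u (Fin.last m)).re - ∑ j : Fin m, (u j.castSucc).re * (u j.castSucc).im := by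
      simp [shift, hv, -Complex.ofReal_sum]
    rw [e1]
    simp only [g, e2, H2, indicator_of_mem (mem_Ioi.2 hr), H1, H3]
    rw [← ENNReal.ofReal_mul (by positivity), ← ENNReal.ofReal_mul (by positivity),
      ← ENNReal.ofReal_mul (by positivity)]
    refine ENNReal.ofReal_le_ofReal ?_
    have h8 := eight_mul_norm_rhoPair_basePt_ge u
    rw [← e3] at h8
    have hpos : 0 < ‖rhoPair u (basePt m)‖ := norm_rhoPair_pos hu basePt_mem
    have hv2 : ‖v‖ ^ 2 ≤ ∑ j : Fin m, ‖u j.castSucc‖ ^ 2 := by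
      have : ‖v‖ ≤ √(∑ j : Fin m, ‖u j.castSucc‖ ^ 2) := by
        refine (pi_norm_le_iff_of_nonneg (Real.sqrt_nonneg _)).2 fun j => ?_
        refine Real.le_sqrt_of_sq_le ?_
        exact Finset.single_le_sum (f := fun j : Fin m => ‖u j.castSucc‖ ^ 2)
          (fun j _ => by positivity) (Finset.mem_univ j)
      calc ‖v‖ ^ 2 ≤ √(∑ j : Fin m, ‖u j.castSucc‖ ^ 2) ^ 2 := by gcongr
        _ = _ := Real.sq_sqrt (Finset.sum_nonneg fun j _ => by positivity)
    have habs := abs_nonneg (u (Fin.last m) - shift v).re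
    have hS0 : 0 ≤ ∑ j : Fin m, ‖u j.castSucc‖ ^ 2 := (sq_nonneg _).trans hv2
    have b1 : (1 + ‖v‖) ^ 2 ≤ 16 * ‖rhoPair u (basePt m)‖ := by
      nlinarith [sq_nonneg (‖v‖ - 1)]
    have b2 : 1 + rho u ≤ 16 * ‖rhoPair u (basePt m)‖ := by linarith
    have b3 : 1 + ‖(u (Fin.last m) - shift v).re‖ ≤ 16 * ‖rhoPair u (basePt m)‖ := by
      rw [Real.norm_eq_abs]; linarith
    have c1 : (16 * ‖rhoPair u (basePt m)‖) ^ (-c) ≤ (1 + ‖v‖) ^ (-(2 * c)) := by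
      calc _ ≤ ((1 + ‖v‖) ^ 2) ^ (-c) :=
            Real.rpow_le_rpow_of_nonpos (by positivity) b1 (by linarith)
        _ = _ := by
            rw [← Real.rpow_natCast, ← Real.rpow_mul (by positivity)]; congr 1; push_cast; ring
    have c2 : (16 * ‖rhoPair u (basePt m)‖) ^ (-a') ≤ (1 + rho u) ^ (-a') :=
      Real.rpow_le_rpow_of_nonpos (by positivity) b2 (by linarith)
    have c3 : (16 * ‖rhoPair u (basePt m)‖) ^ (-b) ≤
        (1 + ‖(u (Fin.last m) - shift v).re‖) ^ (-b) :=
      Real.rpow_le_rpow_of_nonpos (by positivity) b3 (by linarith)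
    have e4 : ‖rhoPair u (basePt m)‖ ^ (-s) = 16 ^ s * ((16 * ‖rhoPair u (basePt m)‖) ^ (-c) *
        ((16 * ‖rhoPair u (basePt m)‖) ^ (-b) * (16 * ‖rhoPair u (basePt m)‖) ^ (-a'))) := by
      rw [← Real.rpow_add (by positivity), ← Real.rpow_add (by positivity),
        show -c + (-b + -a') = -s by rw [hsum]; ring, Real.mul_rpow (by norm_num) hpos.le,
        ← mul_assoc, ← Real.rpow_add (by norm_num), add_neg_cancel, Real.rpow_zero, one_mul]
    rw [e4]
    calc rho u ^ a * (16 ^ s * ((16 * ‖rhoPair u (basePt m)‖) ^ (-c) *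
        ((16 * ‖rhoPair u (basePt m)‖) ^ (-b) * (16 * ‖rhoPair u (basePt m)‖) ^ (-a'))))
        ≤ rho u ^ a * (16 ^ s * ((1 + ‖v‖) ^ (-(2 * c)) *
          ((1 + ‖(u (Fin.last m) - shift v).re‖) ^ (-b) * (1 + rho u) ^ (-a')))) := by
          gcongr
      _ = _ := by ring
  have fin1 : ∫⁻ x, H1 x < ⊤ := finite_integral_one_add_norm (by simp [hb]; linarith)
  have fin2 : ∫⁻ y, H2 y < ⊤ := by
    rw [lintegral_indicator measurableSet_Ioi]
    exact rpow_one_add_lintegral_lt_top ha (by linarith)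
  -- The real dimension is 2m and the decay exponent is 2c > 2m.
  have fin3 : ∫⁻ v, H3 v < ⊤ := by
    refine finite_integral_one_add_norm ?_
    rw [Module.finrank_pi_fintype]
    simp [Complex.finrank_real_complex, hc]
    linarith
  have hinner : ∫⁻ x : ℂ, H1 x.re * H2 x.im = (∫⁻ x, H1 x) * ∫⁻ y, H2 y := by
    rw [← lintegral_prod_mul mH1.aemeasurable mH2.aemeasurable, ← Measure.volume_eq_prod,
      ← Complex.volume_preserving_equiv_real_prod.lintegral_comp (by fun_prop)]
    rfl
  have hg : ∫⁻ u : Cn m,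
      g (MeasurableEquiv.piFinSuccAbove (fun _ : Fin (m + 1) => ℂ) (Fin.last m) u) =
      (∫⁻ v, H3 v) * ((∫⁻ x, H1 x) * ∫⁻ y, H2 y) := by
    have := (volume_preserving_piFinSuccAbove (fun _ : Fin (m + 1) => ℂ)
      (Fin.last m)).lintegral_comp mg
    rw [this, Measure.volume_eq_prod, lintegral_prod_symm' _ mg, ← lintegral_mul_const _ mH3]
    refine lintegral_congr fun v => ?_
    simp only [g]
    rw [lintegral_const_mul _ (by fun_prop),
      lintegral_sub_right_eq_self (fun x : ℂ => H1 x.re * H2 x.im) (shift v), hinner]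
  calc kernelIntegral a s (basePt m)
      ≤ ∫⁻ u in TB m, ENNReal.ofReal (16 ^ s) *
        g (MeasurableEquiv.piFinSuccAbove (fun _ : Fin (m + 1) => ℂ) (Fin.last m) u) :=
        setLIntegral_mono' measurableSet_TB key
    _ ≤ ∫⁻ u : Cn m, ENNReal.ofReal (16 ^ s) *
        g (MeasurableEquiv.piFinSuccAbove (fun _ : Fin (m + 1) => ℂ) (Fin.last m) u) :=
        setLIntegral_le_lintegral _ _
    _ = ENNReal.ofReal (16 ^ s) * ((∫⁻ v, H3 v) * ((∫⁻ x, H1 x) * ∫⁻ y, H2 y)) := by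
        rw [lintegral_const_mul' _ _ ENNReal.ofReal_ne_top, hg]
    _ < ⊤ := ENNReal.mul_lt_top ENNReal.ofReal_lt_top
        (ENNReal.mul_lt_top fin3 (ENNReal.mul_lt_top fin1 fin2))

/-! ### Integration against the weighted volume. -/

theorem measurable_rho_rpow (a : ℝ) : Measurable fun z : Cn m => ENNReal.ofReal (rho z ^ a) := by
  have h : Measurable (rho : Cn m → ℝ) := continuous_rho.measurable
  fun_prop

/-- Integration against `V_α`. -/
theorem lintegral_Valpha (α : ℝ) (f : Cn m → ℝ≥0∞) :
    ∫⁻ z, f z ∂Valpha m α = ∫⁻ z in TB m, ENNReal.ofReal (rho z ^ α) * f z := by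
  rw [Valpha, lintegral_withDensity_eq_lintegral_mul_non_measurable _ (measurable_rho_rpow α)
    (Eventually.of_forall fun _ => ENNReal.ofReal_lt_top)]
  rfl

theorem lintegral_Valpha_phi (α : ℝ) {w : Cn m} (hw : w ∈ TB m) (f : Cn m → ℝ≥0∞) :
    ∫⁻ z, f z ∂Valpha m α =
      ENNReal.ofReal (rho w ^ (m + 2 + α)) * ∫⁻ z, f (phi w z) ∂Valpha m α := by
  have hr := mem_TB_iff.1 hw
  rw [lintegral_Valpha, lintegral_Valpha, lintegral_phi hw]
  have : ∀ z ∈ TB m, ENNReal.ofReal (rho (phi w z) ^ α) * f (phi w z) =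
      ENNReal.ofReal (rho w ^ α) * (ENNReal.ofReal (rho z ^ α) * f (phi w z)) := by
    intro z hz
    rw [← mul_assoc, ← ENNReal.ofReal_mul (by positivity), rho_phi hw,
      Real.mul_rpow hr.le (mem_TB_iff.1 hz).le]
  rw [setLIntegral_congr_fun measurableSet_TB this, lintegral_const_mul' _ _ ENNReal.ofReal_ne_top,
    ← mul_assoc, ← ENNReal.ofReal_mul (by positivity)]
  congr 2
  rw [← Real.rpow_natCast, ← Real.rpow_add hr]
  congr 1
  push_cast
  ring

theorem lintegral_Valpha_kernel (α ε s : ℝ) (z : Cn m) :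
    ∫⁻ u, ENNReal.ofReal (rho u ^ ε * ‖rhoPair u z‖ ^ (-s)) ∂Valpha m α =
      kernelIntegral (α + ε) s z := by
  rw [lintegral_Valpha, kernelIntegral]
  refine setLIntegral_congr_fun measurableSet_TB fun u hu => ?_
  have hr := mem_TB_iff.1 hu
  rw [← ENNReal.ofReal_mul (by positivity), Real.rpow_add hr]
  ring_nf

theorem Valpha_compl_TB (α : ℝ) : Valpha m α (TB m)ᶜ = 0 := by
  refine withDensity_absolutelyContinuous _ _ ?_
  rw [Measure.restrict_apply measurableSet_TB.compl, compl_inter_self, measure_empty]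

theorem ae_mem_TB (α : ℝ) : ∀ᵐ z ∂Valpha m α, z ∈ TB m := by
  rw [ae_iff]; exact Valpha_compl_TB α

theorem Valpha_restrict_TB (α : ℝ) : (Valpha m α).restrict (TB m) = Valpha m α :=
  Measure.restrict_eq_self_of_ae_mem (ae_mem_TB α)

instance (α : ℝ) : SigmaFinite (Valpha m α) := by
  unfold Valpha; infer_instance

end Integrals

/-! ### Submean value property -/

section Submean

variable {m : ℕ}

/-- The sup-norm ball of radius `s` about `𝐢`. -/
def baseBall (m : ℕ) (s : ℝ) : Set (Cn m) := Metric.ball (basePt m) s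

/-- The set of `z` whose `psi w`-coordinate lies in `baseBall m s`. -/
def cell (s : ℝ) (w : Cn m) : Set (Cn m) := psi w ⁻¹' baseBall m s

/-- Radii up to this one give balls about `𝐢` inside the tube. -/
def smallRadius (m : ℕ) : ℝ := 1 / (4 * (m + 1))

theorem smallRadius_pos : 0 < smallRadius m := by unfold smallRadius; positivity

/-- With s = 1/(4(m + 1)) both the change of Im u_n and the sum of squares (at most m s²) are at
most s ≤ 1/4. -/
theorem rho_bounds_of_dist_le {u : Cn m} (hu : dist u (basePt m) ≤ smallRadius m) :
    1 / 2 ≤ rho u ∧ rho u ≤ 2 := by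
  set s := smallRadius m with hs
  have hs1 : s * (4 * (m + 1)) = 1 := by rw [hs, smallRadius]; field_simp
  have hs0 : 0 < s := smallRadius_pos
  have hm : (0 : ℝ) ≤ m := Nat.cast_nonneg m
  have hs4 : s ≤ 1 / 4 := by nlinarith
  have hi : ∀ i, ‖u i - basePt m i‖ ≤ s := fun i =>
    (dist_eq_norm (u i) (basePt m i)) ▸ (dist_le_pi_dist u (basePt m) i).trans hu
  have hj : ∀ j : Fin m, (u j.castSucc).im ^ 2 ≤ s ^ 2 := by
    intro j
    have := hi j.castSucc
    rw [basePt_castSucc, sub_zero] at this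
    rw [← sq_abs]
    exact pow_le_pow_left₀ (abs_nonneg _) ((Complex.abs_im_le_norm _).trans this) 2
  have hsum : ∑ j : Fin m, (u j.castSucc).im ^ 2 ≤ m * s ^ 2 := by
    refine (Finset.sum_le_sum fun j _ => hj j).trans ?_
    rw [Finset.sum_const, Finset.card_univ, Fintype.card_fin, nsmul_eq_mul]
  have hsum0 : 0 ≤ ∑ j : Fin m, (u j.castSucc).im ^ 2 := Finset.sum_nonneg fun j _ => sq_nonneg _
  have hn := (Complex.abs_im_le_norm _).trans (hi (Fin.last m))
  rw [basePt_last, Complex.sub_im, Complex.I_im, abs_le] at hn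
  have : m * s ^ 2 ≤ s := by nlinarith
  unfold rho
  constructor <;> linarith [hn.1, hn.2]

theorem baseBall_subset {s : ℝ} (hs : s ≤ smallRadius m) : baseBall m s ⊆ TB m := by
  intro u hu
  have := (rho_bounds_of_dist_le ((Metric.mem_ball.1 hu).le.trans hs)).1
  rw [mem_TB_iff]; linarith

theorem closedBall_basePt_subset {s : ℝ} (hs : s ≤ smallRadius m) :
    Metric.closedBall (basePt m) s ⊆ TB m := by
  intro u hu
  have := (rho_bounds_of_dist_le ((Metric.mem_closedBall.1 hu).trans hs)).1
  rw [mem_TB_iff]; linarith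

theorem cell_subset {s : ℝ} (hs : s ≤ smallRadius m) {w : Cn m} (hw : w ∈ TB m) :
    cell s w ⊆ TB m := fun _ hz => (psi_mem hw).1 (baseBall_subset hs hz)

theorem measurableSet_cell (s : ℝ) (w : Cn m) : MeasurableSet (cell s w) :=
  (continuous_psi w).measurable Metric.isOpen_ball.measurableSet

theorem measurable_indicator_of_continuousOn {s : Set (Cn m)} (hs : MeasurableSet s)
    {f : Cn m → ℝ≥0∞} (hf : ContinuousOn f s) : Measurable (s.indicator f) := by
  classical
  rw [← piecewise_eq_indicator]
  exact hf.measurable_piecewise continuousOn_const hs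

/-- All coordinates turn by the same angle about c, so complex lines through c and sup-norm balls
about c are preserved; this allows averaging over circles inside a ball. -/
theorem measurePreserving_rotation (θ : ℝ) (c : Cn m) :
    MeasurePreserving (fun u : Cn m => c + Complex.exp (θ * Complex.I) • (u - c)) := by
  have h1 : MeasurePreserving (fun u : Cn m => fun i => Complex.exp (θ * Complex.I) * u i) := by
    refine volume_preserving_pi (f := fun _ : Fin (m + 1) => fun x : ℂ =>
      Complex.exp (θ * Complex.I) * x) fun i => ?_
    have := (rotation (Circle.exp θ)).measurePreserving
    convert! this using 1
  exact (measurePreserving_add_left volume c).comp (h1.comp (measurePreserving_sub_right volume c))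

/-- For each u in the ball, the one-variable mean value property holds on the circle through u in
the complex line joining 𝐢 to u. Integrating over u and exchanging the integrals, each rotation
preserves the integral over the ball. -/
theorem submean_baseBall {h : Cn m → ℂ} (hh : DifferentiableOn ℂ h (TB m)) {s : ℝ}
    (hs : s ≤ smallRadius m) :
    ‖h (basePt m)‖ₑ * volume (baseBall m s) ≤ ∫⁻ u in baseBall m s, ‖h u‖ₑ := by
  set B := baseBall m s with hB
  have hBm : MeasurableSet B := Metric.isOpen_ball.measurableSet
  set G : Cn m → ℝ≥0∞ := B.indicator fun u => ‖h u‖ₑ with hG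
  have mG : Measurable G := measurable_indicator_of_continuousOn hBm
    ((hh.continuousOn.mono (baseBall_subset hs)).enorm)
  let rot : ℝ → Cn m → Cn m := fun θ u => basePt m + Complex.exp (θ * Complex.I) • (u - basePt m)
  have hrot : ∀ θ u, u ∈ B → rot θ u ∈ B := by
    intro θ u hu
    rw [hB, baseBall, Metric.mem_ball, dist_eq_norm] at hu ⊢
    simp only [rot, add_sub_cancel_left, norm_smul, Complex.norm_exp_ofReal_mul_I, one_mul]
    exact hu
  have hpt : ∀ u ∈ B, ‖h (basePt m)‖ₑ * ENNReal.ofReal (2 * Real.pi) ≤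
      ∫⁻ θ in Ioc 0 (2 * Real.pi), G (rot θ u) := by
    intro u hu
    have hmem : ∀ l : ℂ, ‖l‖ ≤ 1 → basePt m + l • (u - basePt m) ∈ B := by
      intro l hl
      rw [hB, baseBall, Metric.mem_ball, dist_eq_norm] at hu ⊢
      rw [add_sub_cancel_left, norm_smul]
      exact (mul_le_of_le_one_left (norm_nonneg _) hl).trans_lt hu
    have hd : DifferentiableOn ℂ (fun l : ℂ => h (basePt m + l • (u - basePt m)))
        (Metric.closedBall 0 1) := by
      refine hh.comp (by fun_prop) fun l hl => baseBall_subset hs (hmem l ?_)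
      simpa using hl
    have hdc : DiffContOnCl ℂ (fun l : ℂ => h (basePt m + l • (u - basePt m)))
        (Metric.ball 0 |(1 : ℝ)|) := by
      refine DifferentiableOn.diffContOnCl ?_
      rw [abs_one, closure_ball _ one_ne_zero]
      exact hd
    have hav := hdc.circleAverage
    rw [Real.circleAverage_def, zero_smul, add_zero,
      intervalIntegral.integral_of_le Real.two_pi_pos.le] at hav
    have hav' : (∫ θ in Ioc 0 (2 * Real.pi), h (rot θ u)) = (2 * Real.pi) • h (basePt m) := by
      rw [← hav, smul_smul, mul_inv_cancel₀ Real.two_pi_pos.ne', one_smul]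
      refine integral_congr_ae (Eventually.of_forall fun θ => ?_)
      simp [rot, circleMap]
    calc ‖h (basePt m)‖ₑ * ENNReal.ofReal (2 * Real.pi)
        = ‖∫ θ in Ioc 0 (2 * Real.pi), h (rot θ u)‖ₑ := by
          rw [hav', enorm_smul, Real.enorm_of_nonneg Real.two_pi_pos.le, mul_comm]
      _ ≤ ∫⁻ θ in Ioc 0 (2 * Real.pi), ‖h (rot θ u)‖ₑ := enorm_integral_le_lintegral_enorm _
      _ = ∫⁻ θ in Ioc 0 (2 * Real.pi), G (rot θ u) := by
          refine lintegral_congr fun θ => ?_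
          rw [hG, indicator_of_mem (hrot θ u hu)]
  have hinner : ∀ θ, ∫⁻ u in B, G (rot θ u) ≤ ∫⁻ u in B, ‖h u‖ₑ := by
    intro θ
    refine (setLIntegral_le_lintegral _ _).trans (le_of_eq ?_)
    rw [(measurePreserving_rotation θ (basePt m)).lintegral_comp mG, hG, lintegral_indicator hBm]
  have hswap : (∫⁻ u in B, ∫⁻ θ in Ioc 0 (2 * Real.pi), G (rot θ u)) =
      ∫⁻ θ in Ioc 0 (2 * Real.pi), ∫⁻ u in B, G (rot θ u) := by
    refine lintegral_lintegral_swap (Measurable.aemeasurable ?_)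
    refine mG.comp ?_
    simp only [rot]
    fun_prop
  have hall : ‖h (basePt m)‖ₑ * ENNReal.ofReal (2 * Real.pi) * volume B ≤
      (∫⁻ u in B, ‖h u‖ₑ) * ENNReal.ofReal (2 * Real.pi) := by
    calc ‖h (basePt m)‖ₑ * ENNReal.ofReal (2 * Real.pi) * volume B
        = ∫⁻ u in B, ‖h (basePt m)‖ₑ * ENNReal.ofReal (2 * Real.pi) := by
          rw [setLIntegral_const]
      _ ≤ ∫⁻ u in B, ∫⁻ θ in Ioc 0 (2 * Real.pi), G (rot θ u) := setLIntegral_mono' hBm hpt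
      _ = ∫⁻ θ in Ioc 0 (2 * Real.pi), ∫⁻ u in B, G (rot θ u) := hswap
      _ ≤ ∫⁻ θ in Ioc 0 (2 * Real.pi), ∫⁻ u in B, ‖h u‖ₑ :=
          lintegral_mono fun θ => hinner θ
      _ = _ := by rw [setLIntegral_const, Real.volume_Ioc, sub_zero]
  have hpi : ENNReal.ofReal (2 * Real.pi) ≠ 0 := by
    rw [Ne, ENNReal.ofReal_eq_zero, not_le]; exact Real.two_pi_pos
  rw [mul_right_comm] at hall
  exact (ENNReal.mul_le_mul_iff_left hpi ENNReal.ofReal_ne_top).1 hall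

theorem volume_baseBall_ne_top (s : ℝ) : volume (baseBall m s) ≠ ⊤ := measure_ball_lt_top.ne

theorem volume_baseBall_pos {s : ℝ} (hs : 0 < s) : 0 < volume (baseBall m s) :=
  Metric.measure_ball_pos _ _ hs

/-- Hölder's inequality on a ball of finite positive measure passes from exponent 1 to q. -/
theorem submean_baseBall_rpow {h : Cn m → ℂ} (hh : DifferentiableOn ℂ h (TB m)) {s : ℝ}
    (hs0 : 0 < s) (hs : s ≤ smallRadius m) {q : ℝ} (hq : 1 ≤ q) :
    ‖h (basePt m)‖ₑ ^ q * volume (baseBall m s) ≤ ∫⁻ u in baseBall m s, ‖h u‖ₑ ^ q := by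
  have hv0 := (volume_baseBall_pos (m := m) hs0).ne'
  have hvt := volume_baseBall_ne_top (m := m) s
  have hq0 : 0 < q := one_pos.trans_le hq
  have hmeas : AEStronglyMeasurable h (volume.restrict (baseBall m s)) :=
    (hh.continuousOn.mono (baseBall_subset hs)).aestronglyMeasurable
      Metric.isOpen_ball.measurableSet
  have h1 := eLpNorm'_le_eLpNorm'_mul_rpow_measure_univ one_pos hq hmeas
  simp only [eLpNorm', ENNReal.rpow_one, div_one, Measure.restrict_apply_univ] at h1
  have h2 := (submean_baseBall hh hs).trans h1
  have h3 := ENNReal.rpow_le_rpow h2 hq0.le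
  rw [ENNReal.mul_rpow_of_nonneg _ _ hq0.le, ENNReal.mul_rpow_of_nonneg _ _ hq0.le,
    ← ENNReal.rpow_mul, ← ENNReal.rpow_mul, one_div_mul_cancel hq0.ne', ENNReal.rpow_one] at h3
  have e : (1 - 1 / q) * q = q - 1 := by field_simp
  rw [e, show q = (q - 1) + 1 by ring, ENNReal.rpow_add _ _ hv0 hvt, ENNReal.rpow_one,
    mul_comm (volume (baseBall m s) ^ (q - 1)), ← mul_assoc] at h3
  simp only [sub_add_cancel] at h3
  refine (ENNReal.mul_le_mul_iff_left ?_ ?_).1 h3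
  · exact (ENNReal.rpow_pos (pos_iff_ne_zero.2 hv0) hvt).ne'
  · exact ENNReal.rpow_ne_top_of_nonneg (by linarith) hvt

theorem two_rpow_neg_abs_le {x : ℝ} (h1 : 1 / 2 ≤ x) (h2 : x ≤ 2) (α : ℝ) :
    (2 : ℝ) ^ (-|α|) ≤ x ^ α := by
  have hx : 0 < x := by linarith
  rcases le_total 0 α with h | h
  · rw [abs_of_nonneg h, Real.rpow_neg (by norm_num), ← Real.inv_rpow (by norm_num)]
    exact Real.rpow_le_rpow (by norm_num) (by linarith) h
  · rw [abs_of_nonpos h, neg_neg]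
    exact Real.rpow_le_rpow_of_nonpos hx h2 h

/-- Submean value property on the cells. -/
theorem exists_submean (α : ℝ) {s : ℝ} (hs0 : 0 < s) (hs : s ≤ smallRadius m) {q : ℝ}
    (hq : 1 ≤ q) : ∃ C : ℝ≥0∞, C ≠ ⊤ ∧ ∀ h : Cn m → ℂ, DifferentiableOn ℂ h (TB m) → ∀ w ∈ TB m,
      ‖h w‖ₑ ^ q ≤ C * ENNReal.ofReal (rho w ^ (-(m + 2 + α))) *
        ∫⁻ z in cell s w, ‖h z‖ₑ ^ q ∂Valpha m α := by
  have hv0 := (volume_baseBall_pos (m := m) hs0).ne'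
  have hvt := volume_baseBall_ne_top (m := m) s
  -- The factor 2^|α| pays for inserting the density ρ^α, as 1/2 ≤ ρ ≤ 2 on the ball.
  refine ⟨(volume (baseBall m s))⁻¹ * ENNReal.ofReal (2 ^ |α|),
    ENNReal.mul_ne_top (ENNReal.inv_ne_top.2 hv0) ENNReal.ofReal_ne_top, fun h hh w hw => ?_⟩
  have hr := mem_TB_iff.1 hw
  have hBm : MeasurableSet (baseBall m s) := Metric.isOpen_ball.measurableSet
  have hphi : DifferentiableOn ℂ (h ∘ phi w) (TB m) := by
    refine hh.comp ?_ fun z hz => (phi_mem hw).2 hz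
    have : Differentiable ℂ (phiLin w).toContinuousLinearMap :=
      (phiLin w).toContinuousLinearMap.differentiable
    exact (this.add_const _).differentiableOn
  have h1 := submean_baseBall_rpow hphi hs0 hs hq
  have h2 : ∫⁻ u in baseBall m s, ‖h (phi w u)‖ₑ ^ q ≤ ENNReal.ofReal (2 ^ |α|) *
      ∫⁻ u in TB m, ENNReal.ofReal (rho u ^ α) *
        (cell s w).indicator (fun z => ‖h z‖ₑ ^ q) (phi w u) := by
    rw [← lintegral_const_mul' _ _ ENNReal.ofReal_ne_top]
    refine le_trans ?_ (lintegral_mono_set (baseBall_subset hs))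
    refine setLIntegral_mono' hBm fun u hu => ?_
    have hb := rho_bounds_of_dist_le ((Metric.mem_ball.1 hu).le.trans hs)
    have hcell : phi w u ∈ cell s w := by
      rw [cell, mem_preimage, psi_phi hw]; exact hu
    rw [indicator_of_mem hcell, ← mul_assoc, ← ENNReal.ofReal_mul (by positivity)]
    refine le_mul_of_one_le_left zero_le ?_
    rw [ENNReal.one_le_ofReal]
    have := two_rpow_neg_abs_le hb.1 hb.2 α
    rw [Real.rpow_neg (by norm_num)] at this
    exact (inv_le_iff_one_le_mul₀' (by positivity)).1 this
  have h3 : ∫⁻ z in cell s w, ‖h z‖ₑ ^ q ∂Valpha m α = ENNReal.ofReal (rho w ^ (m + 2 + α)) *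
      ∫⁻ u in TB m, ENNReal.ofReal (rho u ^ α) *
        (cell s w).indicator (fun z => ‖h z‖ₑ ^ q) (phi w u) := by
    rw [← lintegral_indicator (measurableSet_cell s w), lintegral_Valpha_phi α hw,
      lintegral_Valpha]
  rw [h3]
  have h4 : ENNReal.ofReal (rho w ^ (-(m + 2 + α))) * ENNReal.ofReal (rho w ^ (m + 2 + α)) = 1 := by
    rw [← ENNReal.ofReal_mul (by positivity), ← Real.rpow_add hr, neg_add_cancel, Real.rpow_zero,
      ENNReal.ofReal_one]
  simp only [Function.comp_apply, phi_basePt] at h1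
  calc ‖h w‖ₑ ^ q = (volume (baseBall m s))⁻¹ * (‖h w‖ₑ ^ q * volume (baseBall m s)) := by
        rw [mul_comm, mul_assoc, ENNReal.mul_inv_cancel hv0 hvt, mul_one]
    _ ≤ (volume (baseBall m s))⁻¹ * (ENNReal.ofReal (2 ^ |α|) *
      ∫⁻ u in TB m, ENNReal.ofReal (rho u ^ α) *
        (cell s w).indicator (fun z => ‖h z‖ₑ ^ q) (phi w u)) := by
        exact mul_le_mul' le_rfl (h1.trans h2)
    _ = (volume (baseBall m s))⁻¹ * ENNReal.ofReal (2 ^ |α|) *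
        (ENNReal.ofReal (rho w ^ (-(m + 2 + α))) * ENNReal.ofReal (rho w ^ (m + 2 + α))) *
        ∫⁻ u in TB m, ENNReal.ofReal (rho u ^ α) *
        (cell s w).indicator (fun z => ‖h z‖ₑ ^ q) (phi w u) := by
        rw [h4, mul_one, mul_assoc]
    _ = _ := by ring

end Submean

/-! ### The Bergman metric -/

section Metric

variable {m : ℕ}

/-- The real derivative of `ρ`. -/
def rhoDeriv (z : Cn m) : Cn m →L[ℝ] ℝ :=
  Complex.imCLM ∘L ContinuousLinearMap.proj (Fin.last m) -
    ∑ j : Fin m, (2 * (z j.castSucc).im) •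
      (Complex.imCLM ∘L (ContinuousLinearMap.proj j.castSucc : Cn m →L[ℝ] ℂ))

theorem rhoDeriv_apply (z v : Cn m) : rhoDeriv z v =
    (v (Fin.last m)).im - ∑ j : Fin m, 2 * (z j.castSucc).im * (v j.castSucc).im := by
  simp [rhoDeriv]

theorem hasFDerivAt_im (i : Fin (m + 1)) (z : Cn m) :
    HasFDerivAt (fun z : Cn m => (z i).im)
      (Complex.imCLM ∘L (ContinuousLinearMap.proj i : Cn m →L[ℝ] ℂ)) z :=
  (Complex.imCLM ∘L (ContinuousLinearMap.proj i : Cn m →L[ℝ] ℂ)).hasFDerivAt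

theorem hasFDerivAt_rho (z : Cn m) : HasFDerivAt rho (rhoDeriv z) z := by
  unfold rho rhoDeriv
  refine (hasFDerivAt_im _ z).sub (HasFDerivAt.fun_sum fun j _ => ?_)
  convert! (hasFDerivAt_im j.castSucc z).pow 2 using 1
  simp

/-- The value `∂ρ(v)` of the `(1,0)`-form `∂ρ`. -/
def partialRho (z v : Cn m) : ℂ :=
  Complex.I * (∑ j : Fin m, ((z j.castSucc).im : ℂ) * v j.castSucc) -
    Complex.I / 2 * v (Fin.last m)

theorem rhoDeriv_eq (z v : Cn m) : rhoDeriv z v = 2 * (partialRho z v).re := by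
  rw [rhoDeriv_apply, partialRho]
  have h1 : (∑ j : Fin m, ((z j.castSucc).im : ℂ) * v j.castSucc).im =
      ∑ j : Fin m, (z j.castSucc).im * (v j.castSucc).im := im_sum_real_mul z v
  rw [Complex.sub_re, Complex.I_mul_re, h1]
  have h2 : (Complex.I / 2 * v (Fin.last m)).re = - (v (Fin.last m)).im / 2 := by
    rw [div_mul_eq_mul_div, show (2 : ℂ) = ((2 : ℝ) : ℂ) by norm_num, Complex.div_ofReal_re,
      Complex.I_mul_re]
  rw [h2]
  simp only [mul_assoc, ← Finset.mul_sum]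
  ring

/-- The additive constant is invisible to derivatives, and the factor m + 2 = n + 1 cancels the
normalization of the metric, leaving -log ρ as potential. -/
theorem log_bergmanKernel_self {u : Cn m} (hu : u ∈ TB m) :
    Real.log (bergmanKernel 0 u u).re =
      Real.log (Real.Gamma ((m + 1 : ℝ) + 0 + 1) /
      (2 ^ (m + 2) * Real.pi ^ (m + 1) * Real.Gamma (0 + 1))) - (m + 2) * Real.log (rho u) := by
  have hr := mem_TB_iff.1 hu
  have hG : 0 < Real.Gamma ((m + 1 : ℝ) + 0 + 1) := Real.Gamma_pos_of_pos (by positivity)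
  have hG' : 0 < Real.Gamma (0 + 1) := Real.Gamma_pos_of_pos (by norm_num)
  rw [bergmanKernel, rhoPair_self, ← Complex.ofReal_cpow hr.le, ← Complex.ofReal_div,
    Complex.ofReal_re, Real.log_div (by positivity) (by positivity), Real.log_rpow hr]
  ring

theorem dz_congr {f g : Cn m → ℂ} {z : Cn m} (h : f =ᶠ[𝓝 z] g) (j : Fin (m + 1)) :
    dz j f z = dz j g z := by
  unfold dz; rw [h.fderiv_eq]

theorem dzbar_congr {f g : Cn m → ℂ} {z : Cn m} (h : f =ᶠ[𝓝 z] g) (j : Fin (m + 1)) :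
    dzbar j f z = dzbar j g z := by
  unfold dzbar; rw [h.fderiv_eq]

theorem rhoDeriv_single_one (z : Cn m) (i : Fin (m + 1)) : rhoDeriv z (Pi.single i 1) = 0 := by
  rw [rhoDeriv_apply]
  have : ∀ k, ((Pi.single i (1 : ℂ) : Cn m) k).im = 0 := by
    intro k
    rcases eq_or_ne k i with rfl | h
    · simp
    · simp [h]
  simp [this]

/-- The coefficient `∂ρ/∂z_i`. -/
def rhoCoeff (z : Cn m) (i : Fin (m + 1)) : ℂ := partialRho z (Pi.single i 1)

theorem rhoCoeff_castSucc (z : Cn m) (j : Fin m) :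
    rhoCoeff z j.castSucc = Complex.I * (z j.castSucc).im := by
  simp [rhoCoeff, partialRho, Pi.single_apply]

theorem rhoCoeff_last (z : Cn m) : rhoCoeff z (Fin.last m) = -Complex.I / 2 := by
  simp [rhoCoeff, partialRho, (Fin.castSucc_lt_last _).ne]
  ring

theorem rhoDeriv_single_I (z : Cn m) (i : Fin (m + 1)) :
    ((rhoDeriv z (Pi.single i Complex.I) : ℝ) : ℂ) = 2 * Complex.I * rhoCoeff z i := by
  rw [rhoDeriv_apply]
  refine Fin.lastCases ?_ (fun j => ?_) i
  · rw [rhoCoeff_last]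
    simp [(Fin.castSucc_lt_last _).ne]
    linear_combination Complex.I_sq
  · rw [rhoCoeff_castSucc]
    simp [Pi.single_apply, (Fin.castSucc_lt_last _).ne', apply_ite Complex.im]
    linear_combination (-2 * ((z j.castSucc).im : ℂ)) * Complex.I_sq

/-- ρ depends only on Im z, so its first Wirtinger derivatives are purely imaginary. -/
theorem star_rhoCoeff (z : Cn m) (i : Fin (m + 1)) : star (rhoCoeff z i) = -rhoCoeff z i := by
  refine Fin.lastCases ?_ (fun j => ?_) i
  · simp [rhoCoeff_last]
    ring
  · simp [rhoCoeff_castSucc]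

theorem dz_log_bergmanKernel {z : Cn m} (hz : z ∈ TB m) (j : Fin (m + 1)) :
    dz j (fun u : Cn m => ((Real.log (bergmanKernel 0 u u).re : ℝ) : ℂ)) z =
      -(m + 2) * (rhoCoeff z j / rho z) := by
  have hr := mem_TB_iff.1 hz
  set c := Real.log (Real.Gamma ((m + 1 : ℝ) + 0 + 1) /
      (2 ^ (m + 2) * Real.pi ^ (m + 1) * Real.Gamma (0 + 1)))
  have h1 : (fun u : Cn m => ((Real.log (bergmanKernel 0 u u).re : ℝ) : ℂ)) =ᶠ[𝓝 z]
      fun u => ((c - (m + 2) * Real.log (rho u) : ℝ) : ℂ) := by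
    filter_upwards [isOpen_TB.mem_nhds hz] with u hu
    rw [log_bergmanKernel_self hu]
  have h2 : HasFDerivAt (fun u : Cn m => ((c - (m + 2) * Real.log (rho u) : ℝ) : ℂ))
      (Complex.ofRealCLM ∘L (-(((m : ℝ) + 2) • ((rho z)⁻¹ • rhoDeriv z)))) z := by
    have h3 := ((hasFDerivAt_rho z).log hr.ne').const_mul ((m : ℝ) + 2)
    exact Complex.ofRealCLM.hasFDerivAt.comp z (h3.const_sub c)
  rw [dz_congr h1, dz, h2.fderiv]
  simp only [ContinuousLinearMap.comp_apply, neg_apply,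
    smul_apply, rhoDeriv_single_one, smul_eq_mul, mul_zero, neg_zero, map_zero,
    Complex.ofRealCLM_apply]
  push_cast
  rw [rhoDeriv_single_I]
  have : (rho z : ℂ) ≠ 0 := by exact_mod_cast hr.ne'
  field_simp
  linear_combination 2 * (m + 2) * rhoCoeff z j * Complex.I_sq

/-- This encodes the complex Hessian of ρ, which is -1/2 times the identity on the first m
coordinates and 0 elsewhere. -/
theorem hasFDerivAt_rhoCoeff (z : Cn m) (j : Fin (m + 1)) :
    ∃ D : Cn m →L[ℝ] ℂ, HasFDerivAt (fun u => rhoCoeff u j) D z ∧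
      (∀ i, D (Pi.single i 1) = 0) ∧
      ∀ i, D (Pi.single i Complex.I) = if i = j ∧ j ≠ Fin.last m then Complex.I else 0 := by
  refine Fin.lastCases ?_ (fun j => ?_) j
  · refine ⟨0, ?_, by simp, by simp⟩
    simp only [rhoCoeff_last]
    exact hasFDerivAt_const _ _
  · have h0 : HasFDerivAt (fun u : Cn m => rhoCoeff u j.castSucc)
        (Complex.I • (Complex.ofRealCLM ∘L
          (Complex.imCLM ∘L (ContinuousLinearMap.proj j.castSucc : Cn m →L[ℝ] ℂ)))) z := by
      simp only [rhoCoeff_castSucc]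
      exact (Complex.ofRealCLM.hasFDerivAt.comp z (hasFDerivAt_im j.castSucc z)).const_mul
        Complex.I
    refine ⟨_, h0, fun i => ?_, fun i => ?_⟩
    · rcases eq_or_ne i j.castSucc with rfl | h
      · simp
      · simp [h.symm]
    · rcases eq_or_ne i j.castSucc with rfl | h
      · simp [(Fin.castSucc_lt_last _).ne]
      · simp [h.symm, h]

/-- The complex Hessian of -log ρ is minus that of ρ divided by ρ, plus the product of ∂̄ρ and ∂ρ
divided by ρ². -/
theorem bergmanMatrix_apply {z : Cn m} (hz : z ∈ TB m) (i j : Fin (m + 1)) :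
    bergmanMatrix z i j = (if i = j ∧ j ≠ Fin.last m then 1 / (2 * (rho z : ℂ)) else 0) +
      star (rhoCoeff z i) * rhoCoeff z j / (rho z : ℂ) ^ 2 := by
  have hr := mem_TB_iff.1 hz
  have hrC : (rho z : ℂ) ≠ 0 := by exact_mod_cast hr.ne'
  have hm : (m : ℂ) + 2 ≠ 0 := by
    have : (m : ℝ) + 2 ≠ 0 := by positivity
    exact_mod_cast this
  obtain ⟨D, hD, hD1, hDI⟩ := hasFDerivAt_rhoCoeff z j
  have h1 : dz j (fun u : Cn m => ((Real.log (bergmanKernel 0 u u).re : ℝ) : ℂ)) =ᶠ[𝓝 z]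
      fun u => -(m + 2) * (rhoCoeff u j * ((rho u)⁻¹ : ℝ)) := by
    filter_upwards [isOpen_TB.mem_nhds hz] with u hu
    rw [dz_log_bergmanKernel hu]; push_cast; rw [div_eq_mul_inv]
  have h2 := ((hD.mul (Complex.ofRealCLM.hasFDerivAt.comp z
    ((hasDerivAt_inv hr.ne').comp_hasFDerivAt z (hasFDerivAt_rho z)))).const_mul (-((m : ℂ) + 2)))
  have h3 : fderiv ℝ (fun u => -((m : ℂ) + 2) * (rhoCoeff u j * ((rho u)⁻¹ : ℝ))) z = _ :=
    h2.fderiv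
  rw [bergmanMatrix, Matrix.of_apply, dzbar_congr h1, dzbar, h3]
  simp only [add_apply, smul_apply,
    ContinuousLinearMap.comp_apply, rhoDeriv_single_one, hD1, hDI, smul_eq_mul, mul_zero,
    add_zero, map_zero, Complex.ofRealCLM_apply]
  push_cast
  rw [rhoDeriv_single_I, star_rhoCoeff]
  split_ifs
  · simp only [Function.comp_apply, Complex.ofRealCLM_apply]
    push_cast
    field_simp
    linear_combination ((m : ℂ) + 2) * (-(rho z : ℂ) + 2 * rhoCoeff z j * rhoCoeff z i) * Complex.I_sq
  · field_simp
    linear_combination ((m : ℂ) + 2) * (2 * rhoCoeff z j * rhoCoeff z i) * Complex.I_sq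

theorem sum_rhoCoeff_mul (z v : Cn m) : ∑ i, rhoCoeff z i * v i = partialRho z v := by
  rw [Fin.sum_univ_castSucc, rhoCoeff_last, partialRho, Finset.mul_sum]
  simp only [rhoCoeff_castSucc]
  have : ∀ j : Fin m, Complex.I * ((z j.castSucc).im : ℂ) * v j.castSucc =
    Complex.I * (((z j.castSucc).im : ℂ) * v j.castSucc) := fun j => by ring
  simp only [this]
  ring

/-- The Bergman metric in closed form. -/
theorem bergmanNorm_eq {z : Cn m} (hz : z ∈ TB m) (v : Cn m) : bergmanNorm z v =
    √((∑ j : Fin m, ‖v j.castSucc‖ ^ 2) / (2 * rho z) + ‖partialRho z v‖ ^ 2 / rho z ^ 2) := by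
  unfold bergmanNorm
  congr 1
  have h1 : ∀ i, (bergmanMatrix z).mulVec v i * star (v i) =
      (if i ≠ Fin.last m then 1 / (2 * (rho z : ℂ)) * (v i * star (v i)) else 0) +
      partialRho z v / (rho z : ℂ) ^ 2 * (star (rhoCoeff z i * v i)) := by
    intro i
    have h2 : (bergmanMatrix z).mulVec v i = (if i ≠ Fin.last m then 1 / (2 * (rho z : ℂ)) * v i
        else 0) + partialRho z v / (rho z : ℂ) ^ 2 * star (rhoCoeff z i) := by
      rw [Matrix.mulVec, dotProduct]
      simp only [bergmanMatrix_apply hz, add_mul, Finset.sum_add_distrib]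
      congr 1
      · rw [Finset.sum_eq_single i]
        · simp
        · intro j _ hj; simp [hj.symm]
        · simp
      · rw [← sum_rhoCoeff_mul, Finset.sum_div, Finset.sum_mul]
        exact Finset.sum_congr rfl fun j _ => by ring
    rw [h2, add_mul, star_mul']
    congr 1
    · split_ifs <;> ring
    · ring
  simp only [h1, Finset.sum_add_distrib]
  rw [← Finset.mul_sum, ← star_sum, sum_rhoCoeff_mul, Fin.sum_univ_castSucc]
  have h3 : ∀ c : ℂ, c * star c = ((‖c‖ ^ 2 : ℝ) : ℂ) := fun c => by
    rw [Complex.star_def, Complex.mul_conj, Complex.normSq_eq_norm_sq]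
  simp only [ne_eq, not_true_eq_false, if_false, add_zero, (Fin.castSucc_lt_last _).ne,
    not_false_eq_true, if_true, h3]
  rw [div_mul_eq_mul_div, h3, ← Finset.mul_sum]
  rw [Complex.add_re]
  congr 1
  · rw [← Complex.ofReal_sum, one_div_mul_eq_div, ← Complex.ofReal_ofNat, ← Complex.ofReal_mul,
      ← Complex.ofReal_div, Complex.ofReal_re]
  · rw [← Complex.ofReal_pow, ← Complex.ofReal_div, Complex.ofReal_re]

/-- The infinitesimal form of `rho_phi`; it makes the automorphisms isometries of the Bergman
metric. -/
theorem partialRho_phi {w : Cn m} (hw : w ∈ TB m) (z v : Cn m) :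
    partialRho (phi w z) (phiLin w v) = rho w * partialRho z v := by
  have h := sq_sqrt_rho hw
  unfold partialRho
  have : ∑ j : Fin m, ((phi w z j.castSucc).im : ℂ) * phiLin w v j.castSucc =
      rho w * (∑ j : Fin m, ((z j.castSucc).im : ℂ) * v j.castSucc) +
      √(rho w) * ∑ j : Fin m, ((w j.castSucc).im : ℂ) * v j.castSucc := by
    rw [Finset.mul_sum, Finset.mul_sum, ← Finset.sum_add_distrib]
    refine Finset.sum_congr rfl fun j _ => ?_
    rw [phi_castSucc, phiLin_castSucc, Complex.add_im, Complex.im_ofReal_mul]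
    push_cast
    linear_combination ((z j.castSucc).im : ℂ) * v j.castSucc * h
  rw [this, phiLin_last]
  ring

theorem bergmanNorm_phi {w z : Cn m} (hw : w ∈ TB m) (hz : z ∈ TB m) (v : Cn m) :
    bergmanNorm (phi w z) (phiLin w v) = bergmanNorm z v := by
  have hr := mem_TB_iff.1 hw
  rw [bergmanNorm_eq hz, bergmanNorm_eq ((phi_mem hw).2 hz), partialRho_phi hw, rho_phi hw]
  simp only [phiLin_castSucc, norm_mul, Complex.norm_real, Real.norm_eq_abs, mul_pow, sq_abs,
    Real.sq_sqrt hr.le, ← Finset.mul_sum]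
  congr 2
  · field_simp
  · field_simp

end Metric

/-! ### Bergman balls and cells -/

section Balls

variable {m : ℕ}

theorem bergmanNorm_nonneg (z v : Cn m) : 0 ≤ bergmanNorm z v := Real.sqrt_nonneg _

theorem bergmanLength_nonneg (γ : ℝ → Cn m) : 0 ≤ bergmanLength γ :=
  intervalIntegral.integral_nonneg zero_le_one fun _ _ => bergmanNorm_nonneg _ _

theorem derivWithin_phi_comp {w : Cn m} {η : ℝ → Cn m} {t : ℝ} (ht : t ∈ Icc (0 : ℝ) 1)
    (hη : DifferentiableWithinAt ℝ η (Icc 0 1) t) :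
    derivWithin (fun s => phi w (η s)) (Icc 0 1) t = phiLin w (derivWithin η (Icc 0 1) t) := by
  have h1 : HasDerivWithinAt (fun s => phiLin w (η s)) (phiLin w (derivWithin η (Icc 0 1) t))
      (Icc 0 1) t :=
    (((phiLin w).restrictScalars ℝ).toContinuousLinearMap.hasFDerivAt).comp_hasDerivWithinAt t
      hη.hasDerivWithinAt
  exact (h1.add_const (phiShift w)).derivWithin ((uniqueDiffOn_Icc one_pos) t ht)

theorem bergmanLength_phi {w : Cn m} (hw : w ∈ TB m) {η : ℝ → Cn m}
    (hη : DifferentiableOn ℝ η (Icc 0 1)) (hT : MapsTo η (Icc 0 1) (TB m)) :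
    bergmanLength (fun s => phi w (η s)) = bergmanLength η := by
  unfold bergmanLength
  refine intervalIntegral.integral_congr fun t ht => ?_
  rw [uIcc_of_le zero_le_one] at ht
  simp only
  rw [derivWithin_phi_comp ht (hη t ht), bergmanNorm_phi hw (hT ht)]

theorem contDiff_phi (w : Cn m) : ContDiff ℝ ((⊤ : ℕ∞) : WithTop ℕ∞) (phi w) :=
  ((phiLin w).restrictScalars ℝ).toContinuousLinearMap.contDiff.add contDiff_const

theorem contDiff_psi (w : Cn m) : ContDiff ℝ ((⊤ : ℕ∞) : WithTop ℕ∞) (psi w) := by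
  have h : ∀ i : Fin (m + 1), ContDiff ℝ ((⊤ : ℕ∞) : WithTop ℕ∞) (fun z : Cn m => z i) :=
    fun i => contDiff_apply ℝ ℂ i
  refine contDiff_pi.2 fun i => ?_
  refine Fin.lastCases ?_ (fun j => ?_) i
  · simp only [psi_last]
    exact ((((h _).sub contDiff_const).sub contDiff_const).sub (contDiff_const.mul
      (ContDiff.sum fun j _ => contDiff_const.mul ((h _).sub contDiff_const)))).div_const _
  · simp only [psi_castSucc]
    exact ((h _).sub contDiff_const).div_const _

theorem lengths_bddBelow (z w : Cn m) :
    BddBelow {l : ℝ | ∃ γ : ℝ → Cn m, ContDiffOn ℝ ((⊤ : ℕ∞) : WithTop ℕ∞) γ (Icc 0 1) ∧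
      MapsTo γ (Icc 0 1) (TB m) ∧ γ 0 = z ∧ γ 1 = w ∧ l = bergmanLength γ} :=
  ⟨0, by rintro _ ⟨γ, -, -, -, -, rfl⟩; exact bergmanLength_nonneg γ⟩

theorem norm_partialRho_le {s : ℝ} (hs : s ≤ smallRadius m) {u : Cn m}
    (hu : u ∈ baseBall m s) (v : Cn m) : ‖partialRho u v‖ ≤ (m + 1) * ‖v‖ := by
  have hs1 : smallRadius m ≤ 1 := by
    unfold smallRadius
    rw [div_le_one (by positivity)]
    have : (0 : ℝ) ≤ m := Nat.cast_nonneg m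
    linarith
  have hv : ∀ i, ‖v i‖ ≤ ‖v‖ := norm_le_pi_norm v
  have h1 : ∀ j : Fin m, ‖((u j.castSucc).im : ℂ) * v j.castSucc‖ ≤ ‖v‖ := by
    intro j
    rw [norm_mul, Complex.norm_real, Real.norm_eq_abs]
    have h2 := (Metric.mem_ball.1 hu).le.trans (hs.trans hs1)
    have h3 := (dist_le_pi_dist u (basePt m) j.castSucc).trans h2
    rw [basePt_castSucc, dist_zero_right] at h3
    calc _ ≤ 1 * ‖v‖ := mul_le_mul ((Complex.abs_im_le_norm _).trans h3) (hv _)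
          (norm_nonneg _) zero_le_one
      _ = _ := one_mul _
  unfold partialRho
  refine (norm_sub_le _ _).trans ?_
  rw [norm_mul, norm_mul, norm_div, Complex.norm_I, one_mul, Complex.norm_ofNat]
  have h4 : ‖∑ j : Fin m, ((u j.castSucc).im : ℂ) * v j.castSucc‖ ≤ m * ‖v‖ := by
    refine (norm_sum_le _ _).trans ((Finset.sum_le_sum fun j _ => h1 j).trans (le_of_eq ?_))
    rw [Finset.sum_const, Finset.card_univ, Fintype.card_fin, nsmul_eq_mul]
  have := hv (Fin.last m)
  have := norm_nonneg v
  linarith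

theorem bergmanNorm_le {s : ℝ} (hs : s ≤ smallRadius m) {u : Cn m}
    (hu : u ∈ baseBall m s) (v : Cn m) : bergmanNorm u v ≤ 3 * (m + 1) * ‖v‖ := by
  have hb := rho_bounds_of_dist_le ((Metric.mem_ball.1 hu).le.trans hs)
  rw [bergmanNorm_eq (baseBall_subset hs hu)]
  refine Real.sqrt_le_iff.2 ⟨by positivity, ?_⟩
  have h1 : (∑ j : Fin m, ‖v j.castSucc‖ ^ 2) / (2 * rho u) ≤ m * ‖v‖ ^ 2 := by
    have h2 : ∑ j : Fin m, ‖v j.castSucc‖ ^ 2 ≤ m * ‖v‖ ^ 2 := by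
      calc _ ≤ ∑ j : Fin m, ‖v‖ ^ 2 := by
            refine Finset.sum_le_sum fun j _ => ?_
            gcongr
            exact norm_le_pi_norm v _
        _ = _ := by rw [Finset.sum_const, Finset.card_univ, Fintype.card_fin, nsmul_eq_mul]
    refine (div_le_self (Finset.sum_nonneg fun j _ => by positivity) (by linarith [hb.1])).trans h2
  have h3 : ‖partialRho u v‖ ^ 2 / rho u ^ 2 ≤ 4 * ((m + 1) * ‖v‖) ^ 2 := by
    rw [div_le_iff₀ (by have := hb.1; positivity)]
    have h4 : (1 / 4 : ℝ) ≤ rho u ^ 2 := by nlinarith [hb.1]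
    have h5 : ‖partialRho u v‖ ^ 2 ≤ ((m + 1) * ‖v‖) ^ 2 := by
      gcongr
      exact norm_partialRho_le hs hu v
    nlinarith [sq_nonneg ((m + 1) * ‖v‖)]
  have hm : (0 : ℝ) ≤ m := Nat.cast_nonneg m
  nlinarith [sq_nonneg ‖v‖, mul_nonneg hm (sq_nonneg ‖v‖), mul_nonneg (mul_nonneg hm hm) (sq_nonneg ‖v‖)]

/-- Bergman balls contain cells of a fixed size. -/
theorem cell_subset_bergmanBall {r s : ℝ} (hs0 : 0 < s) (hs : s ≤ smallRadius m)
    (hsr : 3 * (m + 1) * s < r) {z : Cn m} (hz : z ∈ TB m) : cell s z ⊆ bergmanBall z r := by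
  intro w hw
  refine ⟨cell_subset hs hz hw, ?_⟩
  set u := psi z w with hu
  have huB : u ∈ Metric.ball (basePt m) s := hw
  -- The competing curve is a straight segment from 𝐢, which stays in the convex ball where the
  -- metric is bounded by a multiple of the norm; `phi z` then carries it to a curve from z to w of
  -- the same length.
  let η : ℝ → Cn m := fun t => basePt m + t • (u - basePt m)
  have hη : ContDiff ℝ ((⊤ : ℕ∞) : WithTop ℕ∞) η :=
    contDiff_const.add (contDiff_id.smul contDiff_const)
  have hηB : MapsTo η (Icc 0 1) (baseBall m s) := by
    intro t ht
    refine (convex_ball (basePt m) s).add_smul_sub_mem (Metric.mem_ball_self hs0) huB ht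
  have hηT : MapsTo η (Icc 0 1) (TB m) := fun t ht => baseBall_subset hs (hηB ht)
  have hη' : ∀ t ∈ Icc (0 : ℝ) 1, derivWithin η (Icc 0 1) t = u - basePt m := by
    intro t ht
    have : HasDerivAt η ((1 : ℝ) • (u - basePt m)) t :=
      ((hasDerivAt_id t).smul_const _).const_add _
    rw [one_smul] at this
    exact this.hasDerivWithinAt.derivWithin ((uniqueDiffOn_Icc one_pos) t ht)
  have hlen : bergmanLength η ≤ 3 * (m + 1) * s := by
    have h1 : ‖∫ t in (0 : ℝ)..1, bergmanNorm (η t) (derivWithin η (Icc 0 1) t)‖ ≤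
        3 * (m + 1) * s * |1 - 0| := by
      refine intervalIntegral.norm_integral_le_of_norm_le_const fun t ht => ?_
      rw [uIoc_of_le zero_le_one] at ht
      have ht' : t ∈ Icc (0 : ℝ) 1 := ⟨ht.1.le, ht.2⟩
      rw [Real.norm_eq_abs, abs_of_nonneg (bergmanNorm_nonneg _ _), hη' t ht']
      refine (bergmanNorm_le hs (hηB ht') _).trans ?_
      have : ‖u - basePt m‖ ≤ s := by rw [← dist_eq_norm]; exact (Metric.mem_ball.1 huB).le
      gcongr
    rw [sub_zero, abs_one, mul_one] at h1
    exact (le_abs_self _).trans h1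
  refine (csInf_le (lengths_bddBelow z w) ⟨fun t => phi z (η t),
    ((contDiff_phi z).comp hη).contDiffOn, fun t ht => (phi_mem hz).2 (hηT ht), ?_, ?_, rfl⟩).trans_lt ?_
  · simp [η, phi_basePt]
  · simp [η, hu, phi_psi hz]
  · rw [bergmanLength_phi hz (hη.differentiable (by simp)).differentiableOn hηT]
    exact hlen.trans_lt hsr

/-- The speed bound N is nonnegative, so its integral over [0, t] is at most the one over [0, 1]. -/
theorem norm_sub_le_of_deriv_bound {E : Type*} [NormedAddCommGroup E] [NormedSpace ℝ E]
    [CompleteSpace E] {f f' : ℝ → E} {N : ℝ → ℝ} {L : ℝ} (hf : ContinuousOn f (Icc 0 1))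
    (hff' : ∀ t ∈ Ioo (0 : ℝ) 1, HasDerivAt f (f' t) t) (hf' : ContinuousOn f' (Icc 0 1))
    (hN : ContinuousOn N (Icc 0 1)) (hb : ∀ t ∈ Icc (0 : ℝ) 1, ‖f' t‖ ≤ N t)
    (hL : ∫ t in (0 : ℝ)..1, N t ≤ L) {t : ℝ} (ht : t ∈ Icc (0 : ℝ) 1) :
    ‖f t - f 0‖ ≤ L := by
  have hsub : Icc 0 t ⊆ Icc (0 : ℝ) 1 := Icc_subset_Icc_right ht.2
  have hN1 : IntervalIntegrable N volume 0 1 :=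
    ContinuousOn.intervalIntegrable (by rwa [uIcc_of_le zero_le_one])
  have hNt : IntervalIntegrable N volume 0 t :=
    ContinuousOn.intervalIntegrable (by rw [uIcc_of_le ht.1]; exact hN.mono hsub)
  have hft : IntervalIntegrable f' volume 0 t :=
    ContinuousOn.intervalIntegrable (by rw [uIcc_of_le ht.1]; exact hf'.mono hsub)
  rw [← intervalIntegral.integral_eq_sub_of_hasDerivAt_of_le ht.1 (hf.mono hsub)
    (fun x hx => hff' x ⟨hx.1, hx.2.trans_le ht.2⟩) hft]
  refine (intervalIntegral.norm_integral_le_of_norm_le ht.1 (Eventually.of_forall fun x hx =>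
    hb x ⟨hx.1.le, hx.2.trans ht.2⟩) hNt).trans (le_trans ?_ hL)
  refine intervalIntegral.integral_mono_interval le_rfl ht.1 ht.2 ?_ hN1
  refine (ae_restrict_iff' measurableSet_Ioc).2 (Eventually.of_forall fun x hx => ?_)
  exact (norm_nonneg _).trans (hb x ⟨hx.1.le, hx.2⟩)

/-- A curve issuing from `𝐢` of Bergman length less than `r` stays in a fixed compact set. -/
theorem curve_mem_core (m : ℕ) (r : ℝ) : ∃ ε > 0, ∃ R > 0, ∀ η : ℝ → Cn m,
    ContDiffOn ℝ ((⊤ : ℕ∞) : WithTop ℕ∞) η (Icc 0 1) → MapsTo η (Icc 0 1) (TB m) →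
    η 0 = basePt m → bergmanLength η < r → η 1 ∈ core m ε R := by
  -- The metric gives |∂ρ(η')| ≤ ρN, so log ρ varies by at most 2r and ρ ≤ E along the curve. It
  -- also gives |η'_j|² ≤ 2ρN², whence the speed constant c for the first m coordinates, and K
  -- bounds the last one. The absolute value keeps the radius positive for r ≤ 0, when no curve is
  -- this short.
  set E := Real.exp (2 * r) with hE
  set c := √(2 * E) with hc
  set K := 2 * m * (c * |r|) * c + 2 * E with hK
  have hE0 : 0 < E := Real.exp_pos _
  have hc0 : 0 ≤ c := Real.sqrt_nonneg _
  have hK0 : 0 ≤ K := by positivity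
  refine ⟨Real.exp (-(2 * r)), Real.exp_pos _, c * |r| + (K * |r| + 1), by positivity,
    fun η hη hT h0 hlen => ?_⟩
  set η' : ℝ → Cn m := derivWithin η (Icc 0 1) with hη'
  set N : ℝ → ℝ := fun t => bergmanNorm (η t) (η' t) with hN
  have hηc : ContinuousOn η (Icc 0 1) := hη.continuousOn
  have hη'c : ContinuousOn η' (Icc 0 1) :=
    hη.continuousOn_derivWithin (uniqueDiffOn_Icc one_pos) (by simp)
  have hder : ∀ t ∈ Ioo (0 : ℝ) 1, HasDerivAt η (η' t) t := fun t ht =>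
    (((hη.differentiableOn (by simp)) t (Ioo_subset_Icc_self ht)).hasDerivWithinAt).hasDerivAt
      (Icc_mem_nhds ht.1 ht.2)
  have hcoord : ∀ i, ContinuousOn (fun t => η t i) (Icc 0 1) := fun i =>
    (continuous_apply i).comp_continuousOn hηc
  have hcoord' : ∀ i, ContinuousOn (fun t => η' t i) (Icc 0 1) := fun i =>
    (continuous_apply i).comp_continuousOn hη'c
  have hρc : ContinuousOn (fun t => rho (η t)) (Icc 0 1) := continuous_rho.comp_continuousOn hηc
  have hρ : ∀ t ∈ Icc (0 : ℝ) 1, 0 < rho (η t) := fun t ht => mem_TB_iff.1 (hT ht)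
  have hpc : ContinuousOn (fun t => partialRho (η t) (η' t)) (Icc 0 1) := by
    unfold partialRho
    refine (continuousOn_const.mul (continuousOn_finsetSum _ fun j _ => ?_)).sub
      (continuousOn_const.mul (hcoord' _))
    exact ((Complex.continuous_ofReal.comp Complex.continuous_im).comp_continuousOn
      (hcoord _)).mul (hcoord' _)
  have hNeq : ∀ t ∈ Icc (0 : ℝ) 1, N t = √((∑ j : Fin m, ‖η' t j.castSucc‖ ^ 2) / (2 * rho (η t)) +
      ‖partialRho (η t) (η' t)‖ ^ 2 / rho (η t) ^ 2) := fun t ht => bergmanNorm_eq (hT ht) _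
  have hNc : ContinuousOn N (Icc 0 1) := by
    refine ContinuousOn.congr ?_ hNeq
    refine ContinuousOn.sqrt (ContinuousOn.add ?_ ?_)
    · refine ContinuousOn.div ?_ (continuousOn_const.mul hρc) fun t ht => by
        have := hρ t ht; positivity
      exact continuousOn_finsetSum _ fun j _ => (hcoord' _).norm.pow 2
    · exact (hpc.norm.pow 2).div (hρc.pow 2) fun t ht => by have := hρ t ht; positivity
  have hN0 : ∀ t, 0 ≤ N t := fun t => bergmanNorm_nonneg _ _
  have hint : ∫ t in (0 : ℝ)..1, N t < r := hlen
  have hr0 : 0 < r := (bergmanLength_nonneg η).trans_lt hlen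
  have hNint : ∀ a, 0 ≤ a → ∫ t in (0 : ℝ)..1, a * N t ≤ a * r := fun a ha => by
    rw [intervalIntegral.integral_const_mul]
    exact mul_le_mul_of_nonneg_left hint.le ha
  have hp : ∀ t ∈ Icc (0 : ℝ) 1, ‖partialRho (η t) (η' t)‖ ≤ rho (η t) * N t := by
    intro t ht
    have hr := hρ t ht
    have h1 : ‖partialRho (η t) (η' t)‖ ^ 2 / rho (η t) ^ 2 ≤ N t ^ 2 := by
      rw [hNeq t ht, Real.sq_sqrt (by positivity)]
      exact le_add_of_nonneg_left (by positivity)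
    rw [div_le_iff₀ (by positivity), ← mul_pow] at h1
    rw [mul_comm]
    exact le_of_sq_le_sq h1 (mul_nonneg (hN0 t) hr.le)
  have hlog : ∀ t ∈ Icc (0 : ℝ) 1, ‖Real.log (rho (η t)) - Real.log (rho (η 0))‖ ≤ 2 * r := by
    intro t ht
    refine norm_sub_le_of_deriv_bound (f := fun t => Real.log (rho (η t)))
      (f' := fun t => 2 * (partialRho (η t) (η' t)).re / rho (η t)) (N := fun t => 2 * N t)
      (hρc.log fun t ht => (hρ t ht).ne') (fun t ht => ?_) ?_ (continuousOn_const.mul hNc)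
      (fun t ht => ?_) (hNint 2 (by norm_num)) ht
    · have h1 := (hasFDerivAt_rho (η t)).comp_hasDerivAt t (hder t ht)
      rw [rhoDeriv_eq] at h1
      exact h1.log (hρ t (Ioo_subset_Icc_self ht)).ne'
    · exact (continuousOn_const.mul (Complex.continuous_re.comp_continuousOn hpc)).div hρc
        fun t ht => (hρ t ht).ne'
    · have hr := hρ t ht
      rw [norm_div, norm_mul, Real.norm_eq_abs, Real.norm_eq_abs, Real.norm_eq_abs, abs_of_pos hr,
        abs_two, div_le_iff₀ hr]
      have := (Complex.abs_re_le_norm _).trans (hp t ht)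
      linarith
  have hρb : ∀ t ∈ Icc (0 : ℝ) 1, Real.exp (-(2 * r)) ≤ rho (η t) ∧ rho (η t) ≤ E := by
    intro t ht
    have h1 := hlog t ht
    rw [h0, rho_basePt, Real.log_one, sub_zero, Real.norm_eq_abs, abs_le] at h1
    exact ⟨(Real.le_log_iff_exp_le (hρ t ht)).1 h1.1, (Real.log_le_iff_le_exp (hρ t ht)).1 h1.2⟩
  have hv : ∀ t ∈ Icc (0 : ℝ) 1, ∀ j : Fin m, ‖η' t j.castSucc‖ ≤ c * N t := by
    intro t ht j
    have hr := hρ t ht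
    have h1 : (∑ j : Fin m, ‖η' t j.castSucc‖ ^ 2) / (2 * rho (η t)) ≤ N t ^ 2 := by
      rw [hNeq t ht, Real.sq_sqrt (by positivity)]
      exact le_add_of_nonneg_right (by positivity)
    rw [div_le_iff₀ (by positivity)] at h1
    have h2 : ‖η' t j.castSucc‖ ^ 2 ≤ ∑ j : Fin m, ‖η' t j.castSucc‖ ^ 2 :=
      Finset.single_le_sum (f := fun j : Fin m => ‖η' t j.castSucc‖ ^ 2)
        (fun j _ => by positivity) (Finset.mem_univ j)
    refine le_of_sq_le_sq ?_ (mul_nonneg hc0 (hN0 t))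
    rw [mul_pow, hc, Real.sq_sqrt (by positivity)]
    nlinarith [(hρb t ht).2, sq_nonneg (N t)]
  have hjb : ∀ t ∈ Icc (0 : ℝ) 1, ∀ j : Fin m, ‖η t j.castSucc‖ ≤ c * r := by
    intro t ht j
    have := norm_sub_le_of_deriv_bound (f := fun t => η t j.castSucc)
      (f' := fun t => η' t j.castSucc) (N := fun t => c * N t) (hcoord _)
      (fun t ht => (hasDerivAt_pi.1 (hder t ht)) _) (hcoord' _) (continuousOn_const.mul hNc)
      (fun t ht => hv t ht j) (hNint c hc0) ht
    rwa [h0, basePt_castSucc, sub_zero] at this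
  have hlast : ∀ t ∈ Icc (0 : ℝ) 1, ‖η' t (Fin.last m)‖ ≤ K * N t := by
    intro t ht
    -- The definition of ∂ρ is solved for the last velocity component, so a bound for it follows
    -- from those for ∂ρ(η') and the other components.
    have e : η' t (Fin.last m) = 2 * (∑ j : Fin m, ((η t j.castSucc).im : ℂ) * η' t j.castSucc) +
        2 * Complex.I * partialRho (η t) (η' t) := by
      unfold partialRho
      linear_combination (-2 * (∑ j : Fin m, ((η t j.castSucc).im : ℂ) * η' t j.castSucc) +
        η' t (Fin.last m)) * Complex.I_sq
    rw [e]
    refine (norm_add_le _ _).trans ?_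
    rw [norm_mul, norm_mul, norm_mul, Complex.norm_I, Complex.norm_ofNat, mul_one]
    have h1 : ‖∑ j : Fin m, ((η t j.castSucc).im : ℂ) * η' t j.castSucc‖ ≤
        m * ((c * r) * (c * N t)) := by
      refine (norm_sum_le _ _).trans ((Finset.sum_le_sum (g := fun _ => (c * r) * (c * N t))
        fun j _ => ?_).trans (le_of_eq ?_))
      · rw [norm_mul, Complex.norm_real, Real.norm_eq_abs]
        exact mul_le_mul ((Complex.abs_im_le_norm _).trans (hjb t ht j)) (hv t ht j)
          (norm_nonneg _) (mul_nonneg hc0 hr0.le)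
      · rw [Finset.sum_const, Finset.card_univ, Fintype.card_fin, nsmul_eq_mul]
    have h2 := (hp t ht).trans (mul_le_mul_of_nonneg_right (hρb t ht).2 (hN0 t))
    rw [hK, abs_of_pos hr0]
    nlinarith
  have hlb : ‖η 1 (Fin.last m)‖ ≤ K * r + 1 := by
    have := norm_sub_le_of_deriv_bound (f := fun t => η t (Fin.last m))
      (f' := fun t => η' t (Fin.last m)) (N := fun t => K * N t) (hcoord _)
      (fun t ht => (hasDerivAt_pi.1 (hder t ht)) _) (hcoord' _) (continuousOn_const.mul hNc)
      hlast (hNint K hK0) (right_mem_Icc.2 zero_le_one)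
    rw [h0, basePt_last] at this
    have h2 := norm_sub_norm_le (η 1 (Fin.last m)) Complex.I
    rw [Complex.norm_I] at h2
    linarith
  refine ⟨(hρb 1 (right_mem_Icc.2 zero_le_one)).1, ?_⟩
  rw [abs_of_pos hr0]
  refine (pi_norm_le_iff_of_nonneg (by positivity)).2 fun i => ?_
  refine Fin.lastCases ?_ (fun j => ?_) i
  · have : 0 ≤ c * r := by positivity
    linarith
  · have := hjb 1 (right_mem_Icc.2 zero_le_one) j
    have : 0 ≤ K * r := by positivity
    linarith

theorem convex_TB : Convex ℝ (TB m) := by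
  intro x hx y hy a b ha hb hab
  have him : ∀ i, ((a • x + b • y) i).im = a * (x i).im + b * (y i).im := by
    intro i; simp
  have h1 : ∑ j : Fin m, (a * (x j.castSucc).im + b * (y j.castSucc).im) ^ 2 ≤
      a * (∑ j : Fin m, (x j.castSucc).im ^ 2) + b * ∑ j : Fin m, (y j.castSucc).im ^ 2 := by
    rw [Finset.mul_sum, Finset.mul_sum, ← Finset.sum_add_distrib]
    refine Finset.sum_le_sum fun j _ => ?_
    obtain rfl : b = 1 - a := by linarith
    nlinarith [mul_nonneg (mul_nonneg ha hb) (sq_nonneg ((x j.castSucc).im - (y j.castSucc).im))]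
  have hx' : ∑ j : Fin m, (x j.castSucc).im ^ 2 < (x (Fin.last m)).im := hx
  have hy' : ∑ j : Fin m, (y j.castSucc).im ^ 2 < (y (Fin.last m)).im := hy
  show ∑ j : Fin m, ((a • x + b • y) j.castSucc).im ^ 2 < ((a • x + b • y) (Fin.last m)).im
  simp only [him]
  refine h1.trans_lt ?_
  rcases ha.eq_or_lt with rfl | ha'
  · obtain rfl : b = 1 := by linarith
    linarith
  · have := mul_lt_mul_of_pos_left hx' ha'
    have := mul_le_mul_of_nonneg_left hy'.le hb
    linarith

/-- In `psi z`-coordinates, the Bergman balls lie in a fixed compact set. -/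
theorem exists_bergmanBall_subset (m : ℕ) (r : ℝ) : ∃ ε > 0, ∃ R > 0, ∀ z ∈ TB m,
    ∀ w ∈ bergmanBall z r, psi z w ∈ core m ε R := by
  obtain ⟨ε, hε, R, hR, h⟩ := curve_mem_core m r
  refine ⟨ε, hε, R, hR, fun z hz w hw => ?_⟩
  -- The tube is convex, so a segment is an admissible curve. Without nonemptiness the infimum would
  -- have the default value 0 and give no short curve.
  have hne : {l : ℝ | ∃ γ : ℝ → Cn m, ContDiffOn ℝ ((⊤ : ℕ∞) : WithTop ℕ∞) γ (Icc 0 1) ∧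
      MapsTo γ (Icc 0 1) (TB m) ∧ γ 0 = z ∧ γ 1 = w ∧ l = bergmanLength γ}.Nonempty := by
    refine ⟨_, fun t => z + t • (w - z), ContDiff.contDiffOn
      (contDiff_const.add (contDiff_id.smul contDiff_const)), fun t ht =>
      convex_TB.add_smul_sub_mem hz hw.1 ht, by simp, by simp, rfl⟩
  obtain ⟨_, ⟨γ, hγ, hγT, h0, h1, rfl⟩, hlt⟩ := exists_lt_of_csInf_lt hne hw.2
  have hη : ContDiffOn ℝ ((⊤ : ℕ∞) : WithTop ℕ∞) (fun t => psi z (γ t)) (Icc 0 1) :=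
    (contDiff_psi z).comp_contDiffOn hγ
  have hηT : MapsTo (fun t => psi z (γ t)) (Icc 0 1) (TB m) := fun t ht => (psi_mem hz).2 (hγT ht)
  have hlen := bergmanLength_phi hz (hη.differentiableOn (by simp)) hηT
  simp only [phi_psi hz] at hlen
  have := h (fun t => psi z (γ t)) hη hηT (by rw [h0, psi_self hz]) (by rw [← hlen]; exact hlt)
  rwa [h1] at this

end Balls

/-! ### Carleson embedding -/

section Carleson

variable {m : ℕ}

/-- The averages of `μ` over the cells. -/
def cellAvg (α s : ℝ) (μ : Measure (Cn m)) (u : Cn m) : ℝ≥0∞ :=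
  ENNReal.ofReal (rho u ^ (-(m + 2 + α))) * (μ.restrict (TB m)) (cell s u)

theorem continuous_rhoPair_left (z : Cn m) : Continuous fun w : Cn m => rhoPair w z := by
  unfold rhoPair; fun_prop

theorem continuous_rhoPair_right (w : Cn m) : Continuous fun z : Cn m => rhoPair w z := by
  unfold rhoPair; fun_prop

theorem continuous_rhoPair : Continuous fun x : Cn m × Cn m => rhoPair x.1 x.2 := by
  unfold rhoPair; fun_prop

/-- With the positive finite density |ρ(z, 𝐢)|^(-t) the measure becomes finite, and dividing by the
density recovers μ. This justifies Tonelli's theorem for μ. -/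
theorem sFinite_restrict {t : ℝ} {μ : Measure (Cn m)} (h : HasDecay t μ) :
    SFinite (μ.restrict (TB m)) := by
  set f : Cn m → ℝ≥0∞ := fun z => ENNReal.ofReal (1 / ‖rhoPair z (basePt m)‖ ^ t) with hf
  have mf : Measurable f := by
    have := (continuous_rhoPair_left (basePt m)).measurable
    fun_prop
  have hfin : IsFiniteMeasure ((μ.restrict (TB m)).withDensity f) := by
    refine ⟨?_⟩
    rw [withDensity_apply _ MeasurableSet.univ, Measure.restrict_univ]
    exact h
  have hpos : ∀ᵐ z ∂μ.restrict (TB m), f z ≠ 0 := by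
    refine (ae_restrict_iff' measurableSet_TB).2 (Eventually.of_forall fun z hz => ?_)
    have := norm_rhoPair_pos hz (basePt_mem (m := m))
    rw [hf, Ne, ENNReal.ofReal_eq_zero, not_le]
    positivity
  rw [← withDensity_inv_same mf hpos (Eventually.of_forall fun _ => ENNReal.ofReal_ne_top)]
  infer_instance

theorem measurableSet_cells (s : ℝ) : MeasurableSet {x : Cn m × Cn m | x.2 ∈ cell s x.1} :=
  measurable_psi Metric.isOpen_ball.measurableSet

theorem measurable_cellAvg (α s : ℝ) (μ : Measure (Cn m)) [SFinite (μ.restrict (TB m))] :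
    Measurable (cellAvg α s μ) :=
  (measurable_rho_rpow _).mul (measurable_measure_prodMk_left (measurableSet_cells s))

theorem continuousAt_psi_basePt : ContinuousAt (fun u : Cn m => psi u (basePt m)) (basePt m) := by
  have h1 : (√(rho (basePt m)) : ℂ) ≠ 0 := by rw [rho_basePt]; simp
  have h2 : (rho (basePt m) : ℂ) ≠ 0 := by rw [rho_basePt]; simp
  have hc : Continuous (rho : Cn m → ℝ) := continuous_rho
  refine continuousAt_pi.2 fun i => ?_
  refine Fin.lastCases ?_ (fun j => ?_) i
  · simp only [psi_last]
    refine ContinuousAt.div ?_ ?_ h2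
    · exact Continuous.continuousAt (by fun_prop)
    · exact Continuous.continuousAt (by fun_prop)
  · simp only [psi_castSucc]
    refine ContinuousAt.div ?_ ?_ h1
    · exact Continuous.continuousAt (by fun_prop)
    · exact Continuous.continuousAt (by fun_prop)

/-- By `psi_swap`, ψ_z w is the group inverse of ψ_w z. Inversion is continuous at 𝐢, so if one is
near 𝐢 then so is the other, uniformly in w. -/
theorem exists_cell_swap (m : ℕ) {s' : ℝ} (hs' : 0 < s') :
    ∃ s > 0, s ≤ smallRadius m ∧ ∀ w ∈ TB m, ∀ z ∈ cell s w, w ∈ cell s' z := by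
  have h := continuousAt_psi_basePt (m := m)
  rw [Metric.continuousAt_iff] at h
  obtain ⟨δ, hδ, hd⟩ := h s' hs'
  refine ⟨min δ (smallRadius m), lt_min hδ smallRadius_pos, min_le_right _ _,
    fun w hw z hz => ?_⟩
  have hzT := cell_subset (min_le_right _ _) hw hz
  have := hd ((Metric.mem_ball.1 hz).trans_le (min_le_left _ _))
  rw [psi_self basePt_mem] at this
  rw [cell, mem_preimage, psi_swap hw hzT]
  exact this

theorem rho_rpow_cell_le {s : ℝ} (hs : s ≤ smallRadius m) (N : ℝ) {w z : Cn m} (hw : w ∈ TB m)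
    (hz : z ∈ cell s w) : rho w ^ (-N) ≤ 2 ^ |N| * rho z ^ (-N) := by
  have hb := rho_bounds_of_dist_le ((Metric.mem_ball.1 hz).le.trans hs)
  have hr := mem_TB_iff.1 hw
  have hp : 0 < rho (psi w z) := by linarith [hb.1]
  have h1 := two_rpow_neg_abs_le hb.1 hb.2 (-N)
  rw [abs_neg, Real.rpow_neg (by norm_num)] at h1
  rw [rho_psi hw z, Real.mul_rpow hr.le hp.le]
  have h2 : 1 ≤ 2 ^ |N| * rho (psi w z) ^ (-N) := by
    have := mul_le_mul_of_nonneg_left h1 (show (0 : ℝ) ≤ 2 ^ |N| by positivity)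
    rwa [mul_inv_cancel₀ (by positivity)] at this
  have h3 : 0 ≤ rho w ^ (-N) := by positivity
  nlinarith

/-- Integrals of powers of holomorphic functions against `μ` are dominated by integrals against the
averages of `μ`. -/
theorem exists_carleson (m : ℕ) (α : ℝ) {s : ℝ} (hs : 0 < s) {q : ℝ} (hq : 1 ≤ q) :
    ∃ C : ℝ≥0∞, C ≠ ⊤ ∧ ∀ μ : Measure (Cn m), SFinite (μ.restrict (TB m)) → ∀ h : Cn m → ℂ,
      DifferentiableOn ℂ h (TB m) → ∫⁻ w in TB m, ‖h w‖ₑ ^ q ∂μ ≤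
        C * ∫⁻ u, ‖h u‖ₑ ^ q * cellAvg α s μ u ∂Valpha m α := by
  obtain ⟨σ, hσ0, hσ, hswap⟩ := exists_cell_swap m hs
  obtain ⟨C, hC, hsub⟩ := exists_submean (m := m) α hσ0 hσ hq
  refine ⟨C * ENNReal.ofReal (2 ^ |(m : ℝ) + 2 + α|), ENNReal.mul_ne_top hC ENNReal.ofReal_ne_top,
    fun μ hμ h hh => ?_⟩
  set N := (m : ℝ) + 2 + α with hN
  set G : Cn m → ℝ≥0∞ := (TB m).indicator fun z => ‖h z‖ₑ ^ q with hG
  have mG : Measurable G := measurable_indicator_of_continuousOn measurableSet_TB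
    (ENNReal.continuous_rpow_const.comp_continuousOn hh.continuousOn.enorm)
  set S : Set (Cn m × Cn m) := {x | x.2 ∈ cell σ x.1} with hS
  have mS : MeasurableSet S := measurableSet_cells σ
  have mrho : Measurable fun w : Cn m => ENNReal.ofReal (rho w ^ (-N)) := measurable_rho_rpow _
  have mk : Measurable fun x : Cn m × Cn m =>
      ENNReal.ofReal (rho x.1 ^ (-N)) * S.indicator (fun x => G x.2) x :=
    (mrho.comp measurable_fst).mul ((mG.comp measurable_snd).indicator mS)
  have e1 : ∀ w ∈ TB m, ‖h w‖ₑ ^ q ≤ C * ∫⁻ z, ENNReal.ofReal (rho w ^ (-N)) *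
      S.indicator (fun x => G x.2) (w, z) ∂Valpha m α := by
    intro w hw
    refine (hsub h hh w hw).trans (le_of_eq ?_)
    rw [lintegral_const_mul' _ _ ENNReal.ofReal_ne_top, mul_assoc,
      ← lintegral_indicator (measurableSet_cell σ w)]
    congr 2
    refine lintegral_congr fun z => ?_
    by_cases hz : z ∈ cell σ w
    · rw [indicator_of_mem hz, indicator_of_mem (show (w, z) ∈ S from hz), hG,
        indicator_of_mem (cell_subset hσ hw hz)]
    · rw [indicator_of_notMem hz, indicator_of_notMem (show (w, z) ∉ S from hz)]
  -- After the exchange, w runs over the points whose small cell contains z. They lie in the cell of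
  -- radius s about z, where ρ(w) and ρ(z) are comparable, and this leaves the average at z.
  have e2 : ∀ z ∈ TB m, ∫⁻ w in TB m, ENNReal.ofReal (rho w ^ (-N)) *
      S.indicator (fun x => G x.2) (w, z) ∂μ ≤
      ENNReal.ofReal (2 ^ |N|) * (‖h z‖ₑ ^ q * cellAvg α s μ z) := by
    intro z hz
    have e3 : ∀ w ∈ TB m, ENNReal.ofReal (rho w ^ (-N)) * S.indicator (fun x => G x.2) (w, z) ≤
        (cell s z).indicator (fun _ => ENNReal.ofReal (2 ^ |N|) *
          (ENNReal.ofReal (rho z ^ (-N)) * ‖h z‖ₑ ^ q)) w := by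
      intro w hw
      by_cases hzw : z ∈ cell σ w
      · rw [indicator_of_mem (show (w, z) ∈ S from hzw), indicator_of_mem (hswap w hw z hzw), hG,
          indicator_of_mem hz, ← mul_assoc, ← ENNReal.ofReal_mul (by positivity)]
        gcongr
        exact rho_rpow_cell_le hσ N hw hzw
      · rw [indicator_of_notMem (show (w, z) ∉ S from hzw), mul_zero]
        exact zero_le
    refine (setLIntegral_mono' measurableSet_TB e3).trans (le_of_eq ?_)
    rw [lintegral_indicator (measurableSet_cell s z), setLIntegral_const, cellAvg]
    ring
  calc ∫⁻ w in TB m, ‖h w‖ₑ ^ q ∂μ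
      ≤ ∫⁻ w in TB m, C * ∫⁻ z, ENNReal.ofReal (rho w ^ (-N)) *
        S.indicator (fun x => G x.2) (w, z) ∂Valpha m α ∂μ :=
        setLIntegral_mono' measurableSet_TB e1
    _ = C * ∫⁻ w in TB m, ∫⁻ z, ENNReal.ofReal (rho w ^ (-N)) *
        S.indicator (fun x => G x.2) (w, z) ∂Valpha m α ∂μ := lintegral_const_mul' _ _ hC
    _ = C * ∫⁻ z, ∫⁻ w in TB m, ENNReal.ofReal (rho w ^ (-N)) *
        S.indicator (fun x => G x.2) (w, z) ∂μ ∂Valpha m α := by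
        rw [lintegral_lintegral_swap mk.aemeasurable]
    _ ≤ C * ∫⁻ z, ENNReal.ofReal (2 ^ |N|) * (‖h z‖ₑ ^ q * cellAvg α s μ z) ∂Valpha m α := by
        refine mul_le_mul' le_rfl (lintegral_mono_ae ?_)
        filter_upwards [ae_mem_TB α] with z hz using e2 z hz
    _ = _ := by rw [lintegral_const_mul' _ _ ENNReal.ofReal_ne_top, mul_assoc]

/-- |ρ(z, 𝐢)| and |ρ(u, 𝐢)| are comparable for z in the cell of u, so the decay condition makes the
mass of a cell grow at most polynomially. -/
theorem measure_cell_le {s : ℝ} (hs : s ≤ smallRadius m) {t : ℝ} (ht : 0 ≤ t) :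
    ∃ C : ℝ, 0 < C ∧ ∀ μ : Measure (Cn m), ∀ u ∈ TB m,
      (μ.restrict (TB m)) (cell s u) ≤ ENNReal.ofReal ((C * ‖rhoPair u (basePt m)‖) ^ t) *
        ∫⁻ z in TB m, ENNReal.ofReal (1 / ‖rhoPair z (basePt m)‖ ^ t) ∂μ := by
  obtain ⟨C, hC, h⟩ := exists_comparable_cell (isCompact_closedBall (basePt m) s)
    (closedBall_basePt_subset hs)
  refine ⟨C, hC, fun μ u hu => ?_⟩
  have hup := norm_rhoPair_pos hu (basePt_mem (m := m))
  rw [← lintegral_const_mul' _ _ ENNReal.ofReal_ne_top]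
  have hle : ∀ z ∈ TB m, (cell s u).indicator 1 z ≤
      ENNReal.ofReal ((C * ‖rhoPair u (basePt m)‖) ^ t) *
        ENNReal.ofReal (1 / ‖rhoPair z (basePt m)‖ ^ t) := by
    intro z hz
    by_cases hzc : z ∈ cell s u
    · have h1 := (h u hu z (Metric.ball_subset_closedBall hzc) _ basePt_mem).1
      rw [norm_rhoPair_symm _ z, norm_rhoPair_symm _ u] at h1
      have hzp := norm_rhoPair_pos hz (basePt_mem (m := m))
      rw [indicator_of_mem hzc, ← ENNReal.ofReal_mul (by positivity), Pi.one_apply,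
        ENNReal.one_le_ofReal, mul_one_div, one_le_div (by positivity)]
      exact Real.rpow_le_rpow hzp.le h1 ht
    · rw [indicator_of_notMem hzc]; exact zero_le
  refine le_trans (le_of_eq ?_) (setLIntegral_mono' measurableSet_TB hle)
  rw [lintegral_indicator_one (measurableSet_cell s u)]

/-- Near the boundary the limit bounds the averages by 1; on the remaining compact set
`measure_cell_le` does. -/
theorem exists_cellAvg_bound {α s t : ℝ} (hα : -1 < α) (hs : s ≤ smallRadius m) (ht : 0 ≤ t)
    {μ : Measure (Cn m)} (hμ : HasDecay t μ)
    (h0 : Tendsto (cellAvg α s μ) (toBoundary m) (𝓝 0)) :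
    ∃ M : ℝ≥0∞, M ≠ ⊤ ∧ ∀ u ∈ TB m, cellAvg α s μ u ≤ M := by
  obtain ⟨ε, hε, R, hR, h⟩ := eventually_toBoundary_iff.1 (h0.eventually (gt_mem_nhds one_pos))
  obtain ⟨C, hC, hle⟩ := measure_cell_le (m := m) hs ht
  obtain ⟨B, hB⟩ := (isCompact_core (m := m) ε R).exists_bound_of_continuousOn
    (continuous_rhoPair_left (basePt m)).continuousOn
  set I := ∫⁻ z in TB m, ENNReal.ofReal (1 / ‖rhoPair z (basePt m)‖ ^ t) ∂μ
  refine ⟨1 + ENNReal.ofReal (ε ^ (-(m + 2 + α))) * (ENNReal.ofReal ((C * |B|) ^ t) * I),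
    ENNReal.add_ne_top.2 ⟨ENNReal.one_ne_top, ENNReal.mul_ne_top ENNReal.ofReal_ne_top
      (ENNReal.mul_ne_top ENNReal.ofReal_ne_top hμ.ne)⟩, fun u hu => ?_⟩
  by_cases huc : u ∈ core m ε R
  · refine le_trans ?_ le_add_self
    refine mul_le_mul' (ENNReal.ofReal_le_ofReal ?_) ((hle μ u hu).trans
      (mul_le_mul' (ENNReal.ofReal_le_ofReal ?_) le_rfl))
    · have : (0 : ℝ) ≤ m := Nat.cast_nonneg m
      exact Real.rpow_le_rpow_of_nonpos hε huc.1 (by linarith)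
    · have := (hB u huc).trans (le_abs_self B)
      gcongr
  · exact (h u hu huc).le.trans le_self_add

theorem Valpha_core_lt_top (α : ℝ) {ε : ℝ} (hε : 0 < ε) (R : ℝ) : Valpha m α (core m ε R) < ⊤ := by
  have hK := isCompact_core (m := m) ε R
  have hc : ContinuousOn (fun z : Cn m => rho z ^ α) (core m ε R) :=
    continuous_rho.continuousOn.rpow_const fun z hz => Or.inl (hε.trans_le hz.1).ne'
  obtain ⟨B, hB⟩ := hK.exists_bound_of_continuousOn hc
  rw [← setLIntegral_one, ← lintegral_indicator hK.measurableSet, lintegral_Valpha]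
  calc _ ≤ ∫⁻ z, (core m ε R).indicator (fun _ => ENNReal.ofReal B) z := by
        refine (setLIntegral_le_lintegral _ _).trans (lintegral_mono fun z => ?_)
        by_cases hz : z ∈ core m ε R
        · simp only [indicator_of_mem hz, mul_one]
          exact ENNReal.ofReal_le_ofReal ((le_abs_self _).trans (hB z hz))
        · simp [indicator_of_notMem hz]
    _ = ENNReal.ofReal B * volume (core m ε R) := by
        rw [lintegral_indicator hK.measurableSet, setLIntegral_const]
    _ < ⊤ := ENNReal.mul_lt_top ENNReal.ofReal_lt_top hK.measure_lt_top

/-- A bounded weight that vanishes at the boundary makes integrals of bounded families depend, up to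
small errors, only on a compact set. -/
theorem exists_core_weight_bound (α : ℝ) {a : Cn m → ℝ≥0∞} {M : ℝ≥0∞} (hM : M ≠ ⊤)
    (haM : ∀ u ∈ TB m, a u ≤ M) (ha : Tendsto a (toBoundary m) (𝓝 0)) {e : ℝ≥0∞} (he : 0 < e)
    {q : ℝ} (hq : 0 ≤ q) :
    ∃ ε > 0, ∃ R > 0, ∃ C : ℝ≥0∞, C ≠ ⊤ ∧ ∀ (f : Cn m → ℂ) (η : ℝ≥0∞),
      (∀ z ∈ core m ε R, ‖f z‖ₑ ≤ η) → ∫⁻ u, ‖f u‖ₑ ^ q * a u ∂Valpha m α ≤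
        e * (∫⁻ u, ‖f u‖ₑ ^ q ∂Valpha m α) + C * η ^ q := by
  -- A finite constant can be pulled out of an integral without measurability. For e = ⊤ the
  -- estimate with e = 1 is stronger.
  wlog he' : e ≠ ⊤ generalizing e
  · obtain ⟨ε, hε, R, hR, C, hC, h⟩ := this one_pos ENNReal.one_ne_top
    exact ⟨ε, hε, R, hR, C, hC, fun f η hf => (h f η hf).trans (by gcongr; simp at he'; simp [he'])⟩
  obtain ⟨ε, hε, R, hR, h⟩ := eventually_toBoundary_iff.1 (ha.eventually (gt_mem_nhds he))
  refine ⟨ε, hε, R, hR, M * Valpha m α (core m ε R), ENNReal.mul_ne_top hM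
    (Valpha_core_lt_top α hε R).ne, fun f η hf => ?_⟩
  have hK := (isCompact_core (m := m) ε R).measurableSet
  rw [← lintegral_add_compl _ hK, add_comm]
  refine add_le_add ?_ ?_
  · rw [← lintegral_const_mul' _ _ he']
    refine le_trans (lintegral_mono_ae ?_) (setLIntegral_le_lintegral (core m ε R)ᶜ _)
    refine (ae_restrict_iff' hK.compl).2 ?_
    filter_upwards [ae_mem_TB α] with u hu huc
    rw [mul_comm]
    exact mul_le_mul' (h u hu huc).le le_rfl
  · calc _ ≤ ∫⁻ u in core m ε R, η ^ q * M ∂Valpha m α := by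
          refine setLIntegral_mono' hK fun u hu => ?_
          exact mul_le_mul' (ENNReal.rpow_le_rpow (hf u hu) hq) (haM u (core_subset hε R hu))
      _ = _ := by rw [setLIntegral_const]; ring

end Carleson

/-! ### Kernel functions as test functions -/

section TestFunctions

variable {m : ℕ}

/-- The power `ρ(w, z)^(-b)`, as a function of `w`. -/
def kpow (b : ℝ) (z w : Cn m) : ℂ := rhoPair w z ^ ((-b : ℝ) : ℂ)

/-- The function `ρ(z)^(b - a) ρ(w, z)^(-b)` of `w`. -/
def testFun (b a : ℝ) (z w : Cn m) : ℂ := ((rho z ^ (b - a) : ℝ) : ℂ) * kpow b z w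

theorem differentiable_rhoPair_left (z : Cn m) : Differentiable ℂ fun w : Cn m => rhoPair w z := by
  unfold rhoPair; fun_prop

theorem norm_kpow (b : ℝ) (z w : Cn m) : ‖kpow b z w‖ = ‖rhoPair w z‖ ^ (-b) :=
  Complex.norm_cpow_real _ _

theorem differentiableOn_kpow (b : ℝ) {z : Cn m} (hz : z ∈ TB m) :
    DifferentiableOn ℂ (kpow b z) (TB m) := fun _ hw =>
  ((differentiable_rhoPair_left z _).cpow_const
    (rhoPair_mem_slitPlane hw hz)).differentiableWithinAt

theorem differentiableOn_testFun (b a : ℝ) {z : Cn m} (hz : z ∈ TB m) :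
    DifferentiableOn ℂ (testFun b a z) (TB m) := (differentiableOn_kpow b hz).const_mul _

theorem norm_testFun (b a : ℝ) {z : Cn m} (hz : z ∈ TB m) (w : Cn m) :
    ‖testFun b a z w‖ = rho z ^ (b - a) * ‖rhoPair w z‖ ^ (-b) := by
  have hr := mem_TB_iff.1 hz
  rw [testFun, norm_mul, norm_kpow, Complex.norm_real, Real.norm_eq_abs, abs_of_nonneg (by positivity)]

theorem enorm_testFun_rpow {b a x : ℝ} (hx : 0 ≤ x) {z : Cn m} (hz : z ∈ TB m) (w : Cn m) :
    ‖testFun b a z w‖ₑ ^ x =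
      ENNReal.ofReal (rho z ^ ((b - a) * x) * ‖rhoPair w z‖ ^ (-(b * x))) := by
  have hr := mem_TB_iff.1 hz
  rw [← ofReal_norm, ENNReal.ofReal_rpow_of_nonneg (norm_nonneg _) hx, norm_testFun b a hz,
    Real.mul_rpow (by positivity) (by positivity), ← Real.rpow_mul hr.le,
    ← Real.rpow_mul (norm_nonneg _), neg_mul]

/-- The condition a p = N makes the powers of ρ(z) cancel exactly: the test functions are normalized
in A^p_α. -/
theorem lintegral_testFun {α b a p : ℝ} (hp : 0 ≤ p) (hap : a * p = m + 2 + α) {z : Cn m}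
    (hz : z ∈ TB m) : ∫⁻ w, ‖testFun b a z w‖ₑ ^ p ∂Valpha m α =
      kernelIntegral α (b * p) (basePt m) := by
  have hr := mem_TB_iff.1 hz
  simp only [enorm_testFun_rpow hp hz, ENNReal.ofReal_mul (show 0 ≤ rho z ^ ((b - a) * p) by positivity)]
  rw [lintegral_const_mul' _ _ ENNReal.ofReal_ne_top]
  have := lintegral_Valpha_kernel α 0 (b * p) z
  simp only [Real.rpow_zero, one_mul, add_zero] at this
  rw [this, kernelIntegral_eq α (b * p) hz, ← mul_assoc, ← ENNReal.ofReal_mul (by positivity),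
    ← Real.rpow_add hr, show (b - a) * p + (m + 2 + α - b * p) = 0 by rw [sub_mul, hap]; ring,
    Real.rpow_zero, ENNReal.ofReal_one, one_mul]

theorem testFun_lintegral_lt_top {α b a p : ℝ} (hα : -1 < α) (hp : 0 < p) (hap : a * p = m + 2 + α)
    (hab : a < b) : kernelIntegral α (b * p) (basePt m) < ⊤ :=
  kernelIntegral_basePt_lt_top hα (by rw [← hap]; exact mul_lt_mul_of_pos_right hab hp)

theorem eLpNorm_rpow_eq {X : Type*} [MeasurableSpace X] {ν : Measure X} {p : ℝ} (hp : 0 < p)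
    (f : X → ℂ) : eLpNorm f (ENNReal.ofReal p) ν ^ p = ∫⁻ x, ‖f x‖ₑ ^ p ∂ν := by
  rw [eLpNorm_eq_lintegral_rpow_enorm_toReal (by simpa using hp) ENNReal.ofReal_ne_top,
    ENNReal.toReal_ofReal hp.le, ← ENNReal.rpow_mul, one_div_mul_cancel hp.ne', ENNReal.rpow_one]

theorem aestronglyMeasurable_of_continuousOn {f : Cn m → ℂ} (hf : ContinuousOn f (TB m)) (α : ℝ) :
    AEStronglyMeasurable f (Valpha m α) := by
  rw [← Valpha_restrict_TB]
  exact hf.aestronglyMeasurable measurableSet_TB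

theorem memBergman_of_lintegral {α p : ℝ} (hp : 0 < p) {f : Cn m → ℂ}
    (hf : DifferentiableOn ℂ f (TB m)) (hi : ∫⁻ w, ‖f w‖ₑ ^ p ∂Valpha m α < ⊤) :
    MemBergman α p f := by
  refine ⟨hf, aestronglyMeasurable_of_continuousOn hf.continuousOn α, ?_⟩
  rw [← eLpNorm_rpow_eq hp] at hi
  exact (ENNReal.rpow_lt_top_iff_of_pos hp).1 hi

theorem memBergman_testFun {α b a p : ℝ} (hα : -1 < α) (hp : 0 < p) (hap : a * p = m + 2 + α)
    (hab : a < b) {z : Cn m} (hz : z ∈ TB m) : MemBergman α p (testFun b a z) :=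
  memBergman_of_lintegral hp (differentiableOn_testFun b a hz)
    (by rw [lintegral_testFun hp.le hap hz]; exact testFun_lintegral_lt_top hα hp hap hab)

/-- For w in a compact set |ρ(z, w)| is comparable to |ρ(z, 𝐢)|, so `tendsto_rho_rpow_mul` applies.
-/
theorem testFun_small {a b : ℝ} (ha : 0 < a) (hab : a < b) {K : Set (Cn m)} (hK : IsCompact K)
    (hKT : K ⊆ TB m) {η : ℝ} (hη : 0 < η) :
    ∀ᶠ z in toBoundary m, ∀ w ∈ K, ‖testFun b a z w‖ ≤ η := by
  obtain ⟨C, hC, h⟩ := exists_comparable (hK.insert (basePt m)) (insert_subset basePt_mem hKT)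
  have h1 := (tendsto_rho_rpow_mul (m := m) ha hab).const_mul (C ^ b)
  rw [mul_zero] at h1
  filter_upwards [h1.eventually (gt_mem_nhds hη), eventually_mem_TB] with z hz hzT w hw
  refine le_trans ?_ hz.le
  have hr := mem_TB_iff.1 hzT
  have h2 := h _ (mem_insert _ _) w (mem_insert_of_mem _ hw) z hzT
  have h3 := norm_rhoPair_pos hzT (basePt_mem (m := m))
  have h4 := norm_rhoPair_pos hzT (hKT hw)
  rw [norm_testFun b a hzT, norm_rhoPair_symm w z, mul_left_comm]
  refine mul_le_mul_of_nonneg_left ?_ (by positivity)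
  calc ‖rhoPair z w‖ ^ (-b) = C ^ b * (C * ‖rhoPair z w‖) ^ (-b) := by
        rw [Real.mul_rpow hC.le h4.le, ← mul_assoc, ← Real.rpow_add hC, add_neg_cancel,
          Real.rpow_zero, one_mul]
    _ ≤ _ := by
        refine mul_le_mul_of_nonneg_left ?_ (by positivity)
        exact Real.rpow_le_rpow_of_nonpos h3 h2 (by linarith)

/-! ### Averages over Bergman balls -/

theorem Valpha_preimage_psi (α : ℝ) {z : Cn m} (hz : z ∈ TB m) {Q : Set (Cn m)}
    (hQ : MeasurableSet Q) :
    Valpha m α (psi z ⁻¹' Q) = ENNReal.ofReal (rho z ^ (m + 2 + α)) * Valpha m α Q := by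
  have hm : MeasurableSet (psi z ⁻¹' Q) := (continuous_psi z).measurable hQ
  rw [← lintegral_indicator_one hm, ← lintegral_indicator_one hQ, lintegral_Valpha_phi α hz]
  congr 2
  funext u
  have hiff : phi z u ∈ psi z ⁻¹' Q ↔ u ∈ Q := by rw [mem_preimage, psi_phi hz]
  by_cases h : u ∈ Q
  · rw [indicator_of_mem h, indicator_of_mem (hiff.2 h)]; rfl
  · rw [indicator_of_notMem h, indicator_of_notMem (fun h' => h (hiff.1 h'))]

theorem measurableSet_baseBall (s : ℝ) : MeasurableSet (baseBall m s) :=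
  Metric.isOpen_ball.measurableSet

theorem Valpha_baseBall_pos (α : ℝ) {s : ℝ} (hs0 : 0 < s) (hs : s ≤ smallRadius m) :
    0 < Valpha m α (baseBall m s) := by
  have hB : MeasurableSet (baseBall m s) := Metric.isOpen_ball.measurableSet
  rw [← setLIntegral_one, ← lintegral_indicator hB, lintegral_Valpha]
  calc 0 < ENNReal.ofReal (2 ^ (-|α|)) * volume (baseBall m s) := by
        refine ENNReal.mul_pos ?_ (volume_baseBall_pos hs0).ne'
        rw [Ne, ENNReal.ofReal_eq_zero, not_le]; positivity
    _ = ∫⁻ u in baseBall m s, ENNReal.ofReal (2 ^ (-|α|)) := by rw [setLIntegral_const]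
    _ ≤ ∫⁻ u in baseBall m s, ENNReal.ofReal (rho u ^ α) * (baseBall m s).indicator (fun _ => 1) u := by
        refine setLIntegral_mono' hB fun u hu => ?_
        have hb := rho_bounds_of_dist_le ((Metric.mem_ball.1 hu).le.trans hs)
        rw [indicator_of_mem hu, mul_one]
        exact ENNReal.ofReal_le_ofReal (two_rpow_neg_abs_le hb.1 hb.2 α)
    _ ≤ _ := lintegral_mono_set (baseBall_subset hs)

theorem exists_cell_in_ball (m : ℕ) {r : ℝ} (hr : 0 < r) :
    ∃ s > 0, s ≤ smallRadius m ∧ ∀ z ∈ TB m, cell s z ⊆ bergmanBall z r := by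
  refine ⟨min (smallRadius m) (r / (6 * (m + 1))), lt_min smallRadius_pos (by positivity),
    min_le_left _ _, fun z hz => cell_subset_bergmanBall (lt_min smallRadius_pos (by positivity))
    (min_le_left _ _) ?_ hz⟩
  calc 3 * ((m : ℝ) + 1) * min (smallRadius m) (r / (6 * (m + 1)))
      ≤ 3 * (m + 1) * (r / (6 * (m + 1))) := by gcongr; exact min_le_right _ _
    _ = r / 2 := by field_simp; norm_num
    _ < r := by linarith

theorem ofReal_rpow_neg_mul {x N : ℝ} (hx : 0 < x) :
    ENNReal.ofReal (x ^ (-N)) * ENNReal.ofReal (x ^ N) = 1 := by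
  rw [← ENNReal.ofReal_mul (by positivity), ← Real.rpow_add hx, neg_add_cancel, Real.rpow_zero,
    ENNReal.ofReal_one]

/-- A small cell lies in the Bergman ball, and the ball, being compactly contained in `psi
z`-coordinates, has volume at most a constant times ρ(z)^N. -/
theorem exists_cellAvg_le_averaging (α : ℝ) {r : ℝ} (hr : 0 < r) :
    ∃ s > 0, s ≤ smallRadius m ∧ ∃ C : ℝ≥0∞, C ≠ ⊤ ∧ ∀ (μ : Measure (Cn m)), ∀ z ∈ TB m,
      cellAvg α s μ z ≤ C * averaging α r μ z := by
  obtain ⟨s, hs0, hs, hsub⟩ := exists_cell_in_ball m hr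
  obtain ⟨ε, hε, R, -, hball⟩ := exists_bergmanBall_subset m r
  have hKm : MeasurableSet (core m ε R) := (isCompact_core ε R).measurableSet
  refine ⟨s, hs0, hs, Valpha m α (core m ε R), (Valpha_core_lt_top α hε R).ne, fun μ z hz => ?_⟩
  have hrz := mem_TB_iff.1 hz
  set v := Valpha m α (bergmanBall z r) with hv
  have hv1 : v ≤ ENNReal.ofReal (rho z ^ (m + 2 + α)) * Valpha m α (core m ε R) := by
    rw [← Valpha_preimage_psi α hz hKm]
    exact measure_mono fun w hw => hball z hz w hw
  -- Only for a finite nonzero volume does multiplication by v undo the division in the average.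
  have hvt : v ≠ ⊤ := (hv1.trans_lt (ENNReal.mul_lt_top ENNReal.ofReal_lt_top
    (Valpha_core_lt_top α hε R))).ne
  have hv0 : v ≠ 0 := by
    have h1 : Valpha m α (cell s z) ≤ v := measure_mono (hsub z hz)
    rw [cell, Valpha_preimage_psi α hz (measurableSet_baseBall s)] at h1
    refine (lt_of_lt_of_le (ENNReal.mul_pos ?_ (Valpha_baseBall_pos α hs0 hs).ne') h1).ne'
    rw [Ne, ENNReal.ofReal_eq_zero, not_le]; positivity
  have hle : (μ.restrict (TB m)) (cell s z) ≤ μ (bergmanBall z r) :=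
    (Measure.restrict_apply_le _ _).trans (measure_mono (hsub z hz))
  calc cellAvg α s μ z ≤ ENNReal.ofReal (rho z ^ (-(m + 2 + α))) * μ (bergmanBall z r) :=
        mul_le_mul' le_rfl hle
    _ = ENNReal.ofReal (rho z ^ (-(m + 2 + α))) * (averaging α r μ z * v) := by
        rw [averaging, ENNReal.div_mul_cancel hv0 hvt]
    _ ≤ ENNReal.ofReal (rho z ^ (-(m + 2 + α))) * (averaging α r μ z *
        (ENNReal.ofReal (rho z ^ (m + 2 + α)) * Valpha m α (core m ε R))) := by gcongr
    _ = (ENNReal.ofReal (rho z ^ (-(m + 2 + α))) * ENNReal.ofReal (rho z ^ (m + 2 + α))) *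
        (Valpha m α (core m ε R) * averaging α r μ z) := by ring
    _ = _ := by rw [ofReal_rpow_neg_mul hrz, one_mul]

/-- Averages are dominated by integrals of powers of `|ρ(w, z)|`. -/
theorem exists_averaging_le (α : ℝ) {r x : ℝ} (hr : 0 < r) (hx : 0 ≤ x) :
    ∃ C : ℝ≥0∞, C ≠ ⊤ ∧ ∀ (μ : Measure (Cn m)), ∀ z ∈ TB m,
      averaging α r μ z ≤ C * ∫⁻ w in TB m,
        ENNReal.ofReal (rho z ^ (x - (m + 2 + α)) * ‖rhoPair w z‖ ^ (-x)) ∂μ := by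
  obtain ⟨s, hs0, hs, hsub⟩ := exists_cell_in_ball m hr
  obtain ⟨ε, hε, R, -, hball⟩ := exists_bergmanBall_subset m r
  have hKm : MeasurableSet (core m ε R) := (isCompact_core ε R).measurableSet
  obtain ⟨B, hB⟩ := (isCompact_core (m := m) ε R).exists_bound_of_continuousOn
    (continuous_rhoPair_left (basePt m)).continuousOn
  set B' := |B| + 1 with hB'
  have hB0 : 0 < B' := by positivity
  have hvb := Valpha_baseBall_pos (m := m) α hs0 hs
  refine ⟨(Valpha m α (baseBall m s))⁻¹ * ENNReal.ofReal (B' ^ x),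
    ENNReal.mul_ne_top (ENNReal.inv_ne_top.2 hvb.ne') ENNReal.ofReal_ne_top, fun μ z hz => ?_⟩
  have hrz := mem_TB_iff.1 hz
  have hPm : MeasurableSet (psi z ⁻¹' core m ε R) := (continuous_psi z).measurable hKm
  have h1 : μ (bergmanBall z r) ≤ (μ.restrict (TB m)) (psi z ⁻¹' core m ε R) := by
    rw [Measure.restrict_apply hPm]
    exact measure_mono fun w hw => ⟨hball z hz w hw, hw.1⟩
  have h2 : ENNReal.ofReal (rho z ^ (-(m + 2 + α))) * (μ.restrict (TB m)) (psi z ⁻¹' core m ε R) ≤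
      ENNReal.ofReal (B' ^ x) * ∫⁻ w in TB m,
        ENNReal.ofReal (rho z ^ (x - (m + 2 + α)) * ‖rhoPair w z‖ ^ (-x)) ∂μ := by
    rw [← lintegral_indicator_one hPm, ← lintegral_const_mul' _ _ ENNReal.ofReal_ne_top,
      ← lintegral_const_mul' _ _ ENNReal.ofReal_ne_top]
    refine setLIntegral_mono' measurableSet_TB fun w hw => ?_
    by_cases hwc : w ∈ psi z ⁻¹' core m ε R
    · have hwp := norm_rhoPair_pos hw hz
      -- By invariance |ρ(w, z)| = ρ(z) |ρ(ψ_z w, 𝐢)|, and the last factor is bounded on the compact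
      -- set. Hence ρ(z)^(x - N) |ρ(w, z)|^(-x) is at least B'^(-x) ρ(z)^(-N) there.
      have e : ‖rhoPair w z‖ ≤ rho z * B' := by
        rw [rhoPair_eq_psi hz w z, psi_self hz, norm_mul, Complex.norm_real, Real.norm_eq_abs,
          abs_of_pos hrz]
        have := (hB _ hwc).trans (le_abs_self B)
        gcongr
        linarith
      rw [indicator_of_mem hwc, Pi.one_apply, mul_one, ← ENNReal.ofReal_mul (by positivity)]
      refine ENNReal.ofReal_le_ofReal ?_
      have h3 : (rho z * B') ^ (-x) ≤ ‖rhoPair w z‖ ^ (-x) :=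
        Real.rpow_le_rpow_of_nonpos hwp e (by linarith)
      calc rho z ^ (-(m + 2 + α)) = B' ^ x * (rho z ^ (x - (m + 2 + α)) * (rho z * B') ^ (-x)) := by
            rw [Real.mul_rpow hrz.le hB0.le, ← mul_assoc (rho z ^ _), ← Real.rpow_add hrz,
              mul_comm (rho z ^ _), ← mul_assoc, ← Real.rpow_add hB0, add_neg_cancel,
              Real.rpow_zero, one_mul]
            congr 1; ring
        _ ≤ _ := by gcongr
    · rw [indicator_of_notMem hwc, mul_zero]; exact zero_le
  have h3 : ENNReal.ofReal (rho z ^ (m + 2 + α)) * Valpha m α (baseBall m s) ≤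
      Valpha m α (bergmanBall z r) := by
    rw [← Valpha_preimage_psi α hz (measurableSet_baseBall s)]
    exact measure_mono (hsub z hz)
  have h0 : ENNReal.ofReal (rho z ^ (m + 2 + α)) ≠ 0 := by
    rw [Ne, ENNReal.ofReal_eq_zero, not_le]; positivity
  have hinv : (ENNReal.ofReal (rho z ^ (m + 2 + α)))⁻¹ = ENNReal.ofReal (rho z ^ (-(m + 2 + α))) := by
    rw [Real.rpow_neg hrz.le, ENNReal.ofReal_inv_of_pos (by positivity)]
  calc averaging α r μ z ≤ (μ.restrict (TB m)) (psi z ⁻¹' core m ε R) /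
        (ENNReal.ofReal (rho z ^ (m + 2 + α)) * Valpha m α (baseBall m s)) :=
        ENNReal.div_le_div h1 h3
    _ = (Valpha m α (baseBall m s))⁻¹ * (ENNReal.ofReal (rho z ^ (-(m + 2 + α))) *
        (μ.restrict (TB m)) (psi z ⁻¹' core m ε R)) := by
        rw [div_eq_mul_inv, ENNReal.mul_inv (Or.inl h0) (Or.inl ENNReal.ofReal_ne_top), hinv]
        ring
    _ ≤ _ := by
        rw [mul_assoc]
        exact mul_le_mul' le_rfl h2

end TestFunctions

/-! ### Berezin transforms, averages and Carleson measures -/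

section Equivalences

variable {m : ℕ}

theorem exists_carleson_embedding {α s t q : ℝ} (hα : -1 < α) (hs0 : 0 < s) (hs : s ≤ smallRadius m)
    (ht : 0 ≤ t) (hq : 1 ≤ q) {μ : Measure (Cn m)} (hμ : HasDecay t μ)
    (h0 : Tendsto (cellAvg α s μ) (toBoundary m) (𝓝 0)) :
    ∃ C : ℝ≥0∞, C ≠ ⊤ ∧ ∀ h : Cn m → ℂ, DifferentiableOn ℂ h (TB m) →
      ∫⁻ w in TB m, ‖h w‖ₑ ^ q ∂μ ≤ C * ∫⁻ u, ‖h u‖ₑ ^ q ∂Valpha m α := by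
  obtain ⟨C, hC, hc⟩ := exists_carleson m α hs0 hq
  obtain ⟨M, hM, hb⟩ := exists_cellAvg_bound hα hs ht hμ h0
  refine ⟨C * M, ENNReal.mul_ne_top hC hM, fun h hh => ?_⟩
  refine (hc μ (sFinite_restrict hμ) h hh).trans ?_
  rw [mul_assoc, ← lintegral_const_mul' _ _ hM]
  refine mul_le_mul' le_rfl (lintegral_mono_ae ?_)
  filter_upwards [ae_mem_TB α] with u hu
  rw [mul_comm]
  exact mul_le_mul' (hb u hu) le_rfl

theorem ENNReal_exists_mul_le {C d : ℝ≥0∞} (hC : C ≠ ⊤) (hd : 0 < d) : ∃ e > 0, C * e ≤ d := by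
  refine ⟨d / (C + 1), ENNReal.div_pos hd.ne' (ENNReal.add_ne_top.2 ⟨hC, ENNReal.one_ne_top⟩), ?_⟩
  calc C * (d / (C + 1)) ≤ (C + 1) * (d / (C + 1)) := mul_le_mul' le_self_add le_rfl
    _ ≤ d := ENNReal.mul_div_le

theorem ENNReal_exists_mul_rpow_le {C d : ℝ≥0∞} (hC : C ≠ ⊤) (hd : 0 < d) {q : ℝ} (hq : 0 < q) :
    ∃ e > 0, C * e ^ q ≤ d := by
  obtain ⟨e, he, h⟩ := ENNReal_exists_mul_le hC hd
  rcases eq_or_ne e ⊤ with rfl | het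
  · refine ⟨1, one_pos, (mul_le_mul' le_rfl ?_).trans h⟩
    simp
  · refine ⟨e ^ q⁻¹, ENNReal.rpow_pos he het, ?_⟩
    rwa [← ENNReal.rpow_mul, inv_mul_cancel₀ hq.ne', ENNReal.rpow_one]

/-- Bounded families that tend to `0` locally uniformly have weighted integrals tending to `0`. -/
theorem tendsto_lintegral_weight {ι : Type*} {l : Filter ι} {α q : ℝ} (hq : 0 < q)
    {a : Cn m → ℝ≥0∞} {M : ℝ≥0∞} (hM : M ≠ ⊤) (haM : ∀ u ∈ TB m, a u ≤ M)
    (ha : Tendsto a (toBoundary m) (𝓝 0)) {F : ι → Cn m → ℂ} {B : ℝ≥0∞} (hB : B ≠ ⊤)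
    (hFB : ∀ᶠ i in l, ∫⁻ u, ‖F i u‖ₑ ^ q ∂Valpha m α ≤ B)
    (hF0 : ∀ ε > 0, ∀ R : ℝ, ∀ η : ℝ≥0∞, 0 < η → ∀ᶠ i in l, ∀ z ∈ core m ε R, ‖F i z‖ₑ ≤ η) :
    Tendsto (fun i => ∫⁻ u, ‖F i u‖ₑ ^ q * a u ∂Valpha m α) l (𝓝 0) := by
  rw [ENNReal.tendsto_nhds_zero]
  intro d hd
  have hd2 : 0 < d / 2 := ENNReal.half_pos hd.ne'
  obtain ⟨e, he, hle⟩ := ENNReal_exists_mul_le hB hd2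
  obtain ⟨ε, hε, R, -, C, hC, h⟩ := exists_core_weight_bound α hM haM ha he hq.le
  obtain ⟨η, hη, hle'⟩ := ENNReal_exists_mul_rpow_le hC hd2 hq
  filter_upwards [hFB, hF0 ε hε R η hη] with i h1 h2
  refine (h (F i) η h2).trans ?_
  calc _ ≤ d / 2 + d / 2 := by
        refine add_le_add ((mul_le_mul' le_rfl h1).trans ?_) hle'
        rwa [mul_comm]
    _ = d := ENNReal.add_halves d

/-- Stated for a general filter because it serves both sequences (vanishing Carleson measures) and
families indexed by points tending to the boundary (the Berezin transform). -/
theorem tendsto_lintegral_carleson {ι : Type*} {l : Filter ι} {α s t q : ℝ} (hα : -1 < α)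
    (hs0 : 0 < s) (hs : s ≤ smallRadius m) (ht : 0 ≤ t) (hq : 1 ≤ q) {μ : Measure (Cn m)}
    (hμ : HasDecay t μ) (h0 : Tendsto (cellAvg α s μ) (toBoundary m) (𝓝 0))
    {F : ι → Cn m → ℂ} {B : ℝ≥0∞} (hB : B ≠ ⊤)
    (hFd : ∀ᶠ i in l, DifferentiableOn ℂ (F i) (TB m))
    (hFB : ∀ᶠ i in l, ∫⁻ u, ‖F i u‖ₑ ^ q ∂Valpha m α ≤ B)
    (hF0 : ∀ ε > 0, ∀ R : ℝ, ∀ η : ℝ≥0∞, 0 < η → ∀ᶠ i in l, ∀ z ∈ core m ε R, ‖F i z‖ₑ ≤ η) :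
    Tendsto (fun i => ∫⁻ w in TB m, ‖F i w‖ₑ ^ q ∂μ) l (𝓝 0) := by
  obtain ⟨C, hC, hc⟩ := exists_carleson m α hs0 hq
  obtain ⟨M, hM, hb⟩ := exists_cellAvg_bound hα hs ht hμ h0
  have h1 := tendsto_lintegral_weight (one_pos.trans_le hq) hM hb h0 hB hFB hF0
  have h2 := ENNReal.Tendsto.const_mul h1 (Or.inr hC)
  rw [mul_zero] at h2
  refine tendsto_of_tendsto_of_tendsto_of_le_of_le' tendsto_const_nhds h2
    (Eventually.of_forall fun _ => zero_le) ?_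
  filter_upwards [hFd] with i hi using hc μ (sFinite_restrict hμ) (F i) hi

theorem testFun_small_enorm {a b : ℝ} (ha : 0 < a) (hab : a < b) {ε : ℝ} (hε : 0 < ε) (R : ℝ)
    {η : ℝ≥0∞} (hη : 0 < η) :
    ∀ᶠ z in toBoundary m, ∀ w ∈ core m ε R, ‖testFun b a z w‖ₑ ≤ η := by
  obtain ⟨δ, hδ0, hδ⟩ := ENNReal.lt_iff_exists_nnreal_btwn.1 hη
  have hδ' : (0 : ℝ) < δ := by exact_mod_cast hδ0
  filter_upwards [testFun_small ha hab (isCompact_core ε R) (core_subset hε R) hδ'] with z hz w hw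
  refine le_trans ?_ hδ.le
  rw [← ofReal_norm, ← ENNReal.ofReal_coe_nnreal]
  exact ENNReal.ofReal_le_ofReal (hz w hw)

/-- The constant of the Bergman kernel. -/
def kernelConst (m : ℕ) (α : ℝ) : ℝ :=
  Real.Gamma ((m + 1 : ℝ) + α + 1) / (2 ^ (m + 2) * Real.pi ^ (m + 1) * Real.Gamma (α + 1))

theorem kernelConst_pos {α : ℝ} (hα : -1 < α) : 0 < kernelConst m α := by
  have : (0 : ℝ) ≤ m := Nat.cast_nonneg m
  have h1 : 0 < Real.Gamma ((m + 1 : ℝ) + α + 1) := Real.Gamma_pos_of_pos (by linarith)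
  have h2 : 0 < Real.Gamma (α + 1) := Real.Gamma_pos_of_pos (by linarith)
  unfold kernelConst
  positivity

theorem bergmanKernel_eq (α : ℝ) (z w : Cn m) :
    bergmanKernel α z w = kernelConst m α * kpow (m + 2 + α) w z := by
  rw [kpow, bergmanKernel, div_eq_mul_inv, ← Complex.cpow_neg]
  congr 2
  push_cast; ring

theorem norm_bergmanKernel {α : ℝ} (hα : -1 < α) (z w : Cn m) :
    ‖bergmanKernel α z w‖ = kernelConst m α * ‖rhoPair w z‖ ^ (-(m + 2 + α)) := by
  rw [bergmanKernel_eq, norm_mul, norm_kpow, Complex.norm_real, Real.norm_eq_abs,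
    abs_of_pos (kernelConst_pos hα), norm_rhoPair_symm]

theorem bergmanKernel_self_re {α : ℝ} {z : Cn m} (hz : z ∈ TB m) :
    (bergmanKernel α z z).re = kernelConst m α * rho z ^ (-(m + 2 + α)) := by
  rw [bergmanKernel_eq, kpow, rhoPair_self, ← Complex.ofReal_cpow (mem_TB_iff.1 hz).le,
    ← Complex.ofReal_mul, Complex.ofReal_re]

theorem enorm_normalizedKernel_sq {α : ℝ} (hα : -1 < α) {z : Cn m} (hz : z ∈ TB m) (w : Cn m) :
    ‖normalizedKernel α z w‖ₑ ^ 2 = ENNReal.ofReal (kernelConst m α *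
      (rho z ^ ((m : ℝ) + 2 + α) * ‖rhoPair w z‖ ^ (-(2 * (m + 2 + α))))) := by
  have hr := mem_TB_iff.1 hz
  have hc := kernelConst_pos (m := m) hα
  rw [← ofReal_norm, ← ENNReal.ofReal_pow (norm_nonneg _), normalizedKernel, norm_div,
    norm_bergmanKernel hα, Complex.norm_real, Real.norm_eq_abs, abs_of_nonneg (Real.sqrt_nonneg _),
    bergmanKernel_self_re hz, div_pow, Real.sq_sqrt (by positivity), mul_pow,
    ← Real.rpow_natCast (‖rhoPair w z‖ ^ _), ← Real.rpow_mul (norm_nonneg _), Real.rpow_neg hr.le]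
  congr 1
  field_simp
  congr 1
  push_cast; ring

theorem berezin_eq {α : ℝ} (hα : -1 < α) (μ : Measure (Cn m)) {z : Cn m} (hz : z ∈ TB m) :
    berezin α μ z = ENNReal.ofReal (kernelConst m α) *
      ∫⁻ w in TB m, ENNReal.ofReal (rho z ^ ((m : ℝ) + 2 + α) *
        ‖rhoPair w z‖ ^ (-(2 * (m + 2 + α)))) ∂μ := by
  rw [berezin, ← lintegral_const_mul' _ _ ENNReal.ofReal_ne_top]
  refine lintegral_congr fun w => ?_
  rw [enorm_normalizedKernel_sq hα hz, ENNReal.ofReal_mul (kernelConst_pos hα).le]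

/-- Normalized kernels are the test functions with b = N and a = N/2, so the Berezin transform is
governed by the Carleson estimates with q = 2. -/
theorem berezin_eq_testFun {α : ℝ} (hα : -1 < α) (μ : Measure (Cn m)) {z : Cn m} (hz : z ∈ TB m) :
    berezin α μ z = ENNReal.ofReal (kernelConst m α) *
      ∫⁻ w in TB m, ‖testFun (m + 2 + α) ((m + 2 + α) / 2) z w‖ₑ ^ (2 : ℝ) ∂μ := by
  rw [berezin_eq hα μ hz]
  congr 1
  refine lintegral_congr fun w => ?_
  rw [enorm_testFun_rpow zero_le_two hz]
  ring_nf

theorem homogeneousDim_pos {α : ℝ} (hα : -1 < α) : 0 < (m : ℝ) + 2 + α := by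
  have : (0 : ℝ) ≤ m := Nat.cast_nonneg m
  linarith

theorem berezin_lt_top {α s t : ℝ} (hα : -1 < α) (hs0 : 0 < s)
    (hs : s ≤ smallRadius m) (ht : 0 ≤ t) {μ : Measure (Cn m)} (hμ : HasDecay t μ)
    (h0 : Tendsto (cellAvg α s μ) (toBoundary m) (𝓝 0)) {z : Cn m} (hz : z ∈ TB m) :
    berezin α μ z < ⊤ := by
  have hN := homogeneousDim_pos (m := m) hα
  obtain ⟨C, hC, h⟩ := exists_carleson_embedding hα hs0 hs ht one_le_two hμ h0
  rw [berezin_eq_testFun hα μ hz]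
  refine ENNReal.mul_lt_top ENNReal.ofReal_lt_top
    ((h _ (differentiableOn_testFun _ _ hz)).trans_lt (ENNReal.mul_lt_top hC.lt_top ?_))
  have hap : ((m : ℝ) + 2 + α) / 2 * 2 = m + 2 + α := by ring
  rw [lintegral_testFun zero_le_two hap hz]
  exact testFun_lintegral_lt_top hα two_pos hap (by linarith)

theorem berezin_tendsto {α s t : ℝ} (hα : -1 < α) (hs0 : 0 < s)
    (hs : s ≤ smallRadius m) (ht : 0 ≤ t) {μ : Measure (Cn m)} (hμ : HasDecay t μ)
    (h0 : Tendsto (cellAvg α s μ) (toBoundary m) (𝓝 0)) :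
    Tendsto (berezin α μ) (toBoundary m) (𝓝 0) := by
  have hN := homogeneousDim_pos (m := m) hα
  have hap : ((m : ℝ) + 2 + α) / 2 * 2 = m + 2 + α := by ring
  have h1 := tendsto_lintegral_carleson (l := toBoundary m)
    (F := fun z => testFun (m + 2 + α) ((m + 2 + α) / 2) z) hα hs0 hs ht one_le_two hμ h0
    (testFun_lintegral_lt_top (m := m) (b := m + 2 + α) hα two_pos hap (by linarith)).ne
    (eventually_mem_TB.mono fun z hz => differentiableOn_testFun _ _ hz)
    (eventually_mem_TB.mono fun z hz => (lintegral_testFun zero_le_two hap hz).le)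
    (fun ε hε R η hη => testFun_small_enorm (by linarith) (by linarith) hε R hη)
  have h2 := ENNReal.Tendsto.const_mul (a := ENNReal.ofReal (kernelConst m α)) h1
    (Or.inr ENNReal.ofReal_ne_top)
  rw [mul_zero] at h2
  refine h2.congr' ?_
  filter_upwards [eventually_mem_TB] with z hz
  rw [berezin_eq_testFun hα μ hz]

/-- Dominated convergence: for z near z₀ the integrands are dominated by a multiple of the one at
z₀, which is integrable because the transform is finite there. -/
theorem berezin_continuousOn {α : ℝ} (hα : -1 < α) {μ : Measure (Cn m)}
    (hfin : ∀ z ∈ TB m, berezin α μ z ≠ ⊤) :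
    ContinuousOn (fun z => (berezin α μ z).toReal) (TB m) := by
  have hN := homogeneousDim_pos (m := m) hα
  have hc := kernelConst_pos (m := m) hα
  set N := (m : ℝ) + 2 + α with hNdef
  set g : Cn m → Cn m → ℝ := fun z w => rho z ^ N * ‖rhoPair w z‖ ^ (-(2 * N)) with hg
  have mg : ∀ z, Measurable (g z) := fun z => by
    have := (continuous_rhoPair_left z).measurable
    simp only [hg]; fun_prop
  have hg0 : ∀ z ∈ TB m, ∀ w, 0 ≤ g z w := fun z hz w => by
    have := mem_TB_iff.1 hz
    simp only [hg]; positivity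
  have heq : ∀ z ∈ TB m, (berezin α μ z).toReal = kernelConst m α * ∫ w in TB m, g z w ∂μ := by
    intro z hz
    rw [berezin_eq hα μ hz, ENNReal.toReal_mul, ENNReal.toReal_ofReal hc.le,
      integral_eq_lintegral_of_nonneg_ae (Eventually.of_forall (hg0 z hz))
        (mg z).aestronglyMeasurable]
  refine ContinuousOn.congr (continuousOn_const.mul fun z₀ hz₀ => ?_) heq
  refine ContinuousAt.continuousWithinAt ?_
  have hint : Integrable (g z₀) (μ.restrict (TB m)) := by
    refine ⟨(mg z₀).aestronglyMeasurable, ?_⟩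
    rw [hasFiniteIntegral_iff_ofReal (Eventually.of_forall (hg0 z₀ hz₀))]
    have h1 := hfin z₀ hz₀
    rw [berezin_eq hα μ hz₀] at h1
    refine lt_top_iff_ne_top.2 fun htop => h1 ?_
    simp only [hg] at htop
    rw [htop, ENNReal.mul_top]
    rw [Ne, ENNReal.ofReal_eq_zero, not_le]; exact hc
  obtain ⟨δ, hδ, hsub⟩ := Metric.nhds_basis_closedBall.mem_iff.1 (isOpen_TB.mem_nhds hz₀)
  have hK := isCompact_closedBall z₀ δ
  obtain ⟨C, hC, hcomp⟩ := exists_comparable hK hsub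
  obtain ⟨B, hB⟩ := hK.exists_bound_of_continuousOn (f := fun z : Cn m => rho z ^ N)
    (continuous_rho.continuousOn.rpow_const fun z _ => Or.inr hN.le)
  have hr₀ := mem_TB_iff.1 hz₀
  refine continuousAt_of_dominated (bound := fun w => |B| * C ^ (2 * N) * (rho z₀ ^ (-N) * g z₀ w))
    (Eventually.of_forall fun z => (mg z).aestronglyMeasurable) ?_
    ((hint.const_mul _).const_mul _) ?_
  · filter_upwards [Metric.closedBall_mem_nhds z₀ hδ] with z hz
    refine (ae_restrict_iff' measurableSet_TB).2 (Eventually.of_forall fun w hw => ?_)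
    have h1 := hcomp z₀ (Metric.mem_closedBall_self hδ.le) z hz w hw
    have hp0 := norm_rhoPair_pos hw hz₀
    have hp := norm_rhoPair_pos hw (hsub hz)
    rw [Real.norm_eq_abs, abs_of_nonneg (hg0 z (hsub hz) w)]
    simp only [hg]
    have h2 : ‖rhoPair w z‖ ^ (-(2 * N)) ≤ C ^ (2 * N) * ‖rhoPair w z₀‖ ^ (-(2 * N)) := by
      have := Real.rpow_le_rpow_of_nonpos hp0 h1 (show -(2 * N) ≤ 0 by linarith)
      rw [Real.mul_rpow hC.le hp.le, Real.rpow_neg hC.le] at this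
      rwa [inv_mul_le_iff₀ (by positivity)] at this
    have h3 : rho z ^ N ≤ |B| := (le_abs_self _).trans ((hB z hz).trans (le_abs_self B))
    have h4 : rho z₀ ^ (-N) * (rho z₀ ^ N * ‖rhoPair w z₀‖ ^ (-(2 * N))) =
        ‖rhoPair w z₀‖ ^ (-(2 * N)) := by
      rw [← mul_assoc, ← Real.rpow_add hr₀, neg_add_cancel, Real.rpow_zero, one_mul]
    rw [h4, mul_assoc]
    exact mul_le_mul h3 h2 (by positivity) (abs_nonneg B)
  · refine (ae_restrict_iff' measurableSet_TB).2 (Eventually.of_forall fun w hw => ?_)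
    refine (continuous_rho.continuousAt.rpow_const (Or.inl hr₀.ne')).mul ?_
    exact (continuous_rhoPair_right w).norm.continuousAt.rpow_const
      (Or.inl (norm_rhoPair_pos hw hz₀).ne')

theorem berezinMemC0_of_cellAvg {α s t : ℝ} (hα : -1 < α) (hs0 : 0 < s)
    (hs : s ≤ smallRadius m) (ht : 0 ≤ t) {μ : Measure (Cn m)} (hμ : HasDecay t μ)
    (h0 : Tendsto (cellAvg α s μ) (toBoundary m) (𝓝 0)) : BerezinMemC0 α μ := by
  have hfin : ∀ z ∈ TB m, berezin α μ z ≠ ⊤ := fun z hz =>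
    (berezin_lt_top hα hs0 hs ht hμ h0 hz).ne
  refine ⟨hfin, Complex.continuous_ofReal.comp_continuousOn (berezin_continuousOn hα hfin), ?_⟩
  have h1 := (ENNReal.tendsto_toReal ENNReal.zero_ne_top).comp
    (berezin_tendsto hα hs0 hs ht hμ h0)
  have h2 := (Complex.continuous_ofReal.tendsto _).comp h1
  rw [ENNReal.toReal_zero, Complex.ofReal_zero] at h2
  exact h2

theorem tendsto_averaging_of_le {α r : ℝ} {μ : Measure (Cn m)} {C : ℝ≥0∞} (hC : C ≠ ⊤)
    {I : Cn m → ℝ≥0∞} (hle : ∀ z ∈ TB m, averaging α r μ z ≤ C * I z)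
    (hI : Tendsto I (toBoundary m) (𝓝 0)) : Tendsto (averaging α r μ) (toBoundary m) (𝓝 0) := by
  have h2 := ENNReal.Tendsto.const_mul hI (Or.inr hC)
  rw [mul_zero] at h2
  exact tendsto_of_tendsto_of_tendsto_of_le_of_le' tendsto_const_nhds h2
    (Eventually.of_forall fun _ => zero_le) (eventually_mem_TB.mono hle)

/-- The dominating integral with x = 2N is the Berezin transform up to a constant. -/
theorem averaging_tendsto_of_berezin {α r : ℝ} (hr : 0 < r) (hα : -1 < α) {μ : Measure (Cn m)}
    (h : BerezinMemC0 α μ) : Tendsto (averaging α r μ) (toBoundary m) (𝓝 0) := by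
  have hN := homogeneousDim_pos (m := m) hα
  have hc := kernelConst_pos (m := m) hα
  obtain ⟨C, hC, hle⟩ := exists_averaging_le (m := m) α (x := 2 * (m + 2 + α)) hr (by linarith)
  -- Finiteness is essential here: `toReal` sends ⊤ to 0, so decay of the real-valued function alone
  -- would not suffice.
  have hb : Tendsto (berezin α μ) (toBoundary m) (𝓝 0) := by
    have h1 := (continuous_norm.tendsto _).comp h.2.2
    rw [norm_zero] at h1
    have h2 := (ENNReal.continuous_ofReal.tendsto _).comp h1
    rw [ENNReal.ofReal_zero] at h2
    refine h2.congr' ?_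
    filter_upwards [eventually_mem_TB] with z hz
    simp only [Function.comp_apply, Complex.norm_real, Real.norm_eq_abs, ENNReal.abs_toReal]
    exact ENNReal.ofReal_toReal (h.1 z hz)
  have hc0 : ENNReal.ofReal (kernelConst m α) ≠ 0 := by
    rw [Ne, ENNReal.ofReal_eq_zero, not_le]; exact hc
  refine tendsto_averaging_of_le (C := C * (ENNReal.ofReal (kernelConst m α))⁻¹)
    (ENNReal.mul_ne_top hC (ENNReal.inv_ne_top.2 hc0)) (fun z hz => ?_) hb
  refine (hle μ z hz).trans (le_of_eq ?_)
  rw [berezin_eq hα μ hz, mul_assoc, ← mul_assoc (ENNReal.ofReal (kernelConst m α))⁻¹,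
    ENNReal.inv_mul_cancel hc0 ENNReal.ofReal_ne_top, one_mul]
  ring_nf

theorem vanishingCarleson_of_cellAvg {α s t q : ℝ} (hα : -1 < α) (hq : 1 < q) (hs0 : 0 < s)
    (hs : s ≤ smallRadius m) (ht : 0 ≤ t) {μ : Measure (Cn m)} (hμ : HasDecay t μ)
    (h0 : Tendsto (cellAvg α s μ) (toBoundary m) (𝓝 0)) : VanishingCarleson α q μ := by
  have hq0 : 0 < q := one_pos.trans hq
  rintro f hf ⟨M, hM⟩ hunif
  refine tendsto_lintegral_carleson hα hs0 hs ht hq.le hμ h0 (B := ENNReal.ofReal M ^ q)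
    (ENNReal.rpow_ne_top_of_nonneg hq0.le ENNReal.ofReal_ne_top)
    (Eventually.of_forall fun k => (hf k).1) (Eventually.of_forall fun k => ?_)
    fun ε hε R η hη => ?_
  · rw [← eLpNorm_rpow_eq hq0]
    exact ENNReal.rpow_le_rpow (hM k) hq0.le
  · filter_upwards [EMetric.tendstoUniformlyOn_iff.1
      (hunif (core m ε R) (isCompact_core ε R) (core_subset hε R)) η hη] with k hk z hz
    have := hk z hz
    rw [Pi.zero_apply, edist_comm, edist_zero_right] at this
    exact this.le

theorem averaging_tendsto_of_vanishingCarleson {α r q : ℝ} (hr : 0 < r) (hα : -1 < α) (hq : 1 < q)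
    {μ : Measure (Cn m)} (h : VanishingCarleson α q μ) :
    Tendsto (averaging α r μ) (toBoundary m) (𝓝 0) := by
  have hN := homogeneousDim_pos (m := m) hα
  have hq0 : 0 < q := one_pos.trans hq
  set N := (m : ℝ) + 2 + α with hNdef
  have hap : N / q * q = m + 2 + α := by field_simp; rfl
  -- With b = (N + 1)/q and a = N/q, |f_z|^q equals ρ(z) |ρ(w, z)|^(-(N + 1)), the dominating
  -- integrand for x = N + 1.
  have hab : N / q < (N + 1) / q := by gcongr; linarith
  have ha0 : 0 < N / q := by positivity
  obtain ⟨C, hC, hle⟩ := exists_averaging_le (m := m) α (x := N + 1) hr (by linarith)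
  refine tendsto_averaging_of_le hC (hle μ) (tendsto_of_seq_tendsto fun u hu => ?_)
  have huT : ∀ᶠ k in atTop, u k ∈ TB m := hu.eventually eventually_mem_TB
  -- The value 0 is used only for the finitely many k with u k outside the tube, so that every term
  -- of the sequence is in the Bergman space.
  set f : ℕ → Cn m → ℂ := fun k => open Classical in
    if u k ∈ TB m then testFun ((N + 1) / q) (N / q) (u k) else 0 with hf
  have hJ := testFun_lintegral_lt_top (m := m) hα hq0 hap hab
  have hfB : ∀ k, MemBergman α q (f k) ∧
      ∫⁻ w, ‖f k w‖ₑ ^ q ∂Valpha m α ≤ kernelIntegral α ((N + 1) / q * q) (basePt m) := by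
    intro k
    by_cases hk : u k ∈ TB m
    · simp only [hf, hk, if_true]
      exact ⟨memBergman_testFun hα hq0 hap hab hk, (lintegral_testFun hq0.le hap hk).le⟩
    · simp only [hf, hk, if_false]
      refine ⟨⟨differentiableOn_const 0, MemLp.zero⟩, ?_⟩
      simp [ENNReal.zero_rpow_of_pos hq0]
  have key := h f (fun k => (hfB k).1) ?_ ?_
  · refine key.congr' ?_
    filter_upwards [huT] with k hk
    refine lintegral_congr fun w => ?_
    simp only [hf, hk, if_true]
    rw [enorm_testFun_rpow hq0.le hk]
    congr 2
    · congr 1; field_simp; ring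
    · congr 1; field_simp
  · refine ⟨(kernelIntegral α ((N + 1) / q * q) (basePt m) ^ q⁻¹).toReal, fun k => ?_⟩
    rw [ENNReal.ofReal_toReal (ENNReal.rpow_ne_top_of_nonneg (by positivity) hJ.ne),
      ← ENNReal.rpow_le_rpow_iff hq0, eLpNorm_rpow_eq hq0, ← ENNReal.rpow_mul,
      inv_mul_cancel₀ hq0.ne', ENNReal.rpow_one]
    exact (hfB k).2
  · intro K hK hKT
    rw [Metric.tendstoUniformlyOn_iff]
    intro η hη
    filter_upwards [huT, hu.eventually (testFun_small ha0 hab hK hKT (half_pos hη))] with k hk h1 w hw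
    simp only [hf, hk, if_true, Pi.zero_apply, dist_zero_left]
    linarith [h1 w hw]

end Equivalences

/-! ### Holomorphic functions of several variables -/

section Holomorphic

variable {m : ℕ}

/-- Cauchy's estimate for one variable, on the disc of radius δ/‖v‖ in the complex line through z in
the direction v. -/
theorem norm_fderiv_le_of_closedBall {E : Type*} [NormedAddCommGroup E] [NormedSpace ℂ E]
    {h : E → ℂ} {z : E} {δ M : ℝ} (hδ : 0 < δ) {U : Set E} (hU : IsOpen U)
    (hh : DifferentiableOn ℂ h U) (hsub : Metric.closedBall z δ ⊆ U)
    (hM : ∀ y ∈ Metric.closedBall z δ, ‖h y‖ ≤ M) : ‖fderiv ℂ h z‖ ≤ M / δ := by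
  have hM0 : 0 ≤ M := (norm_nonneg _).trans (hM z (Metric.mem_closedBall_self hδ.le))
  refine ContinuousLinearMap.opNorm_le_bound _ (by positivity) fun v => ?_
  rcases eq_or_ne v 0 with rfl | hv
  · simp
  have hv0 : 0 < ‖v‖ := norm_pos_iff.2 hv
  have hmem : ∀ l : ℂ, ‖l‖ ≤ δ / ‖v‖ → z + l • v ∈ Metric.closedBall z δ := by
    intro l hl
    rw [Metric.mem_closedBall, dist_eq_norm, add_sub_cancel_left, norm_smul]
    rwa [le_div_iff₀ hv0] at hl
  have hz : DifferentiableAt ℂ h z :=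
    (hh z (hsub (Metric.mem_closedBall_self hδ.le))).differentiableAt
      (hU.mem_nhds (hsub (Metric.mem_closedBall_self hδ.le)))
  have hline : HasDerivAt (fun l : ℂ => z + l • v) v 0 := by
    simpa using ((hasDerivAt_id (0 : ℂ)).smul_const v).const_add z
  have hder : deriv (fun l : ℂ => h (z + l • v)) 0 = fderiv ℂ h z v := by
    have h1 : HasFDerivAt h (fderiv ℂ h z) (z + (0 : ℂ) • v) := by
      simpa using hz.hasFDerivAt
    exact (h1.comp_hasDerivAt 0 hline).deriv
  have hd : DiffContOnCl ℂ (fun l : ℂ => h (z + l • v)) (Metric.ball 0 (δ / ‖v‖)) := by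
    refine DifferentiableOn.diffContOnCl ?_
    rw [closure_ball _ (by positivity)]
    refine hh.comp (by fun_prop) fun l hl => hsub (hmem l ?_)
    simpa using hl
  have := Complex.norm_deriv_le_of_forall_mem_sphere_norm_le (C := M) (by positivity) hd
    fun l hl => hM _ (hmem l (by simpa using (mem_sphere_zero_iff_norm.1 hl).le))
  rw [hder] at this
  refine this.trans (le_of_eq ?_)
  field_simp

theorem exists_closedBall_two_mul {z : Cn m} (hz : z ∈ TB m) :
    ∃ δ > 0, Metric.closedBall z (2 * δ) ⊆ TB m := by
  obtain ⟨δ, hδ, hsub⟩ := Metric.nhds_basis_closedBall.mem_iff.1 (isOpen_TB.mem_nhds hz)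
  exact ⟨δ / 2, half_pos hδ, by rwa [mul_div_cancel₀ _ two_ne_zero]⟩

theorem closedBall_subset_two_mul {z x : Cn m} {δ : ℝ} (hx : x ∈ Metric.ball z δ) :
    Metric.closedBall x δ ⊆ Metric.closedBall z (2 * δ) :=
  Metric.closedBall_subset_closedBall' (by linarith [Metric.mem_ball.1 hx])

/-- Locally uniformly Cauchy sequences of holomorphic functions have holomorphic limits. -/
theorem exists_holomorphic_limit {F : ℕ → Cn m → ℂ} (hF : ∀ k, DifferentiableOn ℂ (F k) (TB m))
    (hC : ∀ K : Set (Cn m), IsCompact K → K ⊆ TB m → UniformCauchySeqOn F atTop K) :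
    ∃ G : Cn m → ℂ, DifferentiableOn ℂ G (TB m) ∧
      ∀ z ∈ TB m, Tendsto (fun k => F k z) atTop (𝓝 (G z)) := by
  have hlim : ∀ z ∈ TB m, ∃ y, Tendsto (fun k => F k z) atTop (𝓝 y) := by
    intro z hz
    have h1 := hC {z} isCompact_singleton (singleton_subset_iff.2 hz)
    exact cauchySeq_tendsto_of_complete (h1.cauchySeq (mem_singleton z))
  choose! G hG using hlim
  refine ⟨G, fun z₀ hz₀ => ?_, hG⟩
  obtain ⟨δ, hδ, hsub⟩ := exists_closedBall_two_mul hz₀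
  have hunif := hC _ (isCompact_closedBall z₀ (2 * δ)) hsub
  have hballT : ∀ x ∈ Metric.ball z₀ δ, x ∈ TB m := fun x hx =>
    hsub (closedBall_subset_two_mul hx (Metric.mem_closedBall_self hδ.le))
  have hdiff : ∀ k, ∀ x ∈ Metric.ball z₀ δ, DifferentiableAt ℂ (F k) x := fun k x hx =>
    (hF k x (hballT x hx)).differentiableAt (isOpen_TB.mem_nhds (hballT x hx))
  -- Balls of radius δ about points of the smaller ball stay in the ball of radius 2δ, so Cauchy's
  -- estimate makes the derivatives uniformly Cauchy too.
  have hderC : UniformCauchySeqOn (fun k => fderiv ℂ (F k)) atTop (Metric.ball z₀ δ) := by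
    rw [Metric.uniformCauchySeqOn_iff] at hunif ⊢
    intro ε hε
    obtain ⟨n₀, hn⟩ := hunif (ε / 2 * δ) (by positivity)
    refine ⟨n₀, fun k hk l hl x hx => ?_⟩
    rw [dist_eq_norm, ← fderiv_sub (hdiff k x hx) (hdiff l x hx)]
    have := norm_fderiv_le_of_closedBall (h := F k - F l) (M := ε / 2 * δ) hδ isOpen_TB
      ((hF k).sub (hF l)) ((closedBall_subset_two_mul hx).trans hsub) fun y hy => by
        rw [Pi.sub_apply, ← dist_eq_norm]
        exact (hn k hk l hl y (closedBall_subset_two_mul hx hy)).le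
    rw [mul_div_cancel_right₀ _ hδ.ne'] at this
    linarith
  have hlim' : ∀ x ∈ Metric.ball z₀ δ, ∃ y, Tendsto (fun k => fderiv ℂ (F k) x) atTop (𝓝 y) :=
    fun x hx => cauchySeq_tendsto_of_complete (hderC.cauchySeq hx)
  choose! G' hG' using hlim'
  have hT := hderC.tendstoUniformlyOn_of_tendsto hG'
  exact (hasFDerivAt_of_tendstoUniformlyOn Metric.isOpen_ball hT
    (fun k x hx => (hdiff k x hx).hasFDerivAt)
    (fun x hx => hG x (hballT x hx)) (Metric.mem_ball_self hδ)).differentiableAt.differentiableWithinAt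

/-- Point evaluations are bounded, uniformly on compact sets. -/
theorem exists_core_bound (α : ℝ) {p : ℝ} (hp : 1 ≤ p) (hα : -1 < α) {ε : ℝ} (hε : 0 < ε) (R : ℝ) :
    ∃ C : ℝ≥0∞, C ≠ ⊤ ∧ ∀ h : Cn m → ℂ, DifferentiableOn ℂ h (TB m) → ∀ w ∈ core m ε R,
      ‖h w‖ₑ ≤ C * eLpNorm h (ENNReal.ofReal p) (Valpha m α) := by
  have hN := homogeneousDim_pos (m := m) hα
  have hp0 : 0 < p := one_pos.trans_le hp
  obtain ⟨C, hC, h⟩ := exists_submean (m := m) α smallRadius_pos le_rfl hp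
  refine ⟨(C * ENNReal.ofReal (ε ^ (-(m + 2 + α)))) ^ p⁻¹,
    ENNReal.rpow_ne_top_of_nonneg (by positivity) (ENNReal.mul_ne_top hC ENNReal.ofReal_ne_top),
    fun f hf w hw => ?_⟩
  rw [← ENNReal.rpow_le_rpow_iff hp0, ENNReal.mul_rpow_of_nonneg _ _ hp0.le, ← ENNReal.rpow_mul,
    inv_mul_cancel₀ hp0.ne', ENNReal.rpow_one, eLpNorm_rpow_eq hp0]
  refine (h f hf w (core_subset hε R hw)).trans ?_
  refine mul_le_mul' (mul_le_mul' le_rfl (ENNReal.ofReal_le_ofReal ?_))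
    (setLIntegral_le_lintegral _ _)
  exact Real.rpow_le_rpow_of_nonpos hε hw.1 (by linarith)

theorem eq_on_TB_of_ae_eq {α : ℝ} {F G : Cn m → ℂ} (hF : ContinuousOn F (TB m))
    (hG : ContinuousOn G (TB m)) (h : F =ᵐ[Valpha m α] G) : EqOn F G (TB m) := by
  have hac : volume.restrict (TB m) ≪ Valpha m α := by
    refine withDensity_absolutelyContinuous' (measurable_rho_rpow α).aemeasurable ?_
    refine (ae_restrict_iff' measurableSet_TB).2 (Eventually.of_forall fun z hz => ?_)
    rw [Ne, ENNReal.ofReal_eq_zero, not_le]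
    exact Real.rpow_pos_of_pos (mem_TB_iff.1 hz) _
  exact Measure.eqOn_open_of_ae_eq (hac.ae_le h) isOpen_TB hF hG

/-- The Bergman space is complete. -/
theorem isClosed_bergmanSpace {α p : ℝ} (hp : 1 < p) (hα : -1 < α)
    [Fact (1 ≤ ENNReal.ofReal p)] :
    IsClosed (bergmanSpace m α p : Set (Lp ℂ (ENNReal.ofReal p) (Valpha m α))) := by
  refine IsSeqClosed.isClosed fun f g hf hfg => ?_
  have hf' : ∀ k, ∃ F : Cn m → ℂ, MemBergman α p F ∧ f k =ᵐ[Valpha m α] F := hf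
  choose F hF hfF using hf'
  have hcauchy := hfg.cauchySeq
  have hUC : ∀ K : Set (Cn m), IsCompact K → K ⊆ TB m → UniformCauchySeqOn F atTop K := by
    intro K hK hKT
    obtain ⟨ε, hε, R, -, hKc⟩ := exists_subset_core hK hKT
    obtain ⟨C, hC, hb⟩ := exists_core_bound (m := m) α hp.le hα hε R
    rw [Metric.uniformCauchySeqOn_iff]
    intro η hη
    rw [Metric.cauchySeq_iff] at hcauchy
    obtain ⟨n, hn⟩ := hcauchy (η / (C.toReal + 1)) (by positivity)
    refine ⟨n, fun k hk l hl z hz => ?_⟩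
    have h1 := hb (F k - F l) ((hF k).1.sub (hF l).1) z (hKc hz)
    have h2 : eLpNorm (F k - F l) (ENNReal.ofReal p) (Valpha m α) = edist (f k) (f l) := by
      rw [Lp.edist_def]
      exact eLpNorm_congr_ae ((hfF k).sub (hfF l)).symm
    have h3 := hn k hk l hl
    rw [h2] at h1
    rw [edist_dist] at h1
    have h4 : ‖(F k - F l) z‖ ≤ C.toReal * dist (f k) (f l) := by
      have := ENNReal.toReal_mono (ENNReal.mul_ne_top hC ENNReal.ofReal_ne_top) h1
      rwa [ENNReal.toReal_mul, ENNReal.toReal_ofReal dist_nonneg, toReal_enorm] at this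
    rw [dist_eq_norm]
    rw [lt_div_iff₀ (by positivity)] at h3
    rw [Pi.sub_apply] at h4
    nlinarith [dist_nonneg (x := f k) (y := f l)]
  obtain ⟨G, hG, hFG⟩ := exists_holomorphic_limit (fun k => (hF k).1) hUC
  -- An almost everywhere convergent subsequence identifies the L^p limit with the locally uniform
  -- limit G.
  obtain ⟨ns, hns, hae⟩ := (tendstoInMeasure_of_tendsto_Lp hfg).exists_seq_tendsto_ae
  have hgG : g =ᵐ[Valpha m α] G := by
    filter_upwards [hae, ae_all_iff.2 hfF, ae_mem_TB α] with z h1 h2 hz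
    refine tendsto_nhds_unique h1 ?_
    simp only [h2]
    exact (hFG z hz).comp hns.tendsto_atTop
  exact ⟨G, ⟨hG, (memLp_congr_ae hgG).1 (Lp.memLp g)⟩, hgG⟩

/-! ### Holomorphy of `T_μ f` -/

/-- The complex derivative of `ρ(·, w)`. -/
def rhoPairDeriv (z w : Cn m) : Cn m →L[ℂ] ℂ :=
  (1 / 4 : ℂ) • ((∑ j : Fin m, (2 * (z j.castSucc - star (w j.castSucc))) •
      (ContinuousLinearMap.proj j.castSucc : Cn m →L[ℂ] ℂ)) -
    (2 * Complex.I) • (ContinuousLinearMap.proj (Fin.last m) : Cn m →L[ℂ] ℂ))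

theorem hasFDerivAt_rhoPair (z w : Cn m) :
    HasFDerivAt (fun z => rhoPair z w) (rhoPairDeriv z w) z := by
  have hp : ∀ i, HasFDerivAt (fun z : Cn m => z i) (ContinuousLinearMap.proj i : Cn m →L[ℂ] ℂ) z :=
    fun i => (ContinuousLinearMap.proj i : Cn m →L[ℂ] ℂ).hasFDerivAt
  unfold rhoPair rhoPairDeriv
  refine HasFDerivAt.const_mul (HasFDerivAt.sub (HasFDerivAt.fun_sum fun j _ => ?_) ?_) _
  · convert! ((hp j.castSucc).sub_const (star (w j.castSucc))).pow 2 using 1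
    simp
  · exact ((hp (Fin.last m)).sub_const _).const_mul _

theorem continuous_rhoPairDeriv (z : Cn m) : Continuous fun w => rhoPairDeriv z w := by
  unfold rhoPairDeriv; fun_prop

theorem kpow_swap_hasFDerivAt (b : ℝ) {z w : Cn m} (hz : z ∈ TB m) (hw : w ∈ TB m) :
    HasFDerivAt (fun z => kpow b w z)
      ((((-b : ℝ) : ℂ) * rhoPair z w ^ (((-b : ℝ) : ℂ) - 1)) • rhoPairDeriv z w) z := by
  have h := (hasDerivAt_id (rhoPair z w)).cpow_const (c := ((-b : ℝ) : ℂ))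
    (rhoPair_mem_slitPlane hz hw)
  rw [mul_one] at h
  exact h.comp_hasFDerivAt z (hasFDerivAt_rhoPair z w)

theorem exists_kpow_bound {b : ℝ} (hb : 0 ≤ b) {K : Set (Cn m)} (hK : IsCompact K)
    (hKT : K ⊆ TB m) : ∃ C > 0, ∀ z ∈ K, ∀ w ∈ TB m,
      ‖rhoPair w z‖ ^ (-b) ≤ C * ‖rhoPair w (basePt m)‖ ^ (-b) := by
  obtain ⟨C, hC, h⟩ := exists_comparable (hK.insert (basePt m)) (insert_subset basePt_mem hKT)
  refine ⟨C ^ b, by positivity, fun z hz w hw => ?_⟩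
  have h1 := h _ (mem_insert _ _) z (mem_insert_of_mem _ hz) w hw
  have hp := norm_rhoPair_pos hw (hKT hz)
  have h2 := Real.rpow_le_rpow_of_nonpos (norm_rhoPair_pos hw basePt_mem) h1
    (show -b ≤ 0 by linarith)
  rw [Real.mul_rpow hC.le hp.le, Real.rpow_neg hC.le] at h2
  rwa [inv_mul_le_iff₀ (by positivity)] at h2

theorem continuousOn_bergmanKernel (α : ℝ) {z : Cn m} (hz : z ∈ TB m) :
    ContinuousOn (fun w => bergmanKernel α z w) (TB m) := by
  simp only [bergmanKernel_eq, kpow]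
  refine continuousOn_const.mul ?_
  exact (continuous_rhoPair_right z).continuousOn.cpow_const fun w hw =>
    rhoPair_mem_slitPlane hz hw

theorem measurable_rhoPair_rpow (b : ℝ) (z : Cn m) :
    Measurable fun w : Cn m => ‖rhoPair w z‖ ^ b := by
  have := (continuous_rhoPair_left z).measurable
  fun_prop

/-- `∫ |ρ(w, 𝐢)|^(-N) |g(w)| dμ(w) < ∞`, the condition under which `T_μ g` is defined. -/
def ToeplitzIntegrable (α : ℝ) (μ : Measure (Cn m)) (g : Cn m → ℂ) : Prop :=
  AEStronglyMeasurable g (μ.restrict (TB m)) ∧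
    ∫⁻ w in TB m, ENNReal.ofReal (‖rhoPair w (basePt m)‖ ^ (-(m + 2 + α))) * ‖g w‖ₑ ∂μ < ⊤

theorem ToeplitzIntegrable.integrable_bound {α : ℝ} {μ : Measure (Cn m)} {g : Cn m → ℂ}
    (hg : ToeplitzIntegrable α μ g) :
    Integrable (fun w => ‖rhoPair w (basePt m)‖ ^ (-(m + 2 + α)) * ‖g w‖) (μ.restrict (TB m)) := by
  refine ⟨(measurable_rhoPair_rpow _ _).aestronglyMeasurable.mul hg.1.norm, ?_⟩
  rw [hasFiniteIntegral_iff_ofReal (Eventually.of_forall fun w => by positivity)]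
  refine lt_of_le_of_lt (le_of_eq (lintegral_congr fun w => ?_)) hg.2
  rw [ENNReal.ofReal_mul (by positivity), ofReal_norm]

theorem ToeplitzIntegrable.integrable {α : ℝ} (hα : -1 < α) {μ : Measure (Cn m)} {g : Cn m → ℂ}
    (hg : ToeplitzIntegrable α μ g) {z : Cn m} (hz : z ∈ TB m) :
    Integrable (fun w => bergmanKernel α z w * g w) (μ.restrict (TB m)) := by
  obtain ⟨C, hC, h⟩ := exists_kpow_bound (homogeneousDim_pos (m := m) hα).le
    (isCompact_singleton (x := z)) (singleton_subset_iff.2 hz)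
  have hm : AEStronglyMeasurable (fun w => bergmanKernel α z w) (μ.restrict (TB m)) :=
    (continuousOn_bergmanKernel α hz).aestronglyMeasurable measurableSet_TB
  refine (hg.integrable_bound.const_mul (kernelConst m α * C)).mono' (hm.mul hg.1) ?_
  refine (ae_restrict_iff' measurableSet_TB).2 (Eventually.of_forall fun w hw => ?_)
  have hc := kernelConst_pos (m := m) hα
  rw [norm_mul, norm_bergmanKernel hα, ← mul_assoc]
  refine mul_le_mul_of_nonneg_right ?_ (norm_nonneg _)
  rw [mul_assoc]
  exact mul_le_mul_of_nonneg_left (h z rfl w hw) hc.le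

/-- Differentiation under the integral. The derivative of the integrand is dominated through
Cauchy's estimate, so a bound for the kernel itself is enough. -/
theorem ToeplitzIntegrable.differentiableOn {α : ℝ} (hα : -1 < α) {μ : Measure (Cn m)}
    {g : Cn m → ℂ} (hg : ToeplitzIntegrable α μ g) :
    DifferentiableOn ℂ (toeplitz α μ g) (TB m) := by
  intro z₀ hz₀
  set N := (m : ℝ) + 2 + α with hN
  have hN0 : 0 < N := homogeneousDim_pos hα
  have hc := kernelConst_pos (m := m) hα
  obtain ⟨δ, hδ, hsub⟩ := exists_closedBall_two_mul hz₀
  obtain ⟨C, hC, hb⟩ := exists_kpow_bound hN0.le (isCompact_closedBall z₀ (2 * δ)) hsub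
  have hballT : ∀ x ∈ Metric.ball z₀ δ, x ∈ TB m := fun x hx =>
    hsub (closedBall_subset_two_mul hx (Metric.mem_closedBall_self hδ.le))
  have hder : ∀ x ∈ TB m, ∀ w ∈ TB m, HasFDerivAt (fun z => bergmanKernel α z w * g w)
      ((g w * (kernelConst m α * (((-N : ℝ) : ℂ) * rhoPair x w ^ (((-N : ℝ) : ℂ) - 1)))) •
        rhoPairDeriv x w) x := by
    intro x hx w hw
    have h1 := ((kpow_swap_hasFDerivAt N hx hw).const_mul (kernelConst m α : ℂ)).mul_const (g w)
    simp only [bergmanKernel_eq, ← hN]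
    convert! h1 using 1
    rw [smul_smul, smul_smul, mul_assoc]
  refine (hasFDerivAt_integral_of_dominated_of_fderiv_le (𝕜 := ℂ)
    (F := fun z w => bergmanKernel α z w * g w)
    (F' := fun x w => (g w * (kernelConst m α * (((-N : ℝ) : ℂ) *
      rhoPair x w ^ (((-N : ℝ) : ℂ) - 1)))) • rhoPairDeriv x w)
    (bound := fun w => kernelConst m α * C / δ * (‖rhoPair w (basePt m)‖ ^ (-N) * ‖g w‖))
    (Metric.ball_mem_nhds z₀ hδ) ?_ (hg.integrable hα hz₀) ?_ ?_
    (hg.integrable_bound.const_mul _) ?_).differentiableAt.differentiableWithinAt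
  · filter_upwards [isOpen_TB.mem_nhds hz₀] with z hz using (hg.integrable hα hz).1
  · refine AEStronglyMeasurable.smul (hg.1.mul ?_) (continuous_rhoPairDeriv z₀).aestronglyMeasurable
    refine ContinuousOn.aestronglyMeasurable ?_ measurableSet_TB
    exact continuousOn_const.mul (continuousOn_const.mul
      ((continuous_rhoPair_right z₀).continuousOn.cpow_const fun w hw =>
        rhoPair_mem_slitPlane hz₀ hw))
  · refine (ae_restrict_iff' measurableSet_TB).2 (Eventually.of_forall fun w hw x hx => ?_)
    rw [← (hder x (hballT x hx) w hw).fderiv]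
    have h2 := norm_fderiv_le_of_closedBall (h := fun z => bergmanKernel α z w * g w)
      (M := kernelConst m α * (C * ‖rhoPair w (basePt m)‖ ^ (-N)) * ‖g w‖) hδ isOpen_TB
      (fun z hz => (hder z hz w hw).differentiableAt.differentiableWithinAt)
      ((closedBall_subset_two_mul hx).trans hsub) fun y hy => ?_
    · refine h2.trans (le_of_eq ?_)
      ring
    · rw [norm_mul, norm_bergmanKernel hα]
      have := hb y (closedBall_subset_two_mul hx hy) w hw
      gcongr
  · exact (ae_restrict_iff' measurableSet_TB).2 (Eventually.of_forall fun w hw x hx =>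
      hder x (hballT x hx) w hw)

end Holomorphic

/-! ### The integral operator with kernel `|ρ(u, z)|^(-N)` -/

section AbsKernel

variable {m : ℕ}

/-- `|ρ(u, z)|^(-N)`, the modulus of the Bergman kernel up to a constant. -/
def absKer (α : ℝ) (z u : Cn m) : ℝ≥0∞ := ENNReal.ofReal (‖rhoPair u z‖ ^ (-((m : ℝ) + 2 + α)))

/-- The integral operator with kernel `absKer`. -/
def absOp (α : ℝ) (g : Cn m → ℝ≥0∞) (z : Cn m) : ℝ≥0∞ := ∫⁻ u, absKer α z u * g u ∂Valpha m α

theorem absKer_symm (α : ℝ) (z u : Cn m) : absKer α z u = absKer α u z := by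
  rw [absKer, absKer, norm_rhoPair_symm]

theorem measurable_absKer_pair (α : ℝ) :
    Measurable fun x : Cn m × Cn m => absKer α x.1 x.2 := by
  have h : Measurable fun x : Cn m × Cn m => ‖rhoPair x.1 x.2‖ :=
    (continuous_rhoPair (m := m)).norm.measurable
  have e : (fun x : Cn m × Cn m => absKer α x.1 x.2) =
      fun x => ENNReal.ofReal (‖rhoPair x.1 x.2‖ ^ (-((m : ℝ) + 2 + α))) :=
    funext fun x => absKer_symm α x.1 x.2
  rw [e]
  exact (h.pow_const _).ennreal_ofReal

theorem measurable_absKer (α : ℝ) (z : Cn m) : Measurable (absKer α z) :=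
  (measurable_rhoPair_rpow (-((m : ℝ) + 2 + α)) z).ennreal_ofReal

/-- Powers of ρ are reproduced by the kernel up to a constant, which makes them the auxiliary
functions for Schur's test. -/
theorem lintegral_absKer_rho (α : ℝ) {e : ℝ} {z : Cn m} (hz : z ∈ TB m) :
    ∫⁻ u, absKer α z u * ENNReal.ofReal (rho u ^ (-e)) ∂Valpha m α =
      ENNReal.ofReal (rho z ^ (-e)) * kernelIntegral (α - e) (m + 2 + α) (basePt m) := by
  have h := lintegral_Valpha_kernel α (-e) (m + 2 + α) z
  rw [kernelIntegral_eq _ _ hz, show (m : ℝ) + 2 + (α + -e) - (m + 2 + α) = -e by ring] at h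
  rw [sub_eq_add_neg, ← h]
  refine lintegral_congr fun u => ?_
  rw [absKer, mul_comm, ENNReal.ofReal_mul' (by positivity)]

theorem ofReal_rho_rpow_rpow {z : Cn m} (hz : z ∈ TB m) (e : ℝ) (y : ℝ) :
    ENNReal.ofReal (rho z ^ e) ^ y = ENNReal.ofReal (rho z ^ (e * y)) := by
  have hr := mem_TB_iff.1 hz
  rw [ENNReal.ofReal_rpow_of_pos (by positivity), ← Real.rpow_mul hr.le]

/-- Schur's test: the operator `absOp` is bounded on `L^p`. -/
theorem exists_absOp_bound (m : ℕ) {α p : ℝ} (hα : -1 < α) (hp : 1 < p) :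
    ∃ C : ℝ≥0∞, C ≠ ⊤ ∧ ∀ g : Cn m → ℝ≥0∞, Measurable g →
      ∫⁻ z, absOp α g z ^ p ∂Valpha m α ≤ C * ∫⁻ u, g u ^ p ∂Valpha m α := by
  have hpq := Real.HolderConjugate.conjExponent hp
  set p' := p.conjExponent with hp'
  have hp0 : 0 < p := hpq.pos
  have hp'0 : 0 < p' := hpq.symm.pos
  -- Small enough that δp and δp' are both below α + 1, so that `kernelIntegral` converges at 𝐢 for
  -- ρ^(α - δp) and ρ^(α - δp').
  set δ := (α + 1) / (2 * p * p') with hδ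
  have hα1 : 0 < α + 1 := by linarith
  have hδ0 : 0 < δ := by positivity
  have h1 : -1 < α - δ * p' := by
    have : δ * p' * (2 * p) = α + 1 := by rw [hδ]; field_simp
    nlinarith [mul_pos hδ0 hp'0]
  have h2 : -1 < α - δ * p := by
    have : δ * p * (2 * p') = α + 1 := by rw [hδ]; field_simp
    nlinarith [mul_pos hδ0 hp0, hpq.symm.lt]
  have hI1 := kernelIntegral_basePt_lt_top (m := m) h1 (s := m + 2 + α)
    (by nlinarith [mul_pos hδ0 hp'0])
  have hI2 := kernelIntegral_basePt_lt_top (m := m) h2 (s := m + 2 + α)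
    (by nlinarith [mul_pos hδ0 hp0])
  set c1 := kernelIntegral (α - δ * p') (m + 2 + α) (basePt m)
  set c2 := kernelIntegral (α - δ * p) (m + 2 + α) (basePt m)
  refine ⟨c1 ^ (p / p') * c2, ENNReal.mul_ne_top
    (ENNReal.rpow_ne_top_of_nonneg (by positivity) hI1.ne) hI2.ne, fun g hg => ?_⟩
  have mr := measurable_rho_rpow (m := m)
  have key : ∀ z ∈ TB m, absOp α g z ^ p ≤ c1 ^ (p / p') * (ENNReal.ofReal (rho z ^ (-(δ * p))) *
      ∫⁻ u, absKer α z u * (ENNReal.ofReal (rho u ^ (δ * p)) * g u ^ p) ∂Valpha m α) := by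
    intro z hz
    have mk := measurable_absKer α z
    -- Schur's splitting k g = (k^(1/p') ρ^(-δ)) (k^(1/p) ρ^δ g), with k the kernel.
    have hH := ENNReal.lintegral_mul_le_Lp_mul_Lq (Valpha m α) hpq.symm
      (f := fun u => absKer α z u ^ (1 / p') * ENNReal.ofReal (rho u ^ (-δ)))
      (g := fun u => absKer α z u ^ (1 / p) * (ENNReal.ofReal (rho u ^ δ) * g u))
      ((mk.pow_const _).mul (mr _)).aemeasurable
      ((mk.pow_const _).mul ((mr _).mul hg)).aemeasurable
    have e1 : absOp α g z = ∫⁻ u, ((fun u => absKer α z u ^ (1 / p') *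
        ENNReal.ofReal (rho u ^ (-δ))) * fun u => absKer α z u ^ (1 / p) *
        (ENNReal.ofReal (rho u ^ δ) * g u)) u ∂Valpha m α := by
      refine lintegral_congr_ae ?_
      filter_upwards [ae_mem_TB α] with u hu
      have hk : absKer α z u ^ (1 / p') * absKer α z u ^ (1 / p) = absKer α z u := by
        rw [← ENNReal.rpow_add_of_nonneg _ _ (by positivity) (by positivity), one_div, one_div,
          hpq.symm.inv_add_inv_eq_one, ENNReal.rpow_one]
      simp only [Pi.mul_apply]
      calc absKer α z u * g u = (absKer α z u ^ (1 / p') * absKer α z u ^ (1 / p)) *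
            (ENNReal.ofReal (rho u ^ (-δ)) * ENNReal.ofReal (rho u ^ δ)) * g u := by
            rw [hk, ofReal_rpow_neg_mul (mem_TB_iff.1 hu), mul_one]
        _ = _ := by ring
    have e2 : ∫⁻ u, (absKer α z u ^ (1 / p') * ENNReal.ofReal (rho u ^ (-δ))) ^ p' ∂Valpha m α =
        ENNReal.ofReal (rho z ^ (-(δ * p'))) * c1 := by
      rw [← lintegral_absKer_rho α hz]
      refine lintegral_congr_ae ?_
      filter_upwards [ae_mem_TB α] with u hu
      rw [ENNReal.mul_rpow_of_nonneg _ _ hp'0.le, ← ENNReal.rpow_mul, one_div_mul_cancel hp'0.ne',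
        ENNReal.rpow_one, ofReal_rho_rpow_rpow hu, neg_mul]
    have e3 : ∫⁻ u, (absKer α z u ^ (1 / p) * (ENNReal.ofReal (rho u ^ δ) * g u)) ^ p ∂Valpha m α =
        ∫⁻ u, absKer α z u * (ENNReal.ofReal (rho u ^ (δ * p)) * g u ^ p) ∂Valpha m α := by
      refine lintegral_congr_ae ?_
      filter_upwards [ae_mem_TB α] with u hu
      rw [ENNReal.mul_rpow_of_nonneg _ _ hp0.le, ENNReal.mul_rpow_of_nonneg _ _ hp0.le,
        ← ENNReal.rpow_mul, one_div_mul_cancel hp0.ne', ENNReal.rpow_one, ofReal_rho_rpow_rpow hu]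
    rw [e1]
    refine (ENNReal.rpow_le_rpow hH hp0.le).trans (le_of_eq ?_)
    rw [e2, e3, ENNReal.mul_rpow_of_nonneg _ _ hp0.le, ← ENNReal.rpow_mul, ← ENNReal.rpow_mul,
      one_div_mul_cancel hp0.ne', ENNReal.rpow_one, one_div_mul_eq_div,
      ENNReal.mul_rpow_of_nonneg _ _ (by positivity), ofReal_rho_rpow_rpow hz,
      show -(δ * p') * (p / p') = -(δ * p) by field_simp]
    ring
  have hmeas : Measurable fun x : Cn m × Cn m => absKer α x.1 x.2 *
      (ENNReal.ofReal (rho x.2 ^ (δ * p)) * g x.2 ^ p) :=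
    (measurable_absKer_pair α).mul (((mr _).comp measurable_snd).mul
      ((hg.comp measurable_snd).pow_const _))
  calc ∫⁻ z, absOp α g z ^ p ∂Valpha m α
      ≤ ∫⁻ z, c1 ^ (p / p') * (ENNReal.ofReal (rho z ^ (-(δ * p))) *
        ∫⁻ u, absKer α z u * (ENNReal.ofReal (rho u ^ (δ * p)) * g u ^ p) ∂Valpha m α)
          ∂Valpha m α := by
        refine lintegral_mono_ae ?_
        filter_upwards [ae_mem_TB α] with z hz using key z hz
    _ = c1 ^ (p / p') * ∫⁻ z, ∫⁻ u, ENNReal.ofReal (rho z ^ (-(δ * p))) *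
        (absKer α z u * (ENNReal.ofReal (rho u ^ (δ * p)) * g u ^ p)) ∂Valpha m α ∂Valpha m α := by
        rw [lintegral_const_mul' _ _ (ENNReal.rpow_ne_top_of_nonneg (by positivity) hI1.ne)]
        congr 1
        refine lintegral_congr fun z => ?_
        rw [lintegral_const_mul' _ _ ENNReal.ofReal_ne_top]
    _ = c1 ^ (p / p') * ∫⁻ u, ∫⁻ z, ENNReal.ofReal (rho z ^ (-(δ * p))) *
        (absKer α z u * (ENNReal.ofReal (rho u ^ (δ * p)) * g u ^ p)) ∂Valpha m α ∂Valpha m α := by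
        rw [lintegral_lintegral_swap]
        exact (((mr _).comp measurable_fst).mul hmeas).aemeasurable
    _ = c1 ^ (p / p') * ∫⁻ u, c2 * g u ^ p ∂Valpha m α := by
        congr 1
        refine lintegral_congr_ae ?_
        filter_upwards [ae_mem_TB α] with u hu
        have e : ∀ z, ENNReal.ofReal (rho z ^ (-(δ * p))) *
            (absKer α z u * (ENNReal.ofReal (rho u ^ (δ * p)) * g u ^ p)) =
            absKer α u z * ENNReal.ofReal (rho z ^ (-(δ * p))) *
              (ENNReal.ofReal (rho u ^ (δ * p)) * g u ^ p) := fun z => by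
          rw [absKer_symm]; ring
        simp only [e]
        rw [lintegral_mul_const (f := fun z => absKer α u z * ENNReal.ofReal (rho z ^ (-(δ * p)))) _
          ((measurable_absKer α u).mul (mr _)), lintegral_absKer_rho α hu]
        calc _ = (ENNReal.ofReal (rho u ^ (-(δ * p))) * ENNReal.ofReal (rho u ^ (δ * p))) *
              (c2 * g u ^ p) := by ring
          _ = _ := by rw [ofReal_rpow_neg_mul (mem_TB_iff.1 hu), one_mul]
    _ = _ := by rw [lintegral_const_mul' _ _ hI2.ne, mul_assoc]

/-- Point values of `absOp g` are controlled by a weighted `L^p` norm whose weight vanishes at the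
boundary. -/
theorem exists_absOp_basePt_bound (m : ℕ) {α p : ℝ} (hα : -1 < α) (hp : 1 < p) :
    ∃ a : Cn m → ℝ≥0∞, ∃ M : ℝ≥0∞, M ≠ ⊤ ∧ (∀ u ∈ TB m, a u ≤ M) ∧
      Tendsto a (toBoundary m) (𝓝 0) ∧ ∃ C : ℝ≥0∞, C ≠ ⊤ ∧ ∀ g : Cn m → ℝ≥0∞, Measurable g →
        absOp α g (basePt m) ≤ C * (∫⁻ u, g u ^ p * a u ∂Valpha m α) ^ (1 / p) := by
  have hpq := Real.HolderConjugate.conjExponent hp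
  set p' := p.conjExponent with hp'
  have hp0 : 0 < p := hpq.pos
  have hp'0 : 0 < p' := hpq.symm.pos
  have hα1 : 0 < α + 1 := by linarith
  have hm : (0 : ℝ) ≤ m := Nat.cast_nonneg m
  set δ := (α + 1) / (2 * p * p') with hδ
  have hδ0 : 0 < δ := by positivity
  set N := (m : ℝ) + 2 + α with hN
  have h1 : -1 < α - δ * p' := by
    have : δ * p' * (2 * p) = α + 1 := by rw [hδ]; field_simp
    nlinarith [mul_pos hδ0 hp'0]
  -- Since p' - 1 = p'/p, this amounts to δp < N, which the choice of δ guarantees.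
  have h2 : (m : ℝ) + 2 + (α - δ * p') < (N - 2 * δ) * p' := by
    have e1 : p' + p = p * p' := by
      have := hpq.mul_eq_add; linarith
    have : δ * p' * (2 * p) = α + 1 := by rw [hδ]; field_simp
    have h3 : δ * p' * (2 * p) < N := by rw [this]; linarith
    have h4 : (p' - 1) * p = p' := by linarith
    have h5 : N * (p' - 1) * p - δ * p' * p > 0 := by
      rw [mul_assoc, h4]
      have : 1 ≤ p' := hpq.symm.lt.le
      nlinarith [mul_pos (mul_pos hδ0 hp'0) hp0]
    have h6 : 0 < N * (p' - 1) - δ * p' := by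
      by_contra hcon
      nlinarith
    linarith
  have hI := kernelIntegral_basePt_lt_top (m := m) h1 h2
  set c := kernelIntegral (α - δ * p') ((N - 2 * δ) * p') (basePt m)
  have mr := measurable_rho_rpow (m := m)
  have mn : ∀ b : ℝ, Measurable fun u : Cn m => ENNReal.ofReal (‖rhoPair u (basePt m)‖ ^ b) :=
    fun b => (measurable_rhoPair_rpow b _).ennreal_ofReal
  -- Hölder's inequality is applied with an extra factor ρ^δ |ρ(u, 𝐢)|^(-2δ) left on g. Its p-th
  -- power is the weight, and it vanishes at the boundary by `tendsto_rho_rpow_mul` with exponents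
  -- δp < 2δp.
  refine ⟨fun u => ENNReal.ofReal (rho u ^ (δ * p) * ‖rhoPair u (basePt m)‖ ^ (-(2 * δ * p))),
    ENNReal.ofReal (2 ^ (δ * p) * 2 ^ (δ * p)), ENNReal.ofReal_ne_top, fun u hu => ?_, ?_,
    c ^ (1 / p'), ENNReal.rpow_ne_top_of_nonneg (by positivity) hI.ne, fun g hg => ?_⟩
  · have hr := mem_TB_iff.1 hu
    have hh := half_le_norm_rhoPair hu
    have hle := rho_le_norm_rhoPair_left (w := u) (basePt_mem (m := m))
    have hn := norm_rhoPair_pos hu (basePt_mem (m := m))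
    have hp1 : 0 ≤ δ * p := by positivity
    refine ENNReal.ofReal_le_ofReal ?_
    calc rho u ^ (δ * p) * ‖rhoPair u (basePt m)‖ ^ (-(2 * δ * p))
        ≤ (2 * ‖rhoPair u (basePt m)‖) ^ (δ * p) * ‖rhoPair u (basePt m)‖ ^ (-(2 * δ * p)) := by
          gcongr
      _ = 2 ^ (δ * p) * ‖rhoPair u (basePt m)‖ ^ (-(δ * p)) := by
          rw [Real.mul_rpow (by norm_num) hn.le, mul_assoc, ← Real.rpow_add hn]
          ring_nf
      _ ≤ 2 ^ (δ * p) * 2 ^ (δ * p) := by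
          gcongr
          calc _ ≤ (1 / 2 : ℝ) ^ (-(δ * p)) :=
                Real.rpow_le_rpow_of_nonpos (by norm_num) hh (by linarith)
            _ = _ := by rw [one_div, Real.inv_rpow (by norm_num), Real.rpow_neg (by norm_num), inv_inv]
  · have := tendsto_rho_rpow_mul (m := m) (a := δ * p) (b := 2 * δ * p) (by positivity)
      (by nlinarith [mul_pos hδ0 hp0])
    have h3 := (ENNReal.continuous_ofReal.tendsto _).comp this
    rw [ENNReal.ofReal_zero] at h3
    refine h3.congr fun u => ?_
    simp only [Function.comp_apply]
    ring_nf
  · have hH := ENNReal.lintegral_mul_le_Lp_mul_Lq (Valpha m α) hpq.symm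
      (f := fun u => ENNReal.ofReal (rho u ^ (-δ)) *
        ENNReal.ofReal (‖rhoPair u (basePt m)‖ ^ (-(N - 2 * δ))))
      (g := fun u => g u * (ENNReal.ofReal (rho u ^ δ) *
        ENNReal.ofReal (‖rhoPair u (basePt m)‖ ^ (-(2 * δ)))))
      ((mr _).mul (mn _)).aemeasurable (hg.mul ((mr _).mul (mn _))).aemeasurable
    have pw : ∀ u ∈ TB m, ∀ b y : ℝ, ENNReal.ofReal (‖rhoPair u (basePt m)‖ ^ b) ^ y =
        ENNReal.ofReal (‖rhoPair u (basePt m)‖ ^ (b * y)) := fun u hu b y => by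
      have hn := norm_rhoPair_pos hu (basePt_mem (m := m))
      rw [ENNReal.ofReal_rpow_of_pos (by positivity), ← Real.rpow_mul hn.le]
    have e1 : absOp α g (basePt m) = ∫⁻ u, ((fun u => ENNReal.ofReal (rho u ^ (-δ)) *
        ENNReal.ofReal (‖rhoPair u (basePt m)‖ ^ (-(N - 2 * δ)))) *
        fun u => g u * (ENNReal.ofReal (rho u ^ δ) *
        ENNReal.ofReal (‖rhoPair u (basePt m)‖ ^ (-(2 * δ))))) u ∂Valpha m α := by
      refine lintegral_congr_ae ?_
      filter_upwards [ae_mem_TB α] with u hu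
      have hn := norm_rhoPair_pos hu (basePt_mem (m := m))
      simp only [Pi.mul_apply]
      calc absKer α (basePt m) u * g u = (ENNReal.ofReal (rho u ^ (-δ)) *
            ENNReal.ofReal (rho u ^ δ)) * (ENNReal.ofReal (‖rhoPair u (basePt m)‖ ^ (-(N - 2 * δ))) *
            ENNReal.ofReal (‖rhoPair u (basePt m)‖ ^ (-(2 * δ)))) * g u := by
            rw [ofReal_rpow_neg_mul (mem_TB_iff.1 hu), one_mul,
              ← ENNReal.ofReal_mul (by positivity), ← Real.rpow_add hn,
              show -(N - 2 * δ) + -(2 * δ) = -N by ring, absKer]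
        _ = _ := by ring
    have e2 : ∫⁻ u, (ENNReal.ofReal (rho u ^ (-δ)) *
        ENNReal.ofReal (‖rhoPair u (basePt m)‖ ^ (-(N - 2 * δ)))) ^ p' ∂Valpha m α = c := by
      have h := lintegral_Valpha_kernel α (-(δ * p')) ((N - 2 * δ) * p') (basePt m)
      rw [← sub_eq_add_neg] at h
      refine Eq.trans ?_ h
      refine lintegral_congr_ae ?_
      filter_upwards [ae_mem_TB α] with u hu
      have hr := mem_TB_iff.1 hu
      rw [ENNReal.mul_rpow_of_nonneg _ _ hp'0.le, ofReal_rho_rpow_rpow hu, pw u hu,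
        ← ENNReal.ofReal_mul (by positivity), neg_mul, neg_mul]
    have e3 : ∫⁻ u, (g u * (ENNReal.ofReal (rho u ^ δ) *
        ENNReal.ofReal (‖rhoPair u (basePt m)‖ ^ (-(2 * δ))))) ^ p ∂Valpha m α =
        ∫⁻ u, g u ^ p * ENNReal.ofReal (rho u ^ (δ * p) *
          ‖rhoPair u (basePt m)‖ ^ (-(2 * δ * p))) ∂Valpha m α := by
      refine lintegral_congr_ae ?_
      filter_upwards [ae_mem_TB α] with u hu
      have hr := mem_TB_iff.1 hu
      rw [ENNReal.mul_rpow_of_nonneg _ _ hp0.le, ENNReal.mul_rpow_of_nonneg _ _ hp0.le,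
        ofReal_rho_rpow_rpow hu, pw u hu, ← ENNReal.ofReal_mul (by positivity), neg_mul]
    rw [e1]
    refine hH.trans (le_of_eq ?_)
    rw [e2, e3]

end AbsKernel

/-! ### Toeplitz operators on the Bergman spaces -/

section ToeplitzBounds

variable {m : ℕ}

theorem toeplitz_congr {α : ℝ} {μ : Measure (Cn m)} {F G : Cn m → ℂ} (h : EqOn F G (TB m)) :
    toeplitz α μ F = toeplitz α μ G := funext fun z =>
  setIntegral_congr_fun measurableSet_TB fun w hw => by
    rw [h hw]

theorem toeplitzIntegrable_iff_absKer {α : ℝ} {μ : Measure (Cn m)} {g : Cn m → ℂ}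
    (hg : DifferentiableOn ℂ g (TB m)) : ToeplitzIntegrable α μ g ↔
      ∫⁻ w in TB m, absKer α (basePt m) w * ‖g w‖ₑ ∂μ < ⊤ :=
  ⟨fun h => h.2, fun h => ⟨hg.continuousOn.aestronglyMeasurable measurableSet_TB, h⟩⟩

theorem enorm_toeplitz_le {α : ℝ} (hα : -1 < α) (μ : Measure (Cn m)) (f : Cn m → ℂ) (z : Cn m) :
    ‖toeplitz α μ f z‖ₑ ≤
      ENNReal.ofReal (kernelConst m α) * ∫⁻ w in TB m, absKer α z w * ‖f w‖ₑ ∂μ := by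
  refine (enorm_integral_le_lintegral_enorm _).trans (le_of_eq ?_)
  rw [← lintegral_const_mul' _ _ ENNReal.ofReal_ne_top]
  refine lintegral_congr fun w => ?_
  rw [enorm_mul, ← ofReal_norm (bergmanKernel α z w), norm_bergmanKernel hα,
    ENNReal.ofReal_mul (kernelConst_pos hα).le, mul_assoc, absKer]

theorem measurable_indicator_enorm {f : Cn m → ℂ} (hf : DifferentiableOn ℂ f (TB m)) :
    Measurable ((TB m).indicator fun u => ‖f u‖ₑ) :=
  measurable_indicator_of_continuousOn measurableSet_TB hf.continuousOn.enorm

/-- Integrals of holomorphic functions against the Bergman kernel and `μ` are dominated by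
integrals against the averages of `μ`. -/
theorem exists_lintegral_absKer_le (m : ℕ) (α : ℝ) {s : ℝ} (hs : 0 < s) :
    ∃ C : ℝ≥0∞, C ≠ ⊤ ∧ ∀ μ : Measure (Cn m), SFinite (μ.restrict (TB m)) → ∀ f : Cn m → ℂ,
      DifferentiableOn ℂ f (TB m) → ∀ z ∈ TB m, ∫⁻ w in TB m, absKer α z w * ‖f w‖ₑ ∂μ ≤
        C * absOp α (fun u => (TB m).indicator (fun u => ‖f u‖ₑ) u * cellAvg α s μ u) z := by
  obtain ⟨C, hC, h⟩ := exists_carleson m α hs le_rfl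
  refine ⟨C, hC, fun μ hμ f hf z hz => ?_⟩
  have e : ∀ w, ‖kpow (m + 2 + α) z w * f w‖ₑ ^ (1 : ℝ) = absKer α z w * ‖f w‖ₑ := fun w => by
    rw [ENNReal.rpow_one, enorm_mul, ← ofReal_norm (kpow _ z w), norm_kpow, absKer]
  -- The kernel times f is holomorphic in w if ρ(w, z) is used instead of its conjugate ρ(z, w); the
  -- modulus is the same.
  have h1 := h μ hμ (fun w => kpow (m + 2 + α) z w * f w) ((differentiableOn_kpow _ hz).mul hf)
  simp only [e] at h1
  refine h1.trans (mul_le_mul' le_rfl (le_of_eq (lintegral_congr_ae ?_)))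
  filter_upwards [ae_mem_TB α] with u hu
  rw [indicator_of_mem hu, mul_assoc]

/-- The vanishing weight has two uses: boundedness of a gives convergence of T_μ f for every f in
A^p_α, and its decay gives pointwise convergence of T_μ along bounded, locally null families. -/
theorem exists_lintegral_absKer_basePt_le {α s p : ℝ} (hα : -1 < α) (hs0 : 0 < s) (hp : 1 < p)
    {μ : Measure (Cn m)} (hμ : SFinite (μ.restrict (TB m))) {M : ℝ≥0∞} (hM : M ≠ ⊤)
    (hb : ∀ u ∈ TB m, cellAvg α s μ u ≤ M) :
    ∃ a : Cn m → ℝ≥0∞, ∃ M' : ℝ≥0∞, M' ≠ ⊤ ∧ (∀ u ∈ TB m, a u ≤ M') ∧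
      Tendsto a (toBoundary m) (𝓝 0) ∧ ∃ C : ℝ≥0∞, C ≠ ⊤ ∧ ∀ f : Cn m → ℂ,
        DifferentiableOn ℂ f (TB m) → ∫⁻ w in TB m, absKer α (basePt m) w * ‖f w‖ₑ ∂μ ≤
          C * (∫⁻ u, ‖f u‖ₑ ^ p * a u ∂Valpha m α) ^ (1 / p) := by
  have hp0 : 0 < p := one_pos.trans hp
  obtain ⟨C₁, hC₁, h₁⟩ := exists_lintegral_absKer_le m α hs0
  obtain ⟨a, M', hM', haM, ha, C₂, hC₂, h₂⟩ := exists_absOp_basePt_bound m hα hp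
  have hMp : M ^ p ≠ ⊤ := ENNReal.rpow_ne_top_of_nonneg hp0.le hM
  refine ⟨a, M', hM', haM, ha, C₁ * (C₂ * (M ^ p) ^ (1 / p)), ENNReal.mul_ne_top hC₁
    (ENNReal.mul_ne_top hC₂ (ENNReal.rpow_ne_top_of_nonneg (by positivity) hMp)), fun f hf => ?_⟩
  refine (h₁ μ hμ f hf _ basePt_mem).trans ?_
  rw [mul_assoc]
  refine mul_le_mul' le_rfl ((h₂ _ ((measurable_indicator_enorm hf).mul
    (measurable_cellAvg α s μ))).trans ?_)
  rw [mul_assoc, ← ENNReal.mul_rpow_of_nonneg _ _ (by positivity : 0 ≤ 1 / p),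
    ← lintegral_const_mul' _ _ hMp]
  refine mul_le_mul' le_rfl (ENNReal.rpow_le_rpow (lintegral_mono_ae ?_) (by positivity))
  filter_upwards [ae_mem_TB α] with u hu
  rw [Pi.mul_apply, indicator_of_mem hu, ENNReal.mul_rpow_of_nonneg _ _ hp0.le]
  calc _ ≤ ‖f u‖ₑ ^ p * M ^ p * a u := by gcongr; exact hb u hu
    _ = _ := by ring

theorem MemBergman.lintegral_lt_top {α p : ℝ} (hp : 0 < p) {f : Cn m → ℂ}
    (hf : MemBergman α p f) : ∫⁻ w, ‖f w‖ₑ ^ p ∂Valpha m α < ⊤ := by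
  rw [← eLpNorm_rpow_eq hp]
  exact ENNReal.rpow_lt_top_of_nonneg hp.le hf.2.2.ne

theorem toeplitzIntegrable_of_memBergman {α s p : ℝ} (hα : -1 < α) (hs0 : 0 < s) (hp : 1 < p)
    {μ : Measure (Cn m)} (hμ : SFinite (μ.restrict (TB m))) {M : ℝ≥0∞} (hM : M ≠ ⊤)
    (hb : ∀ u ∈ TB m, cellAvg α s μ u ≤ M) {f : Cn m → ℂ} (hf : MemBergman α p f) :
    ToeplitzIntegrable α μ f := by
  have hp0 : 0 < p := one_pos.trans hp
  obtain ⟨a, M', hM', haM, -, C, hC, h⟩ :=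
    exists_lintegral_absKer_basePt_le hα hs0 hp hμ hM hb
  refine (toeplitzIntegrable_iff_absKer hf.1).2 ((h f hf.1).trans_lt
    (ENNReal.mul_lt_top hC.lt_top (ENNReal.rpow_lt_top_of_nonneg (by positivity) ?_)))
  have h1 : ∫⁻ u, ‖f u‖ₑ ^ p * a u ∂Valpha m α ≤ M' * ∫⁻ u, ‖f u‖ₑ ^ p ∂Valpha m α := by
    rw [← lintegral_const_mul' _ _ hM']
    refine lintegral_mono_ae ?_
    filter_upwards [ae_mem_TB α] with u hu
    rw [mul_comm]
    exact mul_le_mul' (haM u hu) le_rfl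
  exact (h1.trans_lt (ENNReal.mul_lt_top hM'.lt_top (hf.lintegral_lt_top hp0))).ne

/-- `L^p` bound for `T_μ f` in terms of the averages of `μ`. -/
theorem exists_toeplitz_bound {α s p : ℝ} (hα : -1 < α) (hs0 : 0 < s) (hp : 1 < p)
    {μ : Measure (Cn m)} (hμ : SFinite (μ.restrict (TB m))) :
    ∃ C : ℝ≥0∞, C ≠ ⊤ ∧ ∀ f : Cn m → ℂ, DifferentiableOn ℂ f (TB m) →
      ∫⁻ z, ‖toeplitz α μ f z‖ₑ ^ p ∂Valpha m α ≤
        C * ∫⁻ u, ‖f u‖ₑ ^ p * cellAvg α s μ u ^ p ∂Valpha m α := by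
  have hp0 : 0 < p := one_pos.trans hp
  obtain ⟨C₁, hC₁, h₁⟩ := exists_lintegral_absKer_le m α hs0
  obtain ⟨C₂, hC₂, h₂⟩ := exists_absOp_bound m hα hp
  set c := (ENNReal.ofReal (kernelConst m α) * C₁) ^ p with hc
  have hc' : c ≠ ⊤ := ENNReal.rpow_ne_top_of_nonneg hp0.le
    (ENNReal.mul_ne_top ENNReal.ofReal_ne_top hC₁)
  refine ⟨c * C₂, ENNReal.mul_ne_top hc' hC₂, fun f hf => ?_⟩
  set g : Cn m → ℝ≥0∞ := fun u => (TB m).indicator (fun u => ‖f u‖ₑ) u * cellAvg α s μ u with hg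
  calc ∫⁻ z, ‖toeplitz α μ f z‖ₑ ^ p ∂Valpha m α
      ≤ ∫⁻ z, c * absOp α g z ^ p ∂Valpha m α := by
        refine lintegral_mono_ae ?_
        filter_upwards [ae_mem_TB α] with z hz
        rw [hc, ← ENNReal.mul_rpow_of_nonneg _ _ hp0.le, mul_assoc]
        exact ENNReal.rpow_le_rpow ((enorm_toeplitz_le hα μ f z).trans
          (mul_le_mul' le_rfl (h₁ μ hμ f hf z hz))) hp0.le
    _ = c * ∫⁻ z, absOp α g z ^ p ∂Valpha m α := lintegral_const_mul' _ _ hc'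
    _ ≤ c * (C₂ * ∫⁻ u, g u ^ p ∂Valpha m α) := by
        gcongr
        exact h₂ _ ((measurable_indicator_enorm hf).mul (measurable_cellAvg α s μ))
    _ = _ := by
        rw [mul_assoc]
        congr 2
        refine lintegral_congr_ae ?_
        filter_upwards [ae_mem_TB α] with u hu
        rw [hg]
        simp only [indicator_of_mem hu]
        rw [ENNReal.mul_rpow_of_nonneg _ _ hp0.le]

theorem lintegral_mul_rpow_le {α s p : ℝ} (hp : 0 ≤ p) {μ : Measure (Cn m)} {M : ℝ≥0∞}
    (hM : M ≠ ⊤) (hb : ∀ u ∈ TB m, cellAvg α s μ u ≤ M) (f : Cn m → ℂ) :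
    ∫⁻ u, ‖f u‖ₑ ^ p * cellAvg α s μ u ^ p ∂Valpha m α ≤
      M ^ p * ∫⁻ u, ‖f u‖ₑ ^ p ∂Valpha m α := by
  rw [← lintegral_const_mul' _ _ (ENNReal.rpow_ne_top_of_nonneg hp hM)]
  refine lintegral_mono_ae ?_
  filter_upwards [ae_mem_TB α] with u hu
  rw [mul_comm]
  exact mul_le_mul' (ENNReal.rpow_le_rpow (hb u hu) hp) le_rfl

theorem memBergman_toeplitz {α s p : ℝ} (hα : -1 < α) (hs0 : 0 < s) (hp : 1 < p)
    {μ : Measure (Cn m)} (hμ : SFinite (μ.restrict (TB m))) {M : ℝ≥0∞} (hM : M ≠ ⊤)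
    (hb : ∀ u ∈ TB m, cellAvg α s μ u ≤ M) {f : Cn m → ℂ} (hf : MemBergman α p f) :
    MemBergman α p (toeplitz α μ f) := by
  have hp0 : 0 < p := one_pos.trans hp
  obtain ⟨C, hC, h⟩ := exists_toeplitz_bound hα hs0 hp hμ
  refine memBergman_of_lintegral hp0
    ((toeplitzIntegrable_of_memBergman hα hs0 hp hμ hM hb hf).differentiableOn hα) ?_
  refine (h f hf.1).trans_lt (ENNReal.mul_lt_top hC.lt_top
    ((lintegral_mul_rpow_le hp0.le hM hb f).trans_lt ?_))
  exact ENNReal.mul_lt_top (ENNReal.rpow_lt_top_of_nonneg hp0.le hM) (hf.lintegral_lt_top hp0)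

/-! ### Elements of the Bergman space as holomorphic functions -/

/-- A holomorphic representative. -/
def holRep {α p : ℝ} (F : bergmanSpace m α p) : Cn m → ℂ :=
  (show ∃ G : Cn m → ℂ, MemBergman α p G ∧
    ((F : Lp ℂ (ENNReal.ofReal p) (Valpha m α)) : Cn m → ℂ) =ᵐ[Valpha m α] G from F.2).choose

theorem holRep_mem {α p : ℝ} (F : bergmanSpace m α p) : MemBergman α p (holRep F) :=
  (show ∃ G : Cn m → ℂ, MemBergman α p G ∧
    ((F : Lp ℂ (ENNReal.ofReal p) (Valpha m α)) : Cn m → ℂ) =ᵐ[Valpha m α] G from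
      F.2).choose_spec.1

theorem coeFn_ae_holRep {α p : ℝ} (F : bergmanSpace m α p) :
    ((F : Lp ℂ (ENNReal.ofReal p) (Valpha m α)) : Cn m → ℂ) =ᵐ[Valpha m α] holRep F :=
  (show ∃ G : Cn m → ℂ, MemBergman α p G ∧
    ((F : Lp ℂ (ENNReal.ofReal p) (Valpha m α)) : Cn m → ℂ) =ᵐ[Valpha m α] G from
      F.2).choose_spec.2

/-- Continuous functions that agree almost everywhere agree on the tube, so the chosen
representative is determined there. -/
theorem holRep_eqOn {α p : ℝ} (F : bergmanSpace m α p) {G : Cn m → ℂ}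
    (hG : ContinuousOn G (TB m))
    (h : ((F : Lp ℂ (ENNReal.ofReal p) (Valpha m α)) : Cn m → ℂ) =ᵐ[Valpha m α] G) :
    EqOn (holRep F) G (TB m) :=
  eq_on_TB_of_ae_eq (holRep_mem F).1.continuousOn hG ((coeFn_ae_holRep F).symm.trans h)

theorem holRep_add {α p : ℝ} (F G : bergmanSpace m α p) :
    EqOn (holRep (F + G)) (holRep F + holRep G) (TB m) := by
  refine holRep_eqOn _ ((holRep_mem F).1.add (holRep_mem G).1).continuousOn ?_
  rw [Submodule.coe_add]
  exact (Lp.coeFn_add _ _).trans ((coeFn_ae_holRep F).add (coeFn_ae_holRep G))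

theorem holRep_smul {α p : ℝ} (c : ℂ) (F : bergmanSpace m α p) :
    EqOn (holRep (c • F)) (c • holRep F) (TB m) := by
  refine holRep_eqOn _ ((holRep_mem F).1.const_smul c).continuousOn ?_
  rw [Submodule.coe_smul]
  exact (Lp.coeFn_smul _ _).trans ((coeFn_ae_holRep F).const_smul c)

/-- The element of the Bergman space given by a function. -/
def toBergman {α p : ℝ} {f : Cn m → ℂ} (hf : MemBergman α p f) : bergmanSpace m α p :=
  ⟨hf.2.toLp f, f, hf, hf.2.coeFn_toLp⟩

theorem toBergman_coeFn {α p : ℝ} {f : Cn m → ℂ} (hf : MemBergman α p f) :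
    ((toBergman hf : Lp ℂ (ENNReal.ofReal p) (Valpha m α)) : Cn m → ℂ) =ᵐ[Valpha m α] f :=
  hf.2.coeFn_toLp

theorem holRep_toBergman {α p : ℝ} {f : Cn m → ℂ} (hf : MemBergman α p f) :
    EqOn (holRep (toBergman hf)) f (TB m) :=
  holRep_eqOn _ hf.1.continuousOn (toBergman_coeFn hf)

theorem bergmanSpace_ext {α p : ℝ} {F G : bergmanSpace m α p}
    (h : EqOn (holRep F) (holRep G) (TB m)) : F = G := by
  refine Subtype.ext (Lp.ext ?_)
  filter_upwards [coeFn_ae_holRep F, coeFn_ae_holRep G, ae_mem_TB α] with z h1 h2 hz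
  rw [h1, h2, h hz]

section Norm

variable {α p : ℝ} [Fact (1 ≤ ENNReal.ofReal p)]

theorem enorm_eq_eLpNorm (F : bergmanSpace m α p) :
    ‖F‖ₑ = eLpNorm (holRep F) (ENNReal.ofReal p) (Valpha m α) := by
  rw [← eLpNorm_congr_ae (coeFn_ae_holRep F), ← Lp.enorm_def]
  rfl

theorem enorm_rpow_eq_lintegral (hp : 0 < p) (F : bergmanSpace m α p) :
    ‖F‖ₑ ^ p = ∫⁻ z, ‖holRep F z‖ₑ ^ p ∂Valpha m α := by
  rw [enorm_eq_eLpNorm, eLpNorm_rpow_eq hp]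

theorem enorm_rpow_eq_lintegral_of_ae_eq (hp : 0 < p) (F : bergmanSpace m α p) {f : Cn m → ℂ}
    (h : ((F : Lp ℂ (ENNReal.ofReal p) (Valpha m α)) : Cn m → ℂ) =ᵐ[Valpha m α] f) :
    ‖F‖ₑ ^ p = ∫⁻ z, ‖f z‖ₑ ^ p ∂Valpha m α := by
  rw [enorm_rpow_eq_lintegral hp]
  refine lintegral_congr_ae ?_
  filter_upwards [coeFn_ae_holRep F, h] with z h1 h2
  rw [← h1, h2]

theorem completeSpace_bergmanSpace (hp : 1 < p) (hα : -1 < α) :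
    CompleteSpace (bergmanSpace m α p) :=
  (isClosed_bergmanSpace hp hα).completeSpace_coe

end Norm

end ToeplitzBounds

/-! ### Compactness of the Toeplitz operator -/

section Compactness

variable {m : ℕ}

/-- A bounded operator that is small in norm modulo finite rank data is compact. -/
theorem isCompactOperator_of_finite_rank_control {E F : Type} [NormedAddCommGroup E]
    [NormedSpace ℂ E] [NormedAddCommGroup F] [NormedSpace ℂ F] [CompleteSpace F] (T : E →L[ℂ] F)
    (h : ∀ e : ℝ, 0 < e → ∃ (ι : Type) (_ : Fintype ι) (L : E →L[ℂ] (ι → ℂ)) (C : ℝ), 0 ≤ C ∧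
      ∀ x, ‖T x‖ ≤ e * ‖x‖ + C * ‖L x‖) : IsCompactOperator T := by
  refine (isCompactOperator_iff_isCompact_closure_image_closedBall (T : E →ₗ[ℂ] F) one_pos).2 ?_
  refine TotallyBounded.isCompact_of_isComplete (TotallyBounded.closure ?_)
    isClosed_closure.isComplete
  refine Metric.totallyBounded_of_finite_discretization fun e he => ?_
  obtain ⟨ι, _, L, C, hC, hL⟩ := h (e / 4) (by positivity)
  set η := e / (4 * (C + 1)) with hη
  have hη0 : 0 < η := by positivity
  -- Bounded sets are totally bounded in the finite-dimensional target. Two points whose L-images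
  -- are near the same net point have T-images at distance at most (e/4)·2 + C·2η < e.
  have htb : TotallyBounded (L '' Metric.closedBall 0 1) :=
    (Bornology.IsBounded.isCompact_closure (L.lipschitz.isBounded_image
      Metric.isBounded_closedBall)).totallyBounded.subset subset_closure
  obtain ⟨t, -, ht, hcov⟩ := Metric.finite_approx_of_totallyBounded htb η hη0
  have hx : ∀ y : ((T : E →ₗ[ℂ] F) '' Metric.closedBall 0 1 : Set F),
      ∃ x ∈ Metric.closedBall (0 : E) 1, T x = y := fun y => y.2
  choose x hx1 hx2 using hx
  have hc : ∀ y : ((T : E →ₗ[ℂ] F) '' Metric.closedBall 0 1 : Set F),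
      ∃ v : t, L (x y) ∈ Metric.ball (v : ι → ℂ) η := fun y => by
    have := hcov (mem_image_of_mem L (hx1 y))
    simp only [mem_iUnion] at this
    obtain ⟨v, hv, hm⟩ := this
    exact ⟨⟨v, hv⟩, hm⟩
  choose G hG using hc
  refine ⟨t, ht.fintype, G, fun y y' hyy => ?_⟩
  have h1 := hG y
  have h2 := hG y'
  rw [← hyy] at h2
  rw [Metric.mem_ball] at h1 h2
  have h3 : ‖L (x y - x y')‖ ≤ 2 * η := by
    rw [map_sub, ← dist_eq_norm]
    linarith [dist_triangle_right (L (x y)) (L (x y')) (G y : ι → ℂ)]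
  have h4 : ‖x y - x y'‖ ≤ 2 := by
    have := hx1 y
    have := hx1 y'
    simp only [mem_closedBall_zero_iff] at *
    linarith [norm_sub_le (x y) (x y')]
  rw [← hx2 y, ← hx2 y', dist_eq_norm, ← map_sub]
  have h5 : C * (2 * η) < e / 2 := by
    have : η * (4 * (C + 1)) = e := by rw [hη]; field_simp
    nlinarith
  calc _ ≤ e / 4 * ‖x y - x y'‖ + C * ‖L (x y - x y')‖ := hL _
    _ ≤ e / 4 * 2 + C * (2 * η) := by gcongr
    _ < e := by linarith

/-- On a compact set, holomorphic functions are controlled by finitely many of their values, up to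
a small multiple of the norm. -/
theorem exists_finite_net {α p : ℝ} (hα : -1 < α) (hp : 1 ≤ p) {ε : ℝ} (hε : 0 < ε) (R : ℝ)
    {η : ℝ} (hη : 0 < η) :
    ∃ S : Finset (Cn m), ↑S ⊆ core m ε R ∧ ∀ h : Cn m → ℂ, MemBergman α p h →
      ∀ z ∈ core m ε R, ∃ s ∈ S,
        ‖h z‖ ≤ ‖h s‖ + η * (eLpNorm h (ENNReal.ofReal p) (Valpha m α)).toReal := by
  have hK := isCompact_core (m := m) ε R
  obtain ⟨δ, hδ, hsub⟩ := hK.exists_cthickening_subset_open isOpen_TB (core_subset hε R)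
  obtain ⟨ε', hε', R', -, hsub'⟩ := exists_subset_core hK.cthickening hsub
  obtain ⟨C, hC, hb⟩ := exists_core_bound (m := m) α hp hα hε' R'
  set C' := C.toReal + 1 with hC'
  have hC'0 : 0 < C' := by positivity
  -- On the thickened set |h| ≤ C'n, so |h'| ≤ C'n/(δ/2) near the net point, and this mesh limits
  -- the variation of h to ηn.
  set d := min (δ / 2) (η * (δ / 2) / C') with hd
  have hd0 : 0 < d := by positivity
  obtain ⟨t, htK, htf, hcov⟩ := Metric.finite_approx_of_totallyBounded hK.totallyBounded d hd0
  refine ⟨htf.toFinset, by simpa using htK, fun h hh z hz => ?_⟩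
  have := hcov hz
  simp only [mem_iUnion] at this
  obtain ⟨s, hs, hzs⟩ := this
  refine ⟨s, by simpa using hs, ?_⟩
  set n := (eLpNorm h (ENNReal.ofReal p) (Valpha m α)).toReal with hn
  have hn0 : 0 ≤ n := ENNReal.toReal_nonneg
  have hball : ∀ x ∈ Metric.ball s (δ / 2), Metric.closedBall x (δ / 2) ⊆
      Metric.cthickening δ (core m ε R) := by
    intro x hx y hy
    refine Metric.mem_cthickening_of_dist_le y s δ _ (htK hs) ?_
    rw [Metric.mem_ball] at hx
    rw [Metric.mem_closedBall] at hy
    linarith [dist_triangle y x s]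
  have hval : ∀ y ∈ Metric.cthickening δ (core m ε R), ‖h y‖ ≤ C' * n := by
    intro y hy
    have h1 := ENNReal.toReal_mono (ENNReal.mul_ne_top hC hh.2.2.ne) (hb h hh.1 y (hsub' hy))
    rw [ENNReal.toReal_mul, toReal_enorm] at h1
    refine h1.trans (mul_le_mul_of_nonneg_right ?_ hn0)
    linarith
  have hder : ∀ x ∈ Metric.ball s (δ / 2), ‖fderiv ℂ h x‖ ≤ C' * n / (δ / 2) := fun x hx =>
    norm_fderiv_le_of_closedBall (half_pos hδ) isOpen_TB hh.1 ((hball x hx).trans hsub)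
      fun y hy => hval y (hball x hx hy)
  have hdf : ∀ x ∈ Metric.ball s (δ / 2), DifferentiableAt ℂ h x := fun x hx =>
    hh.1.differentiableAt (isOpen_TB.mem_nhds
      (hsub (hball x hx (Metric.mem_closedBall_self (half_pos hδ).le))))
  have hzb : z ∈ Metric.ball s (δ / 2) := Metric.ball_subset_ball (min_le_left _ _) hzs
  have h1 := Convex.norm_image_sub_le_of_norm_fderiv_le hdf hder (convex_ball s (δ / 2))
    (Metric.mem_ball_self (half_pos hδ)) hzb
  have h2 : ‖z - s‖ ≤ η * (δ / 2) / C' := by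
    rw [← dist_eq_norm]
    exact (Metric.mem_ball.1 hzs).le.trans (min_le_right _ _)
  have h3 : C' * n / (δ / 2) * ‖z - s‖ ≤ η * n := by
    calc _ ≤ C' * n / (δ / 2) * (η * (δ / 2) / C') := by gcongr
      _ = η * n := by field_simp
  have h4 : ‖h z‖ ≤ ‖h s‖ + ‖h z - h s‖ := by
    have := norm_add_le (h s) (h z - h s)
    rwa [add_sub_cancel] at this
  linarith

section Operator

variable {α p : ℝ} [Fact (1 ≤ ENNReal.ofReal p)]

/-- Evaluation at a point of `T_B`. -/
def evalLin (m : ℕ) (α p : ℝ) {z : Cn m} (hz : z ∈ TB m) : bergmanSpace m α p →ₗ[ℂ] ℂ where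
  toFun F := holRep F z
  map_add' F G := holRep_add F G hz
  map_smul' c F := holRep_smul c F hz

theorem exists_evalCLM (hα : -1 < α) (hp : 1 ≤ p) {z : Cn m} (hz : z ∈ TB m) :
    ∃ L : bergmanSpace m α p →L[ℂ] ℂ, ∀ F, L F = holRep F z := by
  obtain ⟨ε, hε, R, -, hsub⟩ := exists_subset_core (isCompact_singleton (x := z))
    (singleton_subset_iff.2 hz)
  obtain ⟨C, hC, hb⟩ := exists_core_bound (m := m) α hp hα hε R
  refine ⟨(evalLin m α p hz).mkContinuous C.toReal fun F => ?_, fun F => rfl⟩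
  have h1 := hb _ (holRep_mem F).1 z (hsub rfl)
  rw [← enorm_eq_eLpNorm] at h1
  have h2 := ENNReal.toReal_mono (ENNReal.mul_ne_top hC enorm_ne_top) h1
  rwa [ENNReal.toReal_mul, toReal_enorm, toReal_enorm] at h2

theorem enorm_le_of_rpow_le {X Y : Type*} [NormedAddCommGroup X] [NormedAddCommGroup Y] {p : ℝ}
    (hp : 0 < p) {C : ℝ≥0∞} (hC : C ≠ ⊤) {x : X} {y : Y} (h : ‖y‖ₑ ^ p ≤ C * ‖x‖ₑ ^ p) :
    ‖y‖ ≤ (C ^ (1 / p)).toReal * ‖x‖ := by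
  have h1 := ENNReal.rpow_le_rpow h (show 0 ≤ 1 / p by positivity)
  rw [ENNReal.mul_rpow_of_nonneg _ _ (by positivity), ← ENNReal.rpow_mul, ← ENNReal.rpow_mul,
    mul_one_div_cancel hp.ne', ENNReal.rpow_one, ENNReal.rpow_one] at h1
  have h2 := ENNReal.toReal_mono (ENNReal.mul_ne_top
    (ENNReal.rpow_ne_top_of_nonneg (by positivity) hC) enorm_ne_top) h1
  rwa [ENNReal.toReal_mul, toReal_enorm, toReal_enorm] at h2

/-- If the averages of `μ` are bounded, then `T_μ` is a bounded operator. -/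
theorem exists_toeplitzCLM {s : ℝ} (hα : -1 < α) (hs0 : 0 < s) (hp : 1 < p)
    {μ : Measure (Cn m)} (hμ : SFinite (μ.restrict (TB m))) {M : ℝ≥0∞} (hM : M ≠ ⊤)
    (hb : ∀ u ∈ TB m, cellAvg α s μ u ≤ M) :
    ∃ T : bergmanSpace m α p →L[ℂ] bergmanSpace m α p, ∀ F,
      EqOn (holRep (T F)) (toeplitz α μ (holRep F)) (TB m) := by
  have hp0 : 0 < p := one_pos.trans hp
  have hmem : ∀ F : bergmanSpace m α p, MemBergman α p (toeplitz α μ (holRep F)) := fun F =>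
    memBergman_toeplitz hα hs0 hp hμ hM hb (holRep_mem F)
  have hint : ∀ (F : bergmanSpace m α p) {z : Cn m}, z ∈ TB m → IntegrableOn
      (fun w => bergmanKernel α z w * holRep F w) (TB m) μ := fun F z hz =>
    (toeplitzIntegrable_of_memBergman hα hs0 hp hμ hM hb (holRep_mem F)).integrable hα hz
  let T : bergmanSpace m α p →ₗ[ℂ] bergmanSpace m α p :=
    { toFun := fun F => toBergman (hmem F)
      map_add' := fun F G => bergmanSpace_ext fun z hz => by
        rw [holRep_toBergman _ hz, holRep_add _ _ hz, Pi.add_apply, holRep_toBergman _ hz,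
          holRep_toBergman _ hz, toeplitz_congr (holRep_add F G)]
        simp only [toeplitz, Pi.add_apply, mul_add]
        exact integral_add (hint F hz) (hint G hz)
      map_smul' := fun c F => bergmanSpace_ext fun z hz => by
        rw [RingHom.id_apply, holRep_toBergman _ hz, holRep_smul _ _ hz, Pi.smul_apply,
          holRep_toBergman _ hz, toeplitz_congr (holRep_smul c F)]
        simp only [toeplitz, Pi.smul_apply, smul_eq_mul, mul_left_comm _ c]
        exact integral_const_mul _ _ }
  obtain ⟨C, hC, h⟩ := exists_toeplitz_bound hα hs0 hp hμ (s := s)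
  have hMp : M ^ p ≠ ⊤ := ENNReal.rpow_ne_top_of_nonneg hp0.le hM
  refine ⟨T.mkContinuous ((C * M ^ p) ^ (1 / p)).toReal fun F =>
    enorm_le_of_rpow_le hp0 (ENNReal.mul_ne_top hC hMp) ?_, fun F => holRep_toBergman (hmem F)⟩
  rw [enorm_rpow_eq_lintegral_of_ae_eq hp0 (T F) (toBergman_coeFn (hmem F)),
    enorm_rpow_eq_lintegral hp0 F, mul_assoc]
  exact (h _ (holRep_mem F).1).trans (mul_le_mul' le_rfl (lintegral_mul_rpow_le hp0.le hM hb _))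

/-- The weight in ‖T_μ f‖_p ≤ C ‖f `cellAvg`‖_p is small near the boundary; on the remaining compact
set f is controlled by finitely many evaluations, up to a small multiple of ‖f‖. -/
theorem isCompactOperator_toeplitz {s : ℝ} (hα : -1 < α) (hs0 : 0 < s) (hp : 1 < p)
    {μ : Measure (Cn m)} (hμ : SFinite (μ.restrict (TB m))) {M : ℝ≥0∞} (hM : M ≠ ⊤)
    (hb : ∀ u ∈ TB m, cellAvg α s μ u ≤ M) (h0 : Tendsto (cellAvg α s μ) (toBoundary m) (𝓝 0))
    (T : bergmanSpace m α p →L[ℂ] bergmanSpace m α p)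
    (hT : ∀ F, EqOn (holRep (T F)) (toeplitz α μ (holRep F)) (TB m)) : IsCompactOperator T := by
  have hp0 : 0 < p := one_pos.trans hp
  have hp1 : 0 ≤ 1 / p := by positivity
  have hMp : M ^ p ≠ ⊤ := ENNReal.rpow_ne_top_of_nonneg hp0.le hM
  have := completeSpace_bergmanSpace (m := m) hp hα
  obtain ⟨C₀, hC₀, h⟩ := exists_toeplitz_bound hα hs0 hp hμ (s := s)
  have hD : C₀ ^ (1 / p) ≠ ⊤ := ENNReal.rpow_ne_top_of_nonneg hp1 hC₀
  have ha : Tendsto (fun u => cellAvg α s μ u ^ p) (toBoundary m) (𝓝 0) := by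
    have := (ENNReal.continuous_rpow_const (y := p)).tendsto 0 |>.comp h0
    rwa [ENNReal.zero_rpow_of_pos hp0] at this
  refine isCompactOperator_of_finite_rank_control T fun e he => ?_
  -- Half of e is reserved for the region near the boundary; the other half pays for the net, whose
  -- tolerance e/(2(E + 1)) is multiplied by E.
  obtain ⟨e₁, he₁, hle⟩ := ENNReal_exists_mul_rpow_le hD
    (ENNReal.ofReal_pos.2 (half_pos he)) (show 0 < 1 / p by positivity)
  obtain ⟨ε, hε, R, -, C₁, hC₁, hw⟩ := exists_core_weight_bound α hMp
    (fun u hu => ENNReal.rpow_le_rpow (hb u hu) hp0.le) ha he₁ hp0.le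
  have hD₁ : C₀ ^ (1 / p) * C₁ ^ (1 / p) ≠ ⊤ :=
    ENNReal.mul_ne_top hD (ENNReal.rpow_ne_top_of_nonneg hp1 hC₁)
  set E := (C₀ ^ (1 / p) * C₁ ^ (1 / p)).toReal with hE
  have hE0 : 0 ≤ E := ENNReal.toReal_nonneg
  obtain ⟨S, hS, hnet⟩ := exists_finite_net (m := m) hα hp.le hε R
    (show 0 < e / (2 * (E + 1)) by positivity)
  choose L hL using fun z : S =>
    exists_evalCLM (α := α) (p := p) hα hp.le (core_subset hε R (hS z.2))
  refine ⟨S, inferInstance, ContinuousLinearMap.pi L, E, hE0, fun x => ?_⟩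
  set y := ‖ContinuousLinearMap.pi L x‖ + e / (2 * (E + 1)) * ‖x‖ with hy
  have hy0 : 0 ≤ y := by positivity
  have hcore : ∀ z ∈ core m ε R, ‖holRep x z‖ₑ ≤ ENNReal.ofReal y := by
    intro z hz
    obtain ⟨s, hs, hzs⟩ := hnet _ (holRep_mem x) z hz
    rw [← ofReal_norm]
    refine ENNReal.ofReal_le_ofReal (hzs.trans ?_)
    rw [← enorm_eq_eLpNorm, toReal_enorm]
    refine add_le_add ?_ le_rfl
    rw [← hL ⟨s, hs⟩ x]
    exact norm_le_pi_norm (ContinuousLinearMap.pi L x) ⟨s, hs⟩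
  have h1 : ‖T x‖ₑ ^ p ≤ C₀ * (e₁ * ‖x‖ₑ ^ p + C₁ * ENNReal.ofReal y ^ p) := by
    rw [enorm_rpow_eq_lintegral hp0 (T x), enorm_rpow_eq_lintegral hp0 x]
    refine le_trans (le_of_eq (lintegral_congr_ae ?_)) ((h _ (holRep_mem x).1).trans
      (mul_le_mul' le_rfl (hw _ _ hcore)))
    filter_upwards [ae_mem_TB α] with z hz
    rw [hT x hz]
  have h2 := ENNReal.rpow_le_rpow h1 hp1
  have hpp : ∀ a : ℝ≥0∞, (a ^ p) ^ (1 / p) = a := fun a => by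
    rw [← ENNReal.rpow_mul, mul_one_div_cancel hp0.ne', ENNReal.rpow_one]
  rw [hpp, ENNReal.mul_rpow_of_nonneg _ _ hp1] at h2
  have h3 : ‖T x‖ₑ ≤ ENNReal.ofReal (e / 2 * ‖x‖ + E * y) := by
    calc ‖T x‖ₑ ≤ C₀ ^ (1 / p) * (e₁ ^ (1 / p) * ‖x‖ₑ + C₁ ^ (1 / p) * ENNReal.ofReal y) := by
          refine h2.trans (mul_le_mul' le_rfl ((ENNReal.rpow_add_le_add_rpow _ _ hp1 ?_).trans
            (le_of_eq ?_)))
          · rw [div_le_one hp0]; exact hp.le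
          · rw [ENNReal.mul_rpow_of_nonneg _ _ hp1, ENNReal.mul_rpow_of_nonneg _ _ hp1, hpp, hpp]
      _ = C₀ ^ (1 / p) * e₁ ^ (1 / p) * ‖x‖ₑ + C₀ ^ (1 / p) * C₁ ^ (1 / p) * ENNReal.ofReal y := by
          ring
      _ ≤ ENNReal.ofReal (e / 2) * ENNReal.ofReal ‖x‖ + ENNReal.ofReal E * ENNReal.ofReal y := by
          rw [hE, ENNReal.ofReal_toReal hD₁, ofReal_norm]
          gcongr
      _ = _ := by
          rw [← ENNReal.ofReal_mul (by positivity), ← ENNReal.ofReal_mul hE0,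
            ← ENNReal.ofReal_add (by positivity) (by positivity)]
  rw [← ofReal_norm, ENNReal.ofReal_le_ofReal_iff (by positivity)] at h3
  have h4 : E * (e / (2 * (E + 1))) ≤ e / 2 := by
    rw [mul_div_assoc', div_le_div_iff₀ (by positivity) (by norm_num)]
    nlinarith
  nlinarith [mul_le_mul_of_nonneg_right h4 (norm_nonneg x)]

end Operator

theorem toeplitzCompact_of_cellAvg {α s t p : ℝ} (hα : -1 < α) (hs0 : 0 < s)
    (hs : s ≤ smallRadius m) (ht : 0 ≤ t) (hp : 1 < p) {μ : Measure (Cn m)} (hμ : HasDecay t μ)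
    (h0 : Tendsto (cellAvg α s μ) (toBoundary m) (𝓝 0)) : ToeplitzCompact α p t hp μ := by
  have : Fact (1 ≤ ENNReal.ofReal p) := ⟨ENNReal.one_le_ofReal.2 hp.le⟩
  obtain ⟨M, hM, hb⟩ := exists_cellAvg_bound hα hs ht hμ h0
  have hsf := sFinite_restrict hμ
  obtain ⟨T, hT⟩ := exists_toeplitzCLM (p := p) hα hs0 hp hsf hM hb
  refine ⟨T, isCompactOperator_toeplitz hα hs0 hp hsf hM hb h0 T hT, fun F f hf hFf => ?_⟩
  have h1 : toeplitz α μ f = toeplitz α μ (holRep F) :=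
    toeplitz_congr (holRep_eqOn F hf.1.continuousOn hFf).symm
  filter_upwards [coeFn_ae_holRep (T F), ae_mem_TB α] with z hz hzT
  rw [hz, hT F hzT, h1]

end Compactness

/-! ### From compactness to vanishing averages -/

section Necessity

variable {m : ℕ}

/-- `∫_{T_B} ρ(z, w)^(-b) g(w) dμ(w)`. -/
def kpowInt (b : ℝ) (μ : Measure (Cn m)) (g : Cn m → ℂ) (z : Cn m) : ℂ :=
  ∫ w in TB m, kpow b w z * g w ∂μ

theorem toeplitz_eq_kpowInt (α : ℝ) (μ : Measure (Cn m)) (g : Cn m → ℂ) (z : Cn m) :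
    toeplitz α μ g z = kernelConst m α * kpowInt (m + 2 + α) μ g z := by
  rw [toeplitz, kpowInt, ← integral_const_mul]
  simp only [bergmanKernel_eq, mul_assoc]

/-- The translate of `z` by `s` in the last coordinate. -/
def shiftLast (z : Cn m) (s : ℂ) : Cn m := z + s • Pi.single (Fin.last m) 1

theorem shiftLast_zero (z : Cn m) : shiftLast z 0 = z := by simp [shiftLast]

theorem shiftLast_add (z : Cn m) (s s' : ℂ) :
    shiftLast (shiftLast z s) s' = shiftLast z (s + s') := by
  simp [shiftLast, add_smul, add_assoc]

theorem continuous_shiftLast (z : Cn m) : Continuous (shiftLast z) := by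
  unfold shiftLast; fun_prop

theorem rho_shiftLast (z : Cn m) (s : ℂ) : rho (shiftLast z s) = rho z + s.im := by
  simp [rho, shiftLast, Fin.castSucc_ne_last]
  ring

/-- ρ(z, w) is affine in z_n with a slope independent of z and w; hence differentiation in z_n turns
one power of ρ(z, w) into the next. -/
theorem rhoPair_shiftLast (z w : Cn m) (s : ℂ) :
    rhoPair (shiftLast z s) w = rhoPair z w - Complex.I / 2 * s := by
  simp [rhoPair, shiftLast, Fin.castSucc_ne_last]
  ring

theorem half_rho_le_rho_shiftLast {z : Cn m} {s : ℂ} (hs : ‖s‖ ≤ rho z / 2) :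
    rho z / 2 ≤ rho (shiftLast z s) := by
  rw [rho_shiftLast]
  have := (abs_le.1 ((Complex.abs_im_le_norm s).trans hs)).1
  linarith

theorem shiftLast_mem {z : Cn m} (hz : z ∈ TB m) {s : ℂ} (hs : ‖s‖ ≤ rho z / 2) :
    shiftLast z s ∈ TB m :=
  mem_TB_iff.2 ((half_pos (mem_TB_iff.1 hz)).trans_le (half_rho_le_rho_shiftLast hs))

/-- |f| ≤ C |ρ(w, 𝐢)|^(-t) matches the decay of μ, and the kernel factor is bounded because |ρ(w,
𝐢)| ≥ 1/2. -/
theorem ToeplitzIntegrable.of_memS {α t : ℝ} (hα : -1 < α) {μ : Measure (Cn m)}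
    (hμ : HasDecay t μ) {f : Cn m → ℂ} (hf : MemS t f) : ToeplitzIntegrable α μ f := by
  have hN := homogeneousDim_pos (m := m) hα
  obtain ⟨C, hC⟩ := hf.2
  refine (toeplitzIntegrable_iff_absKer hf.1).2 (lt_of_le_of_lt ?_
    (ENNReal.mul_lt_top (ENNReal.ofReal_lt_top (r := (1 / 2 : ℝ) ^ (-((m : ℝ) + 2 + α)) * |C|)) hμ))
  rw [← lintegral_const_mul' _ _ ENNReal.ofReal_ne_top]
  refine setLIntegral_mono' measurableSet_TB fun w hw => ?_
  have hn := norm_rhoPair_pos hw (basePt_mem (m := m))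
  rw [absKer, ← ofReal_norm, ← ENNReal.ofReal_mul (by positivity),
    ← ENNReal.ofReal_mul (by positivity), mul_assoc]
  refine ENNReal.ofReal_le_ofReal (mul_le_mul
    (Real.rpow_le_rpow_of_nonpos (by norm_num) (half_le_norm_rhoPair hw) (by linarith)) ?_
    (norm_nonneg _) (by positivity))
  rw [mul_one_div, le_div_iff₀ (by positivity), mul_comm]
  exact (hC w hw).trans (le_abs_self C)

/-- Uniform domination of `ρ(z, w)^(-b)` for `z` in a compact set. -/
theorem exists_kpow_dominated {α b : ℝ} (hα : -1 < α) (hb : (m : ℝ) + 2 + α ≤ b)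
    {K : Set (Cn m)} (hK : IsCompact K) (hKT : K ⊆ TB m) : ∃ C > 0, ∀ z ∈ K, ∀ w ∈ TB m,
      ‖kpow b w z‖ ≤ C * ‖rhoPair w (basePt m)‖ ^ (-((m : ℝ) + 2 + α)) := by
  have hN := homogeneousDim_pos (m := m) hα
  obtain ⟨C, hC, h⟩ := exists_kpow_bound (hN.le.trans hb) hK hKT
  refine ⟨C * (1 / 2 : ℝ) ^ (m + 2 + α - b), by positivity, fun z hz w hw => ?_⟩
  have hn := norm_rhoPair_pos hw (basePt_mem (m := m))
  rw [norm_kpow, norm_rhoPair_symm]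
  refine (h z hz w hw).trans ?_
  rw [mul_assoc]
  refine mul_le_mul_of_nonneg_left ?_ hC.le
  rw [show -b = (m + 2 + α - b) + -((m : ℝ) + 2 + α) by ring, Real.rpow_add hn]
  refine mul_le_mul_of_nonneg_right ?_ (by positivity)
  exact Real.rpow_le_rpow_of_nonpos (by norm_num) (half_le_norm_rhoPair hw) (by linarith)

theorem continuousOn_kpow_snd (b : ℝ) {z : Cn m} (hz : z ∈ TB m) :
    ContinuousOn (fun w => kpow b w z) (TB m) := by
  simp only [kpow]
  exact (continuous_rhoPair_right z).continuousOn.cpow_const fun w hw =>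
    rhoPair_mem_slitPlane hz hw

theorem aestronglyMeasurable_kpow_mul (b : ℝ) {μ : Measure (Cn m)} {g : Cn m → ℂ}
    (hg : AEStronglyMeasurable g (μ.restrict (TB m))) {z : Cn m} (hz : z ∈ TB m) :
    AEStronglyMeasurable (fun w => kpow b w z * g w) (μ.restrict (TB m)) :=
  ((continuousOn_kpow_snd b hz).aestronglyMeasurable measurableSet_TB).mul hg

theorem ToeplitzIntegrable.integrable_kpow {α b : ℝ} (hα : -1 < α) (hb : (m : ℝ) + 2 + α ≤ b)
    {μ : Measure (Cn m)} {g : Cn m → ℂ} (hg : ToeplitzIntegrable α μ g) {z : Cn m}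
    (hz : z ∈ TB m) : Integrable (fun w => kpow b w z * g w) (μ.restrict (TB m)) := by
  obtain ⟨C, hC, h⟩ := exists_kpow_dominated hα hb (isCompact_singleton (x := z))
    (singleton_subset_iff.2 hz)
  refine (hg.integrable_bound.const_mul C).mono' (aestronglyMeasurable_kpow_mul b hg.1 hz) ?_
  refine (ae_restrict_iff' measurableSet_TB).2 (Eventually.of_forall fun w hw => ?_)
  rw [norm_mul, ← mul_assoc]
  exact mul_le_mul_of_nonneg_right (h z rfl w hw) (norm_nonneg _)

/-- The factor ib/2 is the product of the exponent -b and the slope -i/2 of ρ(·, w) in the last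
coordinate. -/
theorem hasDerivAt_kpowInt {α b : ℝ} (hα : -1 < α) (hb : (m : ℝ) + 2 + α ≤ b)
    {μ : Measure (Cn m)} {g : Cn m → ℂ} (hg : ToeplitzIntegrable α μ g) {z : Cn m}
    (hz : z ∈ TB m) : HasDerivAt (fun s => kpowInt b μ g (shiftLast z s))
      (Complex.I * b / 2 * kpowInt (b + 1) μ g z) 0 := by
  have hr := mem_TB_iff.1 hz
  have hN := homogeneousDim_pos (m := m) hα
  have hK : IsCompact (shiftLast z '' Metric.closedBall 0 (rho z / 2)) :=
    (isCompact_closedBall _ _).image (continuous_shiftLast z)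
  have hKT : shiftLast z '' Metric.closedBall 0 (rho z / 2) ⊆ TB m := by
    rintro _ ⟨s, hs, rfl⟩
    exact shiftLast_mem hz (by simpa using hs)
  obtain ⟨C, hC, h⟩ := exists_kpow_dominated (b := b + 1) hα (by linarith) hK hKT
  have hmem : ∀ s ∈ Metric.ball (0 : ℂ) (rho z / 2), shiftLast z s ∈ TB m := fun s hs =>
    hKT (mem_image_of_mem _ (Metric.ball_subset_closedBall hs))
  have hder : ∀ w ∈ TB m, ∀ s ∈ Metric.ball (0 : ℂ) (rho z / 2),
      HasDerivAt (fun s => kpow b w (shiftLast z s) * g w)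
        (Complex.I * b / 2 * (kpow (b + 1) w (shiftLast z s) * g w)) s := by
    intro w hw s hs
    have h1 : HasDerivAt (fun s : ℂ => rhoPair z w - Complex.I / 2 * s) (-(Complex.I / 2)) s := by
      simpa using ((hasDerivAt_id s).const_mul (Complex.I / 2)).const_sub (rhoPair z w)
    have h2 := rhoPair_mem_slitPlane (hmem s hs) hw
    rw [rhoPair_shiftLast] at h2
    have h3 := (h1.cpow_const (c := ((-b : ℝ) : ℂ)) h2).mul_const (g w)
    simp only [kpow, rhoPair_shiftLast]
    convert! h3 using 1
    rw [show ((-(b + 1) : ℝ) : ℂ) = ((-b : ℝ) : ℂ) - 1 by push_cast; ring]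
    push_cast; ring
  have key := hasDerivAt_integral_of_dominated_loc_of_deriv_le (𝕜 := ℂ)
    (μ := μ.restrict (TB m)) (F := fun s w => kpow b w (shiftLast z s) * g w)
    (F' := fun s w => Complex.I * b / 2 * (kpow (b + 1) w (shiftLast z s) * g w))
    (bound := fun w => b / 2 * C * (‖rhoPair w (basePt m)‖ ^ (-((m : ℝ) + 2 + α)) * ‖g w‖))
    (x₀ := 0) (Metric.ball_mem_nhds 0 (half_pos hr)) ?_ ?_ ?_ ?_ (hg.integrable_bound.const_mul _) ?_
  · have := key.2
    rw [integral_const_mul] at this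
    simp only [shiftLast_zero] at this
    exact this
  · filter_upwards [Metric.ball_mem_nhds (0 : ℂ) (half_pos hr)] with s hs
    exact aestronglyMeasurable_kpow_mul b hg.1 (hmem s hs)
  · simp only [shiftLast_zero]
    exact hg.integrable_kpow hα hb hz
  · simp only [shiftLast_zero]
    exact (aestronglyMeasurable_kpow_mul (b + 1) hg.1 hz).const_mul _
  · refine (ae_restrict_iff' measurableSet_TB).2 (Eventually.of_forall fun w hw s hs => ?_)
    have h1 := h _ (mem_image_of_mem _ (Metric.ball_subset_closedBall hs)) w hw
    have hbn : ‖Complex.I * (b : ℂ) / 2‖ = b / 2 := by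
      rw [norm_div, norm_mul, Complex.norm_I, one_mul, Complex.norm_real, Real.norm_eq_abs,
        abs_of_nonneg (hN.le.trans hb)]
      simp
    rw [norm_mul, norm_mul, hbn, mul_assoc, ← mul_assoc C]
    have : 0 ≤ b := hN.le.trans hb
    gcongr
  · exact (ae_restrict_iff' measurableSet_TB).2 (Eventually.of_forall hder)

/-- Growth bounds pass from `b` to `b + 1`, by Cauchy's estimate. -/
theorem norm_kpowInt_succ_le {α b : ℝ} (hα : -1 < α) (hb : (m : ℝ) + 2 + α ≤ b)
    {μ : Measure (Cn m)} {g : Cn m → ℂ} (hg : ToeplitzIntegrable α μ g) {D x : ℝ} (hx : 0 ≤ x)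
    (hD0 : 0 ≤ D) (hD : ∀ z ∈ TB m, ‖kpowInt b μ g z‖ ≤ D * rho z ^ (-x)) {z : Cn m} (hz : z ∈ TB m) :
    ‖kpowInt (b + 1) μ g z‖ ≤ 4 * 2 ^ x / b * D * rho z ^ (-(x + 1)) := by
  have hr := mem_TB_iff.1 hz
  have hN := homogeneousDim_pos (m := m) hα
  have hb0 : 0 < b := hN.trans_le hb
  have hd : DifferentiableOn ℂ (fun s => kpowInt b μ g (shiftLast z s))
      (Metric.closedBall 0 (rho z / 2)) := by
    intro s hs
    have h1 := hasDerivAt_kpowInt hα hb hg (shiftLast_mem hz (s := s) (by simpa using hs))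
    simp only [shiftLast_add] at h1
    have h2 : HasDerivAt (fun s' : ℂ => s' - s) 1 s := (hasDerivAt_id s).sub_const s
    rw [← sub_self s] at h1
    have h3 := HasDerivAt.comp (h := fun s' => s' - s) s h1 h2
    refine (h3.congr_of_eventuallyEq (Eventually.of_forall fun s' => ?_)).differentiableAt.differentiableWithinAt
    simp
  have h1 := Complex.norm_deriv_le_of_forall_mem_sphere_norm_le
    (C := D * (2 ^ x * rho z ^ (-x))) (half_pos hr)
    (DifferentiableOn.diffContOnCl (by rwa [closure_ball _ (half_pos hr).ne'])) fun s hs => ?_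
  · rw [(hasDerivAt_kpowInt hα hb hg hz).deriv, norm_mul, norm_div, norm_mul, Complex.norm_I,
      one_mul, Complex.norm_real, Real.norm_eq_abs, abs_of_pos hb0, Complex.norm_ofNat] at h1
    rw [neg_add, Real.rpow_add hr, Real.rpow_neg_one]
    rw [div_mul_eq_mul_div, div_le_div_iff₀ two_pos (by positivity)] at h1
    rw [show 4 * 2 ^ x / b * D * (rho z ^ (-x) * (rho z)⁻¹) =
      4 * 2 ^ x * D * rho z ^ (-x) / (b * rho z) by field_simp, le_div_iff₀ (by positivity)]
    nlinarith
  -- On the circle of radius ρ(z)/2 the value of ρ is at least ρ(z)/2, which costs the factor 2^x.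
  · have hs' : ‖s‖ ≤ rho z / 2 := by simpa using (mem_sphere_zero_iff_norm.1 hs).le
    refine (hD _ (shiftLast_mem hz hs')).trans (mul_le_mul_of_nonneg_left ?_ hD0)
    calc rho (shiftLast z s) ^ (-x) ≤ (rho z / 2) ^ (-x) :=
          Real.rpow_le_rpow_of_nonpos (half_pos hr) (half_rho_le_rho_shiftLast hs') (by linarith)
      _ = 2 ^ x * rho z ^ (-x) := by
          rw [Real.div_rpow hr.le two_pos.le, Real.rpow_neg two_pos.le, div_inv_eq_mul, mul_comm]

theorem exists_kpowInt_growth {α x : ℝ} (hα : -1 < α) (hx : 0 ≤ x) (k : ℕ) :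
    ∃ C : ℝ, 0 ≤ C ∧ ∀ (μ : Measure (Cn m)) (g : Cn m → ℂ), ToeplitzIntegrable α μ g →
      ∀ D : ℝ, 0 ≤ D → (∀ z ∈ TB m, ‖kpowInt (m + 2 + α) μ g z‖ ≤ D * rho z ^ (-x)) →
        ∀ z ∈ TB m, ‖kpowInt (m + 2 + α + k) μ g z‖ ≤ C * D * rho z ^ (-(x + k)) := by
  have hN := homogeneousDim_pos (m := m) hα
  induction k with
  | zero => exact ⟨1, zero_le_one, fun μ g _ D _ h z hz => by simpa using h z hz⟩
  | succ k ih =>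
    obtain ⟨C, hC, h⟩ := ih
    have hk : (0 : ℝ) ≤ k := Nat.cast_nonneg k
    refine ⟨4 * 2 ^ (x + k) / (m + 2 + α + k) * C, by positivity, fun μ g hg D hD hgD z hz => ?_⟩
    have := norm_kpowInt_succ_le hα (by linarith) hg (add_nonneg hx hk) (mul_nonneg hC hD)
      (h μ g hg D hD hgD) hz
    push_cast
    rw [← add_assoc, ← add_assoc, mul_assoc (_ / _) C D]
    exact this

/-- The submean value property on a cell, whose scale is ρ(z)^N, after extracting the p-th root. -/
theorem exists_pointwise_bound {α p : ℝ} (hp : 1 ≤ p) [Fact (1 ≤ ENNReal.ofReal p)] :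
    ∃ C : ℝ, 0 ≤ C ∧ ∀ F : bergmanSpace m α p, ∀ z ∈ TB m,
      ‖holRep F z‖ ≤ C * ‖F‖ * rho z ^ (-((m + 2 + α) / p)) := by
  have hp0 : 0 < p := one_pos.trans_le hp
  obtain ⟨C, hC, h⟩ := exists_submean (m := m) α smallRadius_pos le_rfl hp
  refine ⟨(C ^ (1 / p)).toReal, ENNReal.toReal_nonneg, fun F z hz => ?_⟩
  have hr := mem_TB_iff.1 hz
  have h1 := (h _ (holRep_mem F).1 z hz).trans
    (mul_le_mul' le_rfl (setLIntegral_le_lintegral _ _))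
  rw [← enorm_rpow_eq_lintegral hp0, mul_assoc] at h1
  have h2 := ENNReal.rpow_le_rpow h1 (show 0 ≤ 1 / p by positivity)
  have hpp : ∀ a : ℝ≥0∞, (a ^ p) ^ (1 / p) = a := fun a => by
    rw [← ENNReal.rpow_mul, mul_one_div_cancel hp0.ne', ENNReal.rpow_one]
  rw [ENNReal.mul_rpow_of_nonneg _ _ (by positivity), ENNReal.mul_rpow_of_nonneg _ _ (by positivity),
    hpp, hpp, ofReal_rho_rpow_rpow hz] at h2
  have h3 := ENNReal.toReal_mono (ENNReal.mul_ne_top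
    (ENNReal.rpow_ne_top_of_nonneg (by positivity) hC)
    (ENNReal.mul_ne_top ENNReal.ofReal_ne_top enorm_ne_top)) h2
  rw [ENNReal.toReal_mul, ENNReal.toReal_mul, toReal_enorm, toReal_enorm,
    ENNReal.toReal_ofReal (by positivity), mul_one_div, neg_div] at h3
  refine h3.trans (le_of_eq ?_)
  ring

/-- The test functions decay like |ρ(w, 𝐢)|^(-b), which is why b must be at least t. -/
theorem memS_testFun {t b a : ℝ} (htb : t ≤ b) (hb : 0 ≤ b) {z : Cn m} (hz : z ∈ TB m) :
    MemS t (testFun b a z) := by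
  obtain ⟨C, hC, h⟩ := exists_kpow_bound hb (isCompact_singleton (x := z))
    (singleton_subset_iff.2 hz)
  have hr := mem_TB_iff.1 hz
  refine ⟨differentiableOn_testFun b a hz, rho z ^ (b - a) * (C * (1 / 2) ^ (t - b)),
    fun w hw => ?_⟩
  have hn := norm_rhoPair_pos hw (basePt_mem (m := m))
  rw [norm_testFun b a hz, mul_left_comm]
  refine mul_le_mul_of_nonneg_left ?_ (by positivity)
  calc ‖rhoPair w (basePt m)‖ ^ t * ‖rhoPair w z‖ ^ (-b)
      ≤ ‖rhoPair w (basePt m)‖ ^ t * (C * ‖rhoPair w (basePt m)‖ ^ (-b)) :=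
        mul_le_mul_of_nonneg_left (h z rfl w hw) (by positivity)
    _ = C * ‖rhoPair w (basePt m)‖ ^ (t - b) := by
        rw [sub_eq_add_neg, Real.rpow_add hn]; ring
    _ ≤ _ := mul_le_mul_of_nonneg_left (Real.rpow_le_rpow_of_nonpos (by norm_num)
        (half_le_norm_rhoPair hw) (by linarith)) hC.le

theorem kpow_swap (b : ℝ) {z w : Cn m} (hz : z ∈ TB m) (hw : w ∈ TB m) :
    kpow b w z = star (kpow b z w) := by
  have h := rhoPair_mem_slitPlane hw hz
  rw [kpow, kpow, rhoPair_symm]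
  have h1 := Complex.conj_cpow (rhoPair w z) ((-b : ℝ) : ℂ) (Complex.slitPlane_arg_ne_pi h)
  rw [Complex.conj_ofReal] at h1
  exact h1

/-- The two powers are conjugate to each other exactly because their exponents agree, so the product
is positive. -/
theorem kpow_mul_testFun (b a : ℝ) {z w : Cn m} (hz : z ∈ TB m) (hw : w ∈ TB m) :
    kpow b w z * testFun b a z w =
      ((rho z ^ (b - a) * ‖rhoPair w z‖ ^ (-(2 * b)) : ℝ) : ℂ) := by
  have hn := norm_rhoPair_pos hw hz
  rw [testFun, kpow_swap b hz hw, mul_left_comm]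
  have : star (kpow b z w) * kpow b z w = ((‖kpow b z w‖ ^ 2 : ℝ) : ℂ) := by
    rw [mul_comm, Complex.star_def, Complex.mul_conj, Complex.normSq_eq_norm_sq]
  rw [this, norm_kpow, ← Complex.ofReal_mul]
  congr 2
  rw [← Real.rpow_natCast, ← Real.rpow_mul hn.le]
  congr 1; push_cast; ring

/-- Test functions detect the averages of `μ`. -/
theorem exists_lintegral_le_norm_toeplitz {α p t : ℝ} (hα : -1 < α) (hp : 1 < p)
    [Fact (1 ≤ ENNReal.ofReal p)] (k : ℕ) (ht : t ≤ m + 2 + α + k) :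
    ∃ C : ℝ≥0∞, C ≠ ⊤ ∧ ∀ (μ : Measure (Cn m)), HasDecay t μ →
      ∀ z ∈ TB m, ∀ G : bergmanSpace m α p,
        EqOn (holRep G) (toeplitz α μ (testFun (m + 2 + α + k) ((m + 2 + α) / p) z)) (TB m) →
        ∫⁻ w in TB m, ENNReal.ofReal (rho z ^ (2 * (m + 2 + α + k) - (m + 2 + α)) *
          ‖rhoPair w z‖ ^ (-(2 * (m + 2 + α + k)))) ∂μ ≤ C * ‖G‖ₑ := by
  have hN := homogeneousDim_pos (m := m) hα
  have hp0 : 0 < p := one_pos.trans hp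
  have hc := kernelConst_pos (m := m) hα
  set N := (m : ℝ) + 2 + α with hNdef
  have hk : (0 : ℝ) ≤ k := Nat.cast_nonneg k
  obtain ⟨C₁, hC₁, h₁⟩ := exists_pointwise_bound (m := m) (α := α) hp.le
  obtain ⟨C₂, hC₂, h₂⟩ := exists_kpowInt_growth (m := m) hα (div_pos hN hp0).le k
  refine ⟨ENNReal.ofReal (C₂ * (C₁ / kernelConst m α)), ENNReal.ofReal_ne_top,
    fun μ hμ z hz G hG => ?_⟩
  have hr := mem_TB_iff.1 hz
  set f := testFun (N + k) (N / p) z with hf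
  have hfI : ToeplitzIntegrable α μ f :=
    ToeplitzIntegrable.of_memS hα hμ (memS_testFun ht (by positivity) hz)
  -- Elements of the Bergman space grow at most like ρ^(-N/p); after k derivatives in z_n the bound
  -- is ρ^(-(N/p + k)), evaluated at the point z of the test function.
  have h3 := h₂ μ f hfI (C₁ / kernelConst m α * ‖G‖) (by positivity) (fun ζ hζ => by
    have h4 := h₁ G ζ hζ
    rw [hG hζ, toeplitz_eq_kpowInt, norm_mul, Complex.norm_real, Real.norm_eq_abs,
      abs_of_pos hc] at h4
    rw [div_mul_eq_mul_div, div_mul_eq_mul_div, le_div_iff₀ hc, mul_comm]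
    exact h4) z hz
  have hint := hfI.integrable_kpow hα (b := N + k) (by linarith) hz
  set φ : Cn m → ℝ := fun w => rho z ^ (N + k - N / p) * ‖rhoPair w z‖ ^ (-(2 * (N + k))) with hφ
  have hφ0 : ∀ w, 0 ≤ φ w := fun w => by simp only [hφ]; positivity
  have heq : ∀ w ∈ TB m, kpow (N + k) w z * f w = (φ w : ℂ) := fun w hw =>
    kpow_mul_testFun (N + k) (N / p) hz hw
  have hφi : Integrable φ (μ.restrict (TB m)) := by
    refine hint.norm.congr ?_
    refine (ae_restrict_iff' measurableSet_TB).2 (Eventually.of_forall fun w hw => ?_)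
    simp only [heq w hw, Complex.norm_real, Real.norm_eq_abs, abs_of_nonneg (hφ0 w)]
  have h5 : kpowInt (N + k) μ f z = ((∫ w in TB m, φ w ∂μ : ℝ) : ℂ) := by
    rw [kpowInt, ← integral_complex_ofReal]
    exact setIntegral_congr_fun measurableSet_TB heq
  rw [h5, Complex.norm_real, Real.norm_eq_abs, abs_of_nonneg (integral_nonneg hφ0)] at h3
  -- The factor ρ(z)^(N/p + k) that completes the exponent is precisely the inverse of the growth
  -- bound.
  have h6 : ∀ w, ENNReal.ofReal (rho z ^ (2 * (N + k) - N) * ‖rhoPair w z‖ ^ (-(2 * (N + k)))) =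
      ENNReal.ofReal (rho z ^ (N / p + k)) * ENNReal.ofReal (φ w) := fun w => by
    rw [← ENNReal.ofReal_mul (by positivity), hφ]
    simp only
    rw [← mul_assoc, ← Real.rpow_add hr]
    congr 3; ring
  simp only [h6]
  rw [lintegral_const_mul' _ _ ENNReal.ofReal_ne_top,
    ← ofReal_integral_eq_lintegral_ofReal hφi (Eventually.of_forall hφ0),
    ← ENNReal.ofReal_mul (by positivity), ← ofReal_norm G, ← ENNReal.ofReal_mul (by positivity)]
  refine ENNReal.ofReal_le_ofReal ?_
  calc rho z ^ (N / p + k) * ∫ w in TB m, φ w ∂μ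
      ≤ rho z ^ (N / p + k) * (C₂ * (C₁ / kernelConst m α * ‖G‖) * rho z ^ (-(N / p + k))) :=
        mul_le_mul_of_nonneg_left h3 (by positivity)
    _ = (rho z ^ (N / p + k) * rho z ^ (-(N / p + k))) * (C₂ * (C₁ / kernelConst m α * ‖G‖)) := by
        ring
    _ = _ := by rw [← Real.rpow_add hr, add_neg_cancel, Real.rpow_zero]; ring

theorem absKer_le_basePt {α : ℝ} (hα : -1 < α) {z : Cn m} (hz : z ∈ TB m) :
    ∃ C : ℝ≥0∞, C ≠ ⊤ ∧ ∀ w ∈ TB m, absKer α z w ≤ C * absKer α (basePt m) w := by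
  obtain ⟨C, hC, h⟩ := exists_kpow_bound (homogeneousDim_pos (m := m) hα).le
    (isCompact_singleton (x := z)) (singleton_subset_iff.2 hz)
  refine ⟨ENNReal.ofReal C, ENNReal.ofReal_ne_top, fun w hw => ?_⟩
  rw [absKer, absKer, ← ENNReal.ofReal_mul hC.le]
  exact ENNReal.ofReal_le_ofReal (h z rfl w hw)

/-- `T_μ` maps bounded families that tend to `0` locally uniformly to families that tend to `0`
pointwise. -/
theorem tendsto_toeplitz_zero {ι : Type*} {l : Filter ι} {α s p : ℝ} (hα : -1 < α) (hs0 : 0 < s)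
    (hp : 1 < p) {μ : Measure (Cn m)} (hμ : SFinite (μ.restrict (TB m))) {M : ℝ≥0∞} (hM : M ≠ ⊤)
    (hb : ∀ u ∈ TB m, cellAvg α s μ u ≤ M) {F : ι → Cn m → ℂ} {B : ℝ≥0∞} (hB : B ≠ ⊤)
    (hFd : ∀ᶠ i in l, DifferentiableOn ℂ (F i) (TB m))
    (hFB : ∀ᶠ i in l, ∫⁻ u, ‖F i u‖ₑ ^ p ∂Valpha m α ≤ B)
    (hF0 : ∀ ε > 0, ∀ R : ℝ, ∀ η : ℝ≥0∞, 0 < η → ∀ᶠ i in l, ∀ z ∈ core m ε R, ‖F i z‖ₑ ≤ η)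
    {z : Cn m} (hz : z ∈ TB m) : Tendsto (fun i => toeplitz α μ (F i) z) l (𝓝 0) := by
  have hp0 : 0 < p := one_pos.trans hp
  obtain ⟨a, M', hM', haM, ha, C, hC, h⟩ := exists_lintegral_absKer_basePt_le hα hs0 hp hμ hM hb
  obtain ⟨C', hC', h'⟩ := absKer_le_basePt (m := m) hα hz
  have h1 := tendsto_lintegral_weight hp0 hM' haM ha hB hFB hF0
  have h2 := (ENNReal.continuous_rpow_const (y := 1 / p)).tendsto 0 |>.comp h1
  rw [ENNReal.zero_rpow_of_pos (by positivity)] at h2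
  have hk : ENNReal.ofReal (kernelConst m α) * (C' * C) ≠ ⊤ :=
    ENNReal.mul_ne_top ENNReal.ofReal_ne_top (ENNReal.mul_ne_top hC' hC)
  have h3 := ENNReal.Tendsto.const_mul h2 (Or.inr hk)
  rw [mul_zero] at h3
  rw [tendsto_zero_iff_enorm_tendsto_zero]
  refine tendsto_of_tendsto_of_tendsto_of_le_of_le' tendsto_const_nhds h3
    (Eventually.of_forall fun _ => zero_le) ?_
  filter_upwards [hFd] with i hi
  refine (enorm_toeplitz_le hα μ _ z).trans ?_
  rw [mul_assoc, mul_assoc]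
  refine mul_le_mul' le_rfl ?_
  calc ∫⁻ w in TB m, absKer α z w * ‖F i w‖ₑ ∂μ
      ≤ ∫⁻ w in TB m, C' * (absKer α (basePt m) w * ‖F i w‖ₑ) ∂μ := by
        refine setLIntegral_mono' measurableSet_TB fun w hw => ?_
        rw [← mul_assoc]
        exact mul_le_mul' (h' w hw) le_rfl
    _ = C' * ∫⁻ w in TB m, absKer α (basePt m) w * ‖F i w‖ₑ ∂μ := lintegral_const_mul' _ _ hC'
    _ ≤ _ := mul_le_mul' le_rfl (h _ hi)

theorem isCompact_closure_image_of_isCompactOperator {E F : Type*} [NormedAddCommGroup E]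
    [NormedSpace ℂ E] [NormedAddCommGroup F] [NormedSpace ℂ F] {T : E →L[ℂ] F}
    (hT : IsCompactOperator T) (R : ℝ) : IsCompact (closure (T '' Metric.closedBall 0 R)) :=
  IsCompactOperator.isCompact_closure_image_closedBall (f := (T : E →ₗ[ℂ] F)) hT R

theorem averaging_tendsto_of_toeplitzCompact {α r p t : ℝ} (hr : 0 < r) (hα : -1 < α) (hp : 1 < p)
    {μ : Measure (Cn m)} (hμ : HasDecay t μ) (h : ToeplitzCompact α p t hp μ) :
    Tendsto (averaging α r μ) (toBoundary m) (𝓝 0) := by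
  have : Fact (1 ≤ ENNReal.ofReal p) := ⟨ENNReal.one_le_ofReal.2 hp.le⟩
  obtain ⟨T, hTc, hT⟩ := h
  have hN := homogeneousDim_pos (m := m) hα
  have hp0 : 0 < p := one_pos.trans hp
  set N := (m : ℝ) + 2 + α with hNdef
  -- T is known to be the integral operator only on S_t, so k is taken with N + k ≥ t.
  obtain ⟨k, hk⟩ := exists_nat_ge (t - N)
  have hk0 : (0 : ℝ) ≤ k := Nat.cast_nonneg k
  have htb : t ≤ N + k := by linarith
  have hap : N / p * p = m + 2 + α := div_mul_cancel₀ _ hp0.ne'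
  have hab : N / p < N + k := (div_lt_self hN hp).trans_le (by linarith)
  have hsf := sFinite_restrict hμ
  obtain ⟨C₁, hC₁, h₁⟩ := exists_lintegral_le_norm_toeplitz (m := m) (p := p) hα hp k htb
  obtain ⟨C₂, hC₂, h₂⟩ := exists_averaging_le (m := m) α (x := 2 * (N + k)) hr (by positivity)
  obtain ⟨s, hs0, hs, C₃, hC₃, h₃⟩ := exists_cellAvg_le_averaging (m := m) α hr
  set f : Cn m → bergmanSpace m α p := fun z => open Classical in
    if hz : z ∈ TB m then toBergman (memBergman_testFun hα hp0 hap hab hz) else 0 with hf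
  have hfz : ∀ {z} (hz : z ∈ TB m), f z = toBergman (memBergman_testFun hα hp0 hap hab hz) :=
    fun hz => dif_pos hz
  set B := kernelIntegral α ((N + k) * p) (basePt m) with hBdef
  have hB : B ≠ ⊤ := (testFun_lintegral_lt_top hα hp0 hap hab).ne
  have hfB : ∀ z, ‖f z‖ ≤ (B ^ (1 / p)).toReal := by
    intro z
    by_cases hz : z ∈ TB m
    · have e : ‖f z‖ₑ ^ p = B := by
        rw [hfz hz, enorm_rpow_eq_lintegral_of_ae_eq hp0 _ (toBergman_coeFn _),
          lintegral_testFun hp0.le hap hz]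
      have e' : ‖f z‖ₑ = B ^ (1 / p) := by
        rw [← e, ← ENNReal.rpow_mul, mul_one_div_cancel hp0.ne', ENNReal.rpow_one]
      rw [← e', toReal_enorm]
    · rw [show f z = 0 from dif_neg hz, norm_zero]
      exact ENNReal.toReal_nonneg
  have hTf : ∀ z ∈ TB m, EqOn (holRep (T (f z))) (toeplitz α μ (testFun (N + k) (N / p) z))
      (TB m) := by
    intro z hz
    have hS := memS_testFun (a := N / p) htb (hN.le.trans (by linarith)) hz
    refine holRep_eqOn _ (((ToeplitzIntegrable.of_memS hα hμ hS).differentiableOn hα).continuousOn)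
      (hT _ _ hS ?_)
    rw [hfz hz]
    exact toBergman_coeFn _
  have hle : ∀ z ∈ TB m, averaging α r μ z ≤ C₂ * C₁ * ‖T (f z)‖ₑ := by
    intro z hz
    rw [mul_assoc]
    exact (h₂ μ z hz).trans (mul_le_mul' le_rfl (h₁ μ hμ z hz _ (hTf z hz)))
  set b₀ := (B ^ (1 / p)).toReal with hb₀
  have hC₁₂ : C₂ * C₁ ≠ ⊤ := ENNReal.mul_ne_top hC₂ hC₁
  -- Boundedness of T alone already bounds the averages. This is needed before the limit, because
  -- pointwise convergence of T f_z rests on it.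
  have hcell : ∀ u ∈ TB m, cellAvg α s μ u ≤ C₃ * (C₂ * C₁ * ENNReal.ofReal (‖T‖ * b₀)) := by
    intro u hu
    refine (h₃ μ u hu).trans (mul_le_mul' le_rfl ((hle u hu).trans (mul_le_mul' le_rfl ?_)))
    rw [← ofReal_norm]
    exact ENNReal.ofReal_le_ofReal (T.le_opNorm_of_le (hfB u))
  have hM : C₃ * (C₂ * C₁ * ENNReal.ofReal (‖T‖ * b₀)) ≠ ⊤ :=
    ENNReal.mul_ne_top hC₃ (ENNReal.mul_ne_top hC₁₂ ENNReal.ofReal_ne_top)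
  have hpt : ∀ ζ ∈ TB m, Tendsto (fun z => holRep (T (f z)) ζ) (toBoundary m) (𝓝 0) := by
    intro ζ hζ
    refine (tendsto_toeplitz_zero hα hs0 hp hsf hM hcell hB
      (F := fun z => testFun (N + k) (N / p) z)
      (eventually_mem_TB.mono fun z hz => differentiableOn_testFun _ _ hz)
      (eventually_mem_TB.mono fun z hz => (lintegral_testFun hp0.le hap hz).le)
      (fun ε hε R η hη => testFun_small_enorm (div_pos hN hp0) hab hε R hη) hζ).congr' ?_
    filter_upwards [eventually_mem_TB] with z hz using (hTf z hz hζ).symm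
  have hcomp : IsCompact (closure (T '' Metric.closedBall 0 b₀)) :=
    isCompact_closure_image_of_isCompactOperator hTc b₀
  -- The images T f_z lie in a relatively compact set and tend to 0 at each point. Evaluations are
  -- continuous and separate elements, so every limit of a subsequence is 0.
  have hlim : Tendsto (fun z => T (f z)) (toBoundary m) (𝓝 0) := by
    refine tendsto_of_seq_tendsto fun u hu => tendsto_of_subseq_tendsto fun ns hns => ?_
    obtain ⟨g, -, φ, hφ, hg⟩ := hcomp.tendsto_subseq (x := fun n => T (f (u (ns n))))
      fun n => subset_closure (mem_image_of_mem T (by simpa using hfB _))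
    refine ⟨φ, ?_⟩
    suffices hg0 : g = 0 by rw [← hg0]; exact hg
    have hz0 : ∀ G : bergmanSpace m α p, (∀ ζ ∈ TB m, holRep G ζ = 0) → G = 0 := fun G hG => by
      refine bergmanSpace_ext fun ζ hζ => ?_
      have := holRep_smul 0 (0 : bergmanSpace m α p) hζ
      rw [zero_smul, zero_smul, Pi.zero_apply] at this
      rw [this, hG ζ hζ]
    refine hz0 g fun ζ hζ => ?_
    obtain ⟨L, hL⟩ := exists_evalCLM (m := m) (α := α) (p := p) hα hp.le hζ
    have h1 := (L.continuous.tendsto g).comp hg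
    have h2 := (hpt ζ hζ).comp (hu.comp (hns.comp hφ.tendsto_atTop))
    rw [← hL]
    refine tendsto_nhds_unique h1 (h2.congr fun n => ?_)
    simp only [Function.comp_apply, hL]
  refine tendsto_averaging_of_le hC₁₂ hle ?_
  exact tendsto_zero_iff_enorm_tendsto_zero.1 hlim

end Necessity

end TubeBergman

end

/-! ### The equivalence of the four conditions. -/

theorem theorem6p2 (m : ℕ) (r p q α : ℝ) (hr : 0 < r) (hp : 1 < p) (hq : 1 < q) (hα : -1 < α)
    (μ : MeasureTheory.Measure (Cn m)) (hμ : μ ∈ MPlus m)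
    (t : ℝ) (ht : ((m : ℝ) + 1) + (α + 1) / p < t) (htμ : HasDecay t μ) :
    List.TFAE [
      ToeplitzCompact α p t hp μ,
      BerezinMemC0 α μ,
      Tendsto (averaging α r μ) (toBoundary m) (𝓝 0),
      VanishingCarleson α q μ] := by
  have ht0 : 0 ≤ t := by
    have h1 : (0 : ℝ) ≤ m := Nat.cast_nonneg m
    have h2 : 0 ≤ (α + 1) / p := div_nonneg (by linarith) (by linarith)
    linarith
  -- Condition 3 is the hub. It is used through the averages over cells of a radius s so small that
  -- they fit into the Bergman balls of radius r.
  obtain ⟨s, hs0, hs, C, hC, hle⟩ := exists_cellAvg_le_averaging (m := m) α hr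
  have hcell : Tendsto (averaging α r μ) (toBoundary m) (𝓝 0) →
      Tendsto (cellAvg α s μ) (toBoundary m) (𝓝 0) := fun h => by
    have h2 := ENNReal.Tendsto.const_mul h (Or.inr hC)
    rw [mul_zero] at h2
    exact tendsto_of_tendsto_of_tendsto_of_le_of_le' tendsto_const_nhds h2
      (Eventually.of_forall fun _ => zero_le) (eventually_mem_TB.mono (hle μ))
  tfae_have 1 → 3 := averaging_tendsto_of_toeplitzCompact hr hα hp htμ
  tfae_have 2 → 3 := averaging_tendsto_of_berezin hr hα
  tfae_have 4 → 3 := averaging_tendsto_of_vanishingCarleson hr hα hq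
  tfae_have 3 → 1 := fun h => toeplitzCompact_of_cellAvg hα hs0 hs ht0 hp htμ (hcell h)
  tfae_have 3 → 2 := fun h => berezinMemC0_of_cellAvg hα hs0 hs ht0 htμ (hcell h)
  tfae_have 3 → 4 := fun h => vanishingCarleson_of_cellAvg hα hq hs0 hs ht0 htμ (hcell h)
  tfae_finish
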